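/- **Setting.** Let $p>0$, $\alpha=2/(1+p)$, $c(\theta)=\cos\theta|\cos\theta|^p$, $s(\theta)=\sin\theta|\sin\theta|^p$. Let $\mu_0$ be a probability measure on $\mathbb R$ with distribution function $F_0$ and characteristic function $\phi_0$, and let $\mu(\cdot,t)$, $t\ge 0$, be probability measures with distribution functions $F(\cdot,t)$ whose characteristic functions $\phi(\xi,t)$ solve $$\frac{\partial}{\partial t}\phi(\xi,t)=\frac1{2\pi}\int_0^{2\pi}\phi(\xi s(\theta),t)\,\phi(\xi c(\theta),t)\,d\theta-\phi(\xi,t)\quad(t>0),\qquad \phi(\xi,0)=\phi_0(\xi)$$ (with $t\mapsto\phi(\xi,t)$ continuous at $t=0$). Let $a_0>0$, let $G_\alpha$ be the symmetric stable law (and its distribution function) with characteristic function $e^{-a_0|\xi|^\alpha}$ and density $g_\alpha$, and put $\|g_\alpha\|=\sup_x|g_\alpha(x)|$. Assume that $F_0$ belongs to the domain of normal attraction of $G_\alpha$: for i.i.d. $X_1,X_2,\dots$ with law $\mu_0$ there are real constants $m_n$ such that $n^{-1/\alpha}\sum_{i=1}^nX_i-m_n$ converges in distribution to $G_\alpha$.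 **Random weights.** For $t\ge0$ let $\nu_t\in\{1,2,\dots\}$ have law $P_t(\nu_t=n)=e^{-t}(1-e^{-t})^{n-1}$. Given $\nu_t=n$, let $\gamma_t$ be a random binary tree with $n$ leaves, every node having zero or two children, with law $p_n$, where $p_1=1$ and $p_n(g)=\frac1{n-1}p_{n-j}(l)\,p_j(r)$ if $g$ has left subtree $l$ with $n-j$ leaves and right subtree $r$ with $j$ leaves. Attach to the internal nodes independent angles uniform on $[0,2\pi)$, independent of $(\nu_t,\gamma_t)$. For the $j$-th leaf, from left to right, let $\beta_{j,t}$ be the product, along the path from the root to the leaf, of $c(\theta)$ for each step to a left child and $s(\theta)$ for each step to a right child, $\theta$ being the angle at the parent ($\beta_{1,t}=1$ if $\nu_t=1$). Let $\beta_{(\nu_t)}=\max_{1\le j\le\nu_t}|\beta_{j,t}|$, and let $E_t$ denote expectation under $P_t$. **Constants.** Define $v_0^*$ by $1-\mathrm{Re}\,\phi_0(\xi)=(a_0+v_0^*(\xi))|\xi|^\alpha$ for $\xi\ne0$ and $v_0^*(0)=0$. Put $M=a_0+\sup_{\xi\ge0}|v_0^*(\xi)|$ and $\bar v_0^*(\xi)=\sup_{0\le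 x\le\xi}|v_0^*(x)|$. Given $\eta\in(0,a_0)$, call $d\in(0,1)$ admissible if, with $\tilde d=(3d/(8M))^{1/\alpha}$, one has $\frac45M^2|x|^\alpha+\bar v_0^*(|x|)\le\eta$ whenever $|x|\le\tilde d$. Put $$H(\xi,q)=|v_0^*(\xi q)|\,(1+2|\xi|^\alpha|v_0^*(\xi q)|),\qquad N_l=\int_0^\infty e^{-(a_0-\eta)\xi^\alpha}\xi^{l-1}d\xi,\qquad A_m=\frac1{2\pi}\int_0^{2\pi}|\sin\theta|^md\theta,$$ and $K(F,G)=\sup_{x\in\mathbb R}|F(x)-G(x)|$. Call $\mathbf c$ a Berry–Esseen constant if $$K(F,G)\le\frac1\pi\int_{-T}^T\Big|\frac{\phi_F(\xi)-\phi_G(\xi)}{\xi}\Big|d\xi+\frac{\mathbf c\,m}{T}$$ for all $T>0$ and all probability distribution functions $F,G$ on $\mathbb R$, with characteristic functions $\phi_F,\phi_G$, such that $G$ is differentiable with $|G'|\le m$ and the integral is finite. **Theorem.** Berry–Esseen constants exist. Let $\mathbf c$ be any of them. Then, under the above assumptions, for every $\eta\in(0,a_0)$ there are admissible $d$, and for every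 admissible $d$ and every $t\ge0$ $$\begin{aligned}K(F(\cdot,t),G_\alpha)\le{}&\frac2\pi E_t\Big[\sum_{j=1}^{\nu_t}|\beta_{j,t}|^\alpha\int_0^{\infty}H(\xi,|\beta_{j,t}|)\,\xi^{\alpha-1}e^{-(a_0-\eta)\xi^\alpha}d\xi\Big]+\frac{\mathbf c\,\|g_\alpha\|}{\tilde d}E_t(\beta_{(\nu_t)})\\&+\frac8{5\pi}M^2N_{2\alpha}e^{-t(1-2A_4)}+\frac{64}{25\pi}M^4N_{4\alpha}e^{-t(1-2A_6)}\\&+\frac{e^{-t}}2\sup_{x\in\mathbb R}|F_0(x)+F_0(-x-0)-1|,\end{aligned}$$ where $F_0(-x-0)$ is the left limit of $F_0$ at $-x$. Moreover, the right-hand side tends to $0$ as $t\to+\infty$. -/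

import Mathlib

open MeasureTheory ProbabilityTheory Filter Topology Set

noncomputable section

namespace InelasticKac

/-! ### The collision functions and the kinetic equation -/

/-- `c(θ) = cos θ |cos θ|^p`. -/
def cosP (p θ : ℝ) : ℝ := Real.cos θ * |Real.cos θ| ^ p

/-- `s(θ) = sin θ |sin θ|^p`. -/
def sinP (p θ : ℝ) : ℝ := Real.sin θ * |Real.sin θ| ^ p

/-- The characteristic exponent `α = 2 / (1 + p)`. -/
def alpha (p : ℝ) : ℝ := 2 / (1 + p)

/-- The family of probability measures `μ t`, `t ≥ 0`, solves the one-dimensional inelastic kinetic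
equation with initial datum `μ₀`: its characteristic functions `φ(ξ, t)` satisfy
`∂φ/∂t (ξ, t) = (1 / 2π) ∫_0^{2π} φ(ξ s(θ), t) φ(ξ c(θ), t) dθ - φ(ξ, t)` for `t > 0`,
and `φ(ξ, t) → φ(ξ, 0) = φ₀(ξ)` as `t ↓ 0`. The values of `μ` at negative times play no role. -/
structure IsSolution (p : ℝ) (μ₀ : Measure ℝ) (μ : ℝ → Measure ℝ) : Prop where
  initial : μ 0 = μ₀
  continuous_zero : ∀ ξ : ℝ, ContinuousWithinAt (fun t => charFun (μ t) ξ) (Ici 0) 0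
  evolution : ∀ t : ℝ, 0 < t → ∀ ξ : ℝ,
    HasDerivAt (fun τ => charFun (μ τ) ξ)
      ((1 / (2 * (Real.pi : ℂ))) *
          (∫ θ in (0 : ℝ)..(2 * Real.pi),
            charFun (μ t) (ξ * sinP p θ) * charFun (μ t) (ξ * cosP p θ))
        - charFun (μ t) ξ) t

/-! ### Stable laws, domain of normal attraction, Kolmogorov distance -/

/-- The probability measure `G` is the symmetric stable law with characteristic function
`exp (-a₀ |ξ|^α)`. -/
def IsSymmetricStable (α a₀ : ℝ) (G : Measure ℝ) : Prop :=
  ∀ ξ : ℝ, charFun G ξ = ((Real.exp (-(a₀ * |ξ| ^ α)) : ℝ) : ℂ)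

/-- `μ₀` belongs to the domain of normal attraction of the law `G` of exponent `α`: if
`X_1, X_2, …` are i.i.d. with law `μ₀`, then, for suitable real constants `m_n`,
`(X_1 + ⋯ + X_n) / n^{1/α} - m_n` converges in distribution to `G`. -/
def InDomainOfNormalAttraction (α : ℝ) (μ₀ G : Measure ℝ) [IsProbabilityMeasure μ₀]
    [IsProbabilityMeasure G] : Prop :=
  ∃ m : ℕ → ℝ,
    TendstoInDistribution
      (fun (n : ℕ) (x : ℕ → ℝ) =>
        (∑ i ∈ Finset.range n, x i) / (n : ℝ) ^ (1 / α) - m n)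
      atTop (id : ℝ → ℝ) (fun _ => Measure.infinitePi (fun _ : ℕ => μ₀)) G

/-- The Kolmogorov distance `sup_x |F(x) - G(x)|` between the distribution functions of two
probability measures. -/
def kolmogorovDist (μ ν : Measure ℝ) : ℝ := ⨆ x : ℝ, |cdf μ x - cdf ν x|

/-- `‖g‖ = sup_x |g(x)|`, where `g` is the derivative of the distribution function of `G`. -/
def densitySupNorm (G : Measure ℝ) : ℝ := ⨆ x : ℝ, |deriv (fun y => cdf G y) x|

/-- `c` is a constant with which the Berry–Esseen smoothing inequality holds: for all probability
measures `μ`, `ν` on the line such that the distribution function of `ν` is everywhere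
differentiable with derivative bounded by `m`, and for all `T > 0`,
`sup_x |F_μ(x) - F_ν(x)| ≤ (1/π) ∫_{-T}^{T} |(φ_μ(ξ) - φ_ν(ξ)) / ξ| dξ + c m / T`
(where the integral is finite; otherwise there is nothing to assert). -/
def IsBerryEsseenConstant (c : ℝ) : Prop :=
  ∀ (μ ν : Measure ℝ) (m T : ℝ), IsProbabilityMeasure μ → IsProbabilityMeasure ν → 0 < T →
    Differentiable ℝ (fun x => cdf ν x) → (∀ x : ℝ, |deriv (fun y => cdf ν y) x| ≤ m) →
    IntervalIntegrable (fun ξ : ℝ => ‖(charFun μ ξ - charFun ν ξ) / (ξ : ℂ)‖) volume (-T) T →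
    kolmogorovDist μ ν ≤
      (1 / Real.pi) * (∫ ξ in (-T)..T, ‖(charFun μ ξ - charFun ν ξ) / (ξ : ℂ)‖) + c * m / T

/-! ### The random weights

A tree is a finite binary tree in which every node has zero or two children. It is
encoded by its internal nodes: `nil` is a leaf, `node () l r` is a node with left subtree `l` and
right subtree `r`. A tree with `m` internal nodes has `m + 1` leaves. -/

instance : MeasurableSpace (BinaryTree Unit) := ⊤

/-- The probability `p_n` on the set of trees with `n` leaves: the number of leaves in the left
subtree is uniform on `{1, …, n - 1}` and, given it, the two subtrees are independent and distributed
in the same way. Thus `p_1 = 1` and `p_n(g) = p_{n-j}(l) p_j(r) / (n - 1)` if `g` has left subtree `l` and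
right subtree `r`; here `n - 1` is the number of internal nodes of `g`. -/
def treeProb : BinaryTree Unit → ℝ
  | .nil => 1
  | .node _ l r => treeProb l * treeProb r / ((l.numNodes + r.numNodes + 1 : ℕ) : ℝ)

/-- The law of the random tree `γ_t`: the number of leaves `ν_t` equals `n = m + 1` with probability
`e^{-t} (1 - e^{-t})^{n-1}`, and given `ν_t = n` the tree is distributed according to `p_n`. -/
def treeLaw (t : ℝ) : Measure (BinaryTree Unit) :=
  Measure.sum fun m : ℕ =>
    ENNReal.ofReal (Real.exp (-t) * (1 - Real.exp (-t)) ^ m) •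
      ∑ g ∈ BinaryTree.treesOfNumNodesEq m, ENNReal.ofReal (treeProb g) • Measure.dirac g

/-- The uniform law on `[0, 2π)`. -/
def angleLaw : Measure ℝ := volume[|Ico (0 : ℝ) (2 * Real.pi)]

/-- The joint law under `P_t` of the random tree and of the independent sequence of
i.i.d. angles, uniform on `[0, 2π)`. -/
def treeAngleLaw (t : ℝ) : Measure (BinaryTree Unit × (ℕ → ℝ)) :=
  (treeLaw t).prod (Measure.infinitePi fun _ : ℕ => angleLaw)

/-- The weights `β_1, …, β_n` attached to the leaves (from left to right) of a tree. The internal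
nodes are numbered in preorder, and `θ k` is the angle at the `k`-th one. The weight of a
leaf is the product, along the path from the root to the leaf, of `c(θ)` for each step to a left
child and of `s(θ)` for each step to a right child, `θ` being the angle at the parent. -/
def weights (p : ℝ) : BinaryTree Unit → (ℕ → ℝ) → List ℝ
  | .nil, _ => [1]
  | .node _ l r, θ =>
      (weights p l (fun k => θ (k + 1))).map (fun b => cosP p (θ 0) * b) ++
        (weights p r (fun k => θ (k + 1 + l.numNodes))).map (fun b => sinP p (θ 0) * b)

/-- The expectation `E_t[∑_{j=1}^{ν_t} f(|β_j|)]`. -/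
def expectSum (p t : ℝ) (f : ℝ → ℝ) : ℝ :=
  ∫ ω, ((weights p ω.1 ω.2).map fun b => f |b|).sum ∂(treeAngleLaw t)

/-- The maximum `max_j |b_j|` of the absolute values of the members of a nonempty list. -/
def maxAbs (L : List ℝ) : ℝ := (L.map fun b => |b|).foldr max 0

/-- The expectation `E_t[max_{1 ≤ j ≤ ν_t} |β_j|]`. -/
def expectMax (p t : ℝ) : ℝ := ∫ ω, maxAbs (weights p ω.1 ω.2) ∂(treeAngleLaw t)

/-! ### The quantities in the bound -/

/-- The function `v₀*` defined by `1 - Re φ₀(ξ) = (a₀ + v₀*(ξ)) |ξ|^α` for `ξ ≠ 0`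
and `v₀*(0) = 0`. -/
def vStar (α a₀ : ℝ) (μ₀ : Measure ℝ) (ξ : ℝ) : ℝ :=
  if ξ = 0 then 0 else (1 - (charFun μ₀ ξ).re) / |ξ| ^ α - a₀

/-- `‖v₀*‖ = sup_{ξ ≥ 0} |v₀*(ξ)|`. -/
def vNorm (α a₀ : ℝ) (μ₀ : Measure ℝ) : ℝ :=
  sSup ((fun ξ => |vStar α a₀ μ₀ ξ|) '' Ici 0)

/-- `M = a₀ + ‖v₀*‖`. -/
def constM (α a₀ : ℝ) (μ₀ : Measure ℝ) : ℝ := a₀ + vNorm α a₀ μ₀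

/-- `v̄₀*(ξ) = sup_{0 ≤ x ≤ ξ} |v₀*(x)|`. -/
def vBar (α a₀ : ℝ) (μ₀ : Measure ℝ) (ξ : ℝ) : ℝ :=
  sSup ((fun x => |vStar α a₀ μ₀ x|) '' Icc 0 ξ)

/-- `d̃ = (3 d / (8 M))^{1/α}`. -/
def dTilde (α a₀ : ℝ) (μ₀ : Measure ℝ) (d : ℝ) : ℝ :=
  (3 * d / (8 * constM α a₀ μ₀)) ^ (1 / α)

/-- `d` is an element of `(0, 1)` such that `(4/5) M² |x|^α + v̄₀*(|x|) ≤ η` whenever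
`|x| ≤ (3 d / (8 M))^{1/α}`. -/
def IsAdmissible (α a₀ : ℝ) (μ₀ : Measure ℝ) (η d : ℝ) : Prop :=
  d ∈ Ioo (0 : ℝ) 1 ∧ ∀ x : ℝ, |x| ≤ dTilde α a₀ μ₀ d →
    4 / 5 * constM α a₀ μ₀ ^ 2 * |x| ^ α + vBar α a₀ μ₀ |x| ≤ η

/-- `H(ξ, q) = |v₀*(ξ q)| (1 + 2 |ξ|^α |v₀*(ξ q)|)`. -/
def funH (α a₀ : ℝ) (μ₀ : Measure ℝ) (ξ q : ℝ) : ℝ :=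
  |vStar α a₀ μ₀ (ξ * q)| * (1 + 2 * |ξ| ^ α * |vStar α a₀ μ₀ (ξ * q)|)

/-- `N_l = ∫_0^∞ exp (-(a₀ - η) ξ^α) ξ^{l-1} dξ`. -/
def constN (α a₀ η l : ℝ) : ℝ :=
  ∫ ξ in Ioi (0 : ℝ), Real.exp (-((a₀ - η) * ξ ^ α)) * ξ ^ (l - 1)

/-- `A_m = (1 / 2π) ∫_0^{2π} |sin θ|^m dθ`. -/
def constA (m : ℝ) : ℝ :=
  1 / (2 * Real.pi) * ∫ θ in (0 : ℝ)..(2 * Real.pi), |Real.sin θ| ^ m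

/-- `sup_x |F₀(x) + F₀(-x-0) - 1|`, where `F₀(-x-0)` is the left limit at `-x`. -/
def asymmetry (μ₀ : Measure ℝ) : ℝ :=
  ⨆ x : ℝ, |cdf μ₀ x + Function.leftLim (fun y => cdf μ₀ y) (-x) - 1|

/-- The upper bound, as a function of the time `t`. -/
def kolmogorovBound (c p a₀ : ℝ) (G μ₀ : Measure ℝ) (η d t : ℝ) : ℝ :=
  2 / Real.pi *
      expectSum p t (fun q => q ^ alpha p *
        ∫ ξ in Ioi (0 : ℝ), funH (alpha p) a₀ μ₀ ξ q * ξ ^ (alpha p - 1) *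
          Real.exp (-((a₀ - η) * ξ ^ alpha p)))
    + c * densitySupNorm G / dTilde (alpha p) a₀ μ₀ d * expectMax p t
    + 8 / (5 * Real.pi) * constM (alpha p) a₀ μ₀ ^ 2 * constN (alpha p) a₀ η (2 * alpha p) *
        Real.exp (-(t * (1 - 2 * constA 4)))
    + 64 / (25 * Real.pi) * constM (alpha p) a₀ μ₀ ^ 4 * constN (alpha p) a₀ η (4 * alpha p) *
        Real.exp (-(t * (1 - 2 * constA 6)))
    + Real.exp (-t) / 2 * asymmetry μ₀

end InelasticKac

end

/-! The law of a solution is read as the law of a randomly weighted sum of i.i.d. variables, and the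
Berry–Esseen method is applied conditionally on the weights.

The maps θ ↦ -θ and θ ↦ π - θ preserve the uniform angle and flip the signs of s and c separately,
so the collision integral is unchanged when φ is replaced by Re φ. Hence Im φ only decays like
e^{-t}, while Re φ solves a closed equation whose solution is the Wild series E_t[∏ Re φ₀(β_j ξ)]
(`hasDerivAt_wildSum`, `IsSolution.re_charFun_eq`). That series is the characteristic function of ∑
β_j X_j with X_j i.i.d. of the symmetrized initial law (`wildLaw`). The difference of the two
distribution functions is computed exactly and gives the asymmetry term
(`IsSolution.cdf_sub_cdf_wildLaw`).

Since α(1 + p) = 2, the identity cos² + sin² = 1 gives ∑ |β_j|^α = 1 for every tree and all angles.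
Therefore e^{-a₀|ξ|^α} = ∏ e^{-a₀|β_j ξ|^α}, and the two characteristic functions can be compared
factor by factor: 1 - Re φ₀(x) = (a₀ + v₀*(x))|x|^α together with a logarithm estimate works as long
as |ξ| max|β_j| ≤ d̃ (`abs_prod_sub_exp_le`). The smoothing inequality with cutoff d̃ / max|β_j|
yields a bound for fixed weights (`kolmogorovDist_listLaw_le`) that is linear in ∑ |β_j|^α I(|β_j|),
max|β_j| and ∑ |β_j|^{2α}, where I is the radial integral of H. Its expectation is the claim; the
A_6 term and the second factor of H are nonnegative slack.

The mean of ∑ |β_j|^{2α} solves a linear equation and equals e^{-t(1 - 2A_4)} (`expAvg_treePow`). As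
A_4 = 3/8 < 1/2, it tends to 0; so the largest weight tends to 0 in mean, and with it the whole
bound.

Two analytic inputs remain. A Berry–Esseen constant is obtained by smoothing with the Fejér kernel
(`exists_isBerryEsseenConstant`). And v₀*(ξ) → 0 as ξ → 0 (`tendsto_vStar`): because the centring is
unknown, normal attraction is first exploited for |φ₀| only, and a tail estimate then shows that (Im
φ₀)² is negligible. -/

namespace InelasticKac

/-! ### The Fejér kernel -/

/-- The Fejér kernel `(1 - cos y) / (π y²)`, written as the Fourier transform of a triangle. -/
noncomputable def fejer (y : ℝ) : ℝ :=
  (2 * Real.pi)⁻¹ * ∫ ξ in (-1 : ℝ)..1, (1 - |ξ|) * Real.cos (y * ξ)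

lemma continuous_fejer : Continuous fejer := by
  unfold fejer
  refine continuous_const.mul ?_
  exact intervalIntegral.continuous_parametric_intervalIntegral_of_continuous' (by fun_prop) _ _

lemma fejer_neg (y : ℝ) : fejer (-y) = fejer y := by
  simp [fejer]

lemma fejer_eq {y : ℝ} (hy : y ≠ 0) : fejer y = (1 - Real.cos y) / (Real.pi * y ^ 2) := by
  have hc : Continuous fun ξ : ℝ => (1 - |ξ|) * Real.cos (y * ξ) := by fun_prop
  have h1 : ∫ ξ in (0 : ℝ)..1, (1 - |ξ|) * Real.cos (y * ξ) = (1 - Real.cos y) / y ^ 2 := by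
    have hd : ∀ x ∈ uIcc (0 : ℝ) 1, HasDerivAt
        (fun ξ : ℝ => (1 - ξ) * Real.sin (y * ξ) / y - Real.cos (y * ξ) / y ^ 2)
        ((1 - |x|) * Real.cos (y * x)) x := by
      intro x hx
      rw [uIcc_of_le zero_le_one] at hx
      rw [abs_of_nonneg hx.1]
      have hl : HasDerivAt (fun ξ : ℝ => y * ξ) y x := by
        simpa using (hasDerivAt_id x).const_mul y
      have h2 := ((((hasDerivAt_id x).const_sub 1).mul hl.sin).div_const y).sub
        ((hl.cos).div_const (y ^ 2))
      convert! h2 using 1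
      simp only [id]
      field_simp
      ring
    rw [intervalIntegral.integral_eq_sub_of_hasDerivAt hd (hc.intervalIntegrable _ _)]
    simp
    field_simp
    ring
  have h2 : ∫ ξ in (-1 : ℝ)..0, (1 - |ξ|) * Real.cos (y * ξ) = (1 - Real.cos y) / y ^ 2 := by
    rw [← h1]
    have := intervalIntegral.integral_comp_neg (a := 0) (b := 1)
      (fun ξ : ℝ => (1 - |ξ|) * Real.cos (y * ξ))
    simpa using this.symm
  rw [fejer, ← intervalIntegral.integral_add_adjacent_intervals
    (hc.intervalIntegrable (-1) 0) (hc.intervalIntegrable 0 1), h1, h2]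
  field_simp
  ring

lemma fejer_nonneg (y : ℝ) : 0 ≤ fejer y := by
  rcases eq_or_ne y 0 with rfl | hy
  · unfold fejer
    refine mul_nonneg (by positivity) (intervalIntegral.integral_nonneg (by norm_num) ?_)
    intro u hu
    simpa using abs_le.mpr hu
  · rw [fejer_eq hy]
    have := Real.cos_le_one y
    have : 0 ≤ 1 - Real.cos y := by linarith
    positivity

lemma fejer_le {y : ℝ} (hy : y ≠ 0) : fejer y ≤ 2 / Real.pi * |y| ^ (-2 : ℝ) := by
  rw [fejer_eq hy, Real.rpow_neg (abs_nonneg y)]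
  have h : |y| ^ (2 : ℝ) = y ^ 2 := by
    rw [Real.rpow_two, sq_abs]
  rw [h, ← div_eq_mul_inv, div_div]
  have := Real.neg_one_le_cos y
  gcongr
  linarith

lemma integrableOn_fejer_Ioi {δ : ℝ} (hδ : 0 < δ) : IntegrableOn fejer (Ioi δ) := by
  refine Integrable.mono' ((integrableOn_Ioi_rpow_of_lt (a := -2) (by norm_num) hδ).const_mul
    (2 / Real.pi)) continuous_fejer.aestronglyMeasurable ?_
  filter_upwards [ae_restrict_mem measurableSet_Ioi] with x hx
  have hx0 : 0 < x := hδ.trans hx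
  rw [Real.norm_of_nonneg (fejer_nonneg x)]
  simpa [abs_of_pos hx0] using fejer_le hx0.ne'

lemma integral_fejer_Ioi_le {δ : ℝ} (hδ : 0 < δ) : ∫ y in Ioi δ, fejer y ≤ 2 / (Real.pi * δ) := by
  calc ∫ y in Ioi δ, fejer y ≤ ∫ y in Ioi δ, 2 / Real.pi * y ^ (-2 : ℝ) := by
        refine setIntegral_mono_on (integrableOn_fejer_Ioi hδ)
          ((integrableOn_Ioi_rpow_of_lt (a := -2) (by norm_num) hδ).const_mul _)
          measurableSet_Ioi fun x hx => ?_
        have hx0 : 0 < x := hδ.trans hx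
        simpa [abs_of_pos hx0] using fejer_le hx0.ne'
    _ = 2 / (Real.pi * δ) := by
        rw [integral_const_mul, integral_Ioi_rpow_of_lt (by norm_num) hδ]
        norm_num
        rw [Real.rpow_neg_one]
        field_simp

lemma integrable_fejer : Integrable fejer := by
  have h1 : IntegrableOn fejer (Ioi 1) := integrableOn_fejer_Ioi one_pos
  have h2 : IntegrableOn fejer (Iic (-1)) := by
    rw [← integrable_indicator_iff measurableSet_Iic]
    have h1' : IntegrableOn fejer (Ici 1) := by rwa [integrableOn_Ici_iff_integrableOn_Ioi]
    have h3 := ((integrable_indicator_iff measurableSet_Ici).2 h1').comp_neg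
    refine h3.congr (Eventually.of_forall fun x => ?_)
    simp only [indicator, mem_Ici, mem_Iic, fejer_neg]
    congr 1
    simp only [eq_iff_iff]
    constructor <;> intro h <;> linarith
  have h3 : IntegrableOn fejer (Icc (-1) 1) := continuous_fejer.continuousOn.integrableOn_Icc
  rw [← integrableOn_univ]
  refine ((h2.union h3).union h1).mono_set ?_
  intro x _
  simp only [mem_union, mem_Iic, mem_Icc, mem_Ioi]
  rcases le_total x (-1) with h | h
  · exact Or.inl (Or.inl h)
  · rcases le_or_gt x 1 with h' | h'
    · exact Or.inl (Or.inr ⟨h, h'⟩)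
    · exact Or.inr h'

/-- Fourier inversion of the triangle function at 0, where its value is 1; the kernel is its
transform up to scaling. -/
lemma integral_fejer : ∫ y, fejer y = 1 := by
  let f : ℝ → ℂ := fun ξ => ((max (1 - |ξ|) 0 : ℝ) : ℂ)
  have hsupp : Function.support f ⊆ Ioc (-1) 1 := by
    intro x hx
    by_contra h
    apply hx
    have : 1 - |x| ≤ 0 := by
      simp only [mem_Ioc, not_and_or, not_lt, not_le] at h
      rcases h with h | h
      · linarith [neg_le_abs x]
      · linarith [le_abs_self x]
    simp [f, this]
  have hc : Continuous f := by fun_prop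
  have hfi : Integrable f := hc.integrable_of_hasCompactSupport
    (HasCompactSupport.intro (isCompact_Icc (a := (-1 : ℝ)) (b := 1)) fun x hx => by
      by_contra h
      exact hx (Ioc_subset_Icc_self (hsupp h)))
  have hF : ∀ w : ℝ, FourierTransform.fourier f w = ((2 * Real.pi * fejer (2 * Real.pi * w) : ℝ) : ℂ) := by
    intro w
    have hs : (Function.support fun ξ : ℝ =>
        Complex.exp (↑(-2 * Real.pi * ξ * w) * Complex.I) • f ξ) ⊆ Ioc (-1) 1 :=
      fun x hx => hsupp fun h => hx (by simp [h])
    rw [Real.fourier_real_eq_integral_exp_smul,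
      ← intervalIntegral.integral_eq_integral_of_support_subset hs]
    have h0 : ∀ ξ ∈ uIcc (-1 : ℝ) 1, Complex.exp (↑(-2 * Real.pi * ξ * w) * Complex.I) • f ξ
        = (((1 - |ξ|) * Real.cos (2 * Real.pi * w * ξ) : ℝ) : ℂ)
          - Complex.I * (((1 - |ξ|) * Real.sin (2 * Real.pi * w * ξ) : ℝ) : ℂ) := by
      intro ξ hξ
      rw [uIcc_of_le (by norm_num)] at hξ
      have : 0 ≤ 1 - |ξ| := by simpa using abs_le.mpr hξ
      have h1 : f ξ = ((1 - |ξ| : ℝ) : ℂ) := by simp [f, this]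
      rw [h1, Complex.exp_mul_I, smul_eq_mul]
      have h2 : (-2 * Real.pi * ξ * w) = -(2 * Real.pi * w * ξ) := by ring
      rw [h2]
      push_cast
      rw [Complex.cos_neg, Complex.sin_neg]
      ring
    rw [intervalIntegral.integral_congr h0, intervalIntegral.integral_sub
      (Continuous.intervalIntegrable (by fun_prop) _ _)
      (Continuous.intervalIntegrable (by fun_prop) _ _), intervalIntegral.integral_const_mul,
      intervalIntegral.integral_ofReal, intervalIntegral.integral_ofReal]
    have hodd : ∫ ξ in (-1 : ℝ)..1, (1 - |ξ|) * Real.sin (2 * Real.pi * w * ξ) = 0 := by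
      have := intervalIntegral.integral_comp_neg (a := -1) (b := 1)
        (fun ξ : ℝ => (1 - |ξ|) * Real.sin (2 * Real.pi * w * ξ))
      simp only [abs_neg, mul_neg, Real.sin_neg, intervalIntegral.integral_neg, neg_neg] at this
      linarith
    rw [hodd, fejer]
    push_cast
    have : (Real.pi : ℂ) ≠ 0 := by exact_mod_cast Real.pi_ne_zero
    field_simp
    simp
  have hpi : (2 * Real.pi) ≠ 0 := by positivity
  have hFi : Integrable (FourierTransform.fourier f) := by
    have : Integrable fun w : ℝ => 2 * Real.pi * fejer (2 * Real.pi * w) :=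
      (integrable_fejer.comp_mul_left' hpi).const_mul _
    refine this.ofReal.congr (Eventually.of_forall fun w => (hF w).symm)
  have hinv := hfi.fourierInv_fourier_eq hFi (v := 0) hc.continuousAt
  rw [Real.fourierInv_eq] at hinv
  simp only [inner_zero_right, AddChar.map_zero_eq_one, one_smul] at hinv
  simp_rw [hF] at hinv
  rw [integral_complex_ofReal] at hinv
  have h1 : (∫ w : ℝ, 2 * Real.pi * fejer (2 * Real.pi * w)) = 1 := by
    have : f 0 = ((1 : ℝ) : ℂ) := by simp [f]
    rw [this] at hinv
    exact_mod_cast hinv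
  rw [integral_const_mul, Measure.integral_comp_mul_left] at h1
  rw [← h1, abs_of_pos (by positivity)]
  simp
  field_simp

lemma fejer_le_one (y : ℝ) : fejer y ≤ 1 := by
  have h : ‖∫ ξ in (-1 : ℝ)..1, (1 - |ξ|) * Real.cos (y * ξ)‖ ≤ 1 * |1 - (-1)| := by
    refine intervalIntegral.norm_integral_le_of_norm_le_const fun ξ hξ => ?_
    rw [uIoc_of_le (by norm_num)] at hξ
    have h1 : |ξ| ≤ 1 := abs_le.mpr (Ioc_subset_Icc_self hξ)
    rw [norm_mul, Real.norm_eq_abs, Real.norm_eq_abs, abs_of_nonneg (by linarith)]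
    have := Real.abs_cos_le_one (y * ξ)
    nlinarith [abs_nonneg ξ, abs_nonneg (Real.cos (y * ξ))]
  rw [Real.norm_eq_abs] at h
  have h2 := le_of_abs_le h
  norm_num at h2
  rw [fejer, inv_mul_le_iff₀ (by positivity)]
  linarith [Real.pi_gt_three]

/-! ### Smoothed distribution functions and their Fourier form -/

/-- The distribution function of `μ` smoothed by the Fejér kernel. -/
noncomputable def smoothCdf (μ : Measure ℝ) (x : ℝ) : ℝ := ∫ y, cdf μ (x - y) * fejer y

/-- The density of the convolution of `μ` with the Fejér kernel. -/
noncomputable def smoothDensity (μ : Measure ℝ) (x : ℝ) : ℝ := ∫ z, fejer (x - z) ∂μ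

lemma measurable_cdf (μ : Measure ℝ) : Measurable (fun x => cdf μ x) :=
  (monotone_cdf μ).measurable

lemma integrable_cdf_mul_fejer (μ : Measure ℝ) (x : ℝ) :
    Integrable fun y => cdf μ (x - y) * fejer y := by
  refine integrable_fejer.bdd_mul (c := 1)
    ((measurable_cdf μ).comp (measurable_const.sub measurable_id)).aestronglyMeasurable ?_
  refine Eventually.of_forall fun y => ?_
  rw [Real.norm_of_nonneg (cdf_nonneg μ _)]
  exact cdf_le_one μ _

/-- Fubini twice: an increment of the distribution function is the measure of an interval, and the
shift is moved from the interval to the kernel. The integrated form requires no regularity of `cdf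
μ`. -/
lemma smoothCdf_sub (μ : Measure ℝ) [IsProbabilityMeasure μ] {a b : ℝ} (hab : a ≤ b) :
    smoothCdf μ b - smoothCdf μ a = ∫ u in a..b, smoothDensity μ u := by
  have hI : ∀ y, cdf μ (b - y) - cdf μ (a - y)
      = ∫ z, (Ioc a b).indicator (fun _ => (1 : ℝ)) (z + y) ∂μ := by
    intro y
    have h1 : (fun z => (Ioc a b).indicator (fun _ => (1 : ℝ)) (z + y))
        = (Ioc (a - y) (b - y)).indicator 1 := by
      ext z
      simp only [indicator, mem_Ioc, Pi.one_apply, sub_lt_iff_lt_add, le_sub_iff_add_le]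
    rw [h1, integral_indicator_one measurableSet_Ioc, cdf_eq_real, cdf_eq_real,
      ← measureReal_sdiff (Iic_subset_Iic.2 (by linarith)) measurableSet_Iic, Iic_sdiff_Iic]
  have hint1 : Integrable (fun q : ℝ × ℝ =>
      (Ioc a b).indicator (fun _ => (1 : ℝ)) (q.2 + q.1) * fejer q.1) (volume.prod μ) := by
    have h0 : Integrable (fun q : ℝ × ℝ => fejer q.1 * 1) (volume.prod μ) :=
      integrable_fejer.mul_prod (integrable_const (1 : ℝ))
    simp only [mul_one] at h0
    refine h0.bdd_mul (c := 1) ?_ ?_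
    · exact ((measurable_const.indicator measurableSet_Ioc).comp
        (measurable_snd.add measurable_fst)).aestronglyMeasurable
    · refine Eventually.of_forall fun q => ?_
      refine (norm_indicator_le_norm_self _ _).trans ?_
      simp
  have hint2 : Integrable (fun q : ℝ × ℝ =>
      (Ioc a b).indicator (fun _ => (1 : ℝ)) q.2 * fejer (q.2 - q.1)) (μ.prod volume) := by
    have h0 : Integrable (fun q : ℝ × ℝ => 1 * (Ioc a b).indicator (fun _ => (1 : ℝ)) q.2)
        (μ.prod volume) :=
      (integrable_const (1 : ℝ)).mul_prod
        ((integrable_indicator_iff measurableSet_Ioc).2 (by simp))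
    simp only [one_mul] at h0
    refine h0.mul_bdd (c := 1) ?_ ?_
    · exact (continuous_fejer.comp (continuous_snd.sub continuous_fst)).aestronglyMeasurable
    · refine Eventually.of_forall fun q => ?_
      rw [Real.norm_of_nonneg (fejer_nonneg _)]
      exact fejer_le_one _
  calc smoothCdf μ b - smoothCdf μ a
      = ∫ y, (∫ z, (Ioc a b).indicator (fun _ => (1 : ℝ)) (z + y) * fejer y ∂μ) := by
        rw [smoothCdf, smoothCdf, ← integral_sub (integrable_cdf_mul_fejer μ b)
          (integrable_cdf_mul_fejer μ a)]
        congr 1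
        ext y
        rw [← sub_mul, hI, integral_mul_const]
    _ = ∫ z, (∫ y, (Ioc a b).indicator (fun _ => (1 : ℝ)) (z + y) * fejer y) ∂μ :=
        integral_integral_swap hint1
    _ = ∫ z, (∫ u, (Ioc a b).indicator (fun _ => (1 : ℝ)) u * fejer (u - z)) ∂μ := by
        congr 1
        ext z
        rw [← integral_add_left_eq_self
          (fun u => (Ioc a b).indicator (fun _ => (1 : ℝ)) u * fejer (u - z)) z]
        simp
    _ = ∫ u, (∫ z, (Ioc a b).indicator (fun _ => (1 : ℝ)) u * fejer (u - z) ∂μ) :=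
        integral_integral_swap hint2
    _ = ∫ u in a..b, smoothDensity μ u := by
        rw [intervalIntegral.integral_of_le hab, ← integral_indicator measurableSet_Ioc]
        congr 1
        ext u
        rw [integral_const_mul]
        by_cases hu : u ∈ Ioc a b <;> simp [hu, smoothDensity]

/-- The kernel is band-limited, so only the values of the characteristic function on [-1, 1] enter.
-/
lemma smoothDensity_eq (μ : Measure ℝ) [IsProbabilityMeasure μ] (x : ℝ) :
    smoothDensity μ x = (2 * Real.pi)⁻¹ * ∫ ξ in (-1 : ℝ)..1,
      (1 - |ξ|) * (charFun μ ξ * Complex.exp (-(x * ξ * Complex.I))).re := by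
  unfold smoothDensity fejer
  rw [integral_const_mul]
  congr 1
  have hint : Integrable (Function.uncurry fun (ξ z : ℝ) => (1 - |ξ|) * Real.cos ((x - z) * ξ))
      ((volume.restrict (uIoc (-1 : ℝ) 1)).prod μ) := by
    have h0 : Integrable (fun q : ℝ × ℝ => (1 - |q.1|) * 1)
        ((volume.restrict (uIoc (-1 : ℝ) 1)).prod μ) := by
      refine Integrable.mul_prod (f := fun ξ : ℝ => 1 - |ξ|) ?_ (integrable_const (1 : ℝ))
      rw [uIoc_of_le (by norm_num)]
      exact (Continuous.integrableOn_Icc (by fun_prop)).mono_set Ioc_subset_Icc_self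
    simp only [mul_one] at h0
    refine h0.mul_bdd (c := 1) ?_ (Eventually.of_forall fun q => Real.abs_cos_le_one _)
    exact (Continuous.aestronglyMeasurable (by fun_prop))
  rw [← intervalIntegral_integral_swap hint]
  refine intervalIntegral.integral_congr fun ξ _ => ?_
  rw [integral_const_mul]
  congr 1
  rw [charFun_apply_real, ← integral_mul_const, ← Complex.reCLM_apply,
    ← ContinuousLinearMap.integral_comp_comm]
  · congr 1
    ext z
    rw [Complex.reCLM_apply, ← Complex.exp_add]
    have : (ξ : ℂ) * z * Complex.I + -(x * ξ * Complex.I)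
        = ((-((x - z) * ξ) : ℝ) : ℂ) * Complex.I := by push_cast; ring
    rw [this, Complex.exp_ofReal_mul_I_re, Real.cos_neg]
  · refine Integrable.mul_const ?_ _
    refine Integrable.of_bound (C := 1) (Continuous.aestronglyMeasurable (by fun_prop)) ?_
    refine Eventually.of_forall fun z => ?_
    rw [← Complex.ofReal_mul, Complex.norm_exp_ofReal_mul_I]

lemma continuous_smoothDensity (μ : Measure ℝ) [IsProbabilityMeasure μ] :
    Continuous (smoothDensity μ) := by
  unfold smoothDensity
  refine continuous_of_dominated (bound := fun _ => 1)
    (fun x => (continuous_fejer.comp (by fun_prop)).aestronglyMeasurable) ?_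
    (integrable_const _) ?_
  · refine fun x => Eventually.of_forall fun z => ?_
    rw [Real.norm_of_nonneg (fejer_nonneg _)]
    exact fejer_le_one _
  · exact Eventually.of_forall fun z => continuous_fejer.comp (by fun_prop)

lemma tendsto_smoothCdf_atTop (μ : Measure ℝ) :
    Tendsto (smoothCdf μ) atTop (𝓝 1) := by
  rw [← integral_fejer]
  refine tendsto_integral_filter_of_dominated_convergence fejer ?_ ?_ integrable_fejer ?_
  · exact Eventually.of_forall fun x => (integrable_cdf_mul_fejer μ x).aestronglyMeasurable
  · refine Eventually.of_forall fun x => Eventually.of_forall fun y => ?_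
    rw [Real.norm_of_nonneg (mul_nonneg (cdf_nonneg μ _) (fejer_nonneg y))]
    exact mul_le_of_le_one_left (fejer_nonneg y) (cdf_le_one μ _)
  · refine Eventually.of_forall fun y => ?_
    have := ((tendsto_cdf_atTop μ).comp
      (tendsto_atTop_add_const_right atTop (-y) tendsto_id)).mul_const (fejer y)
    simpa [sub_eq_add_neg] using this

/-- The Fourier representation of the difference of two smoothed distribution functions. -/
noncomputable def smoothDiff (μ ν : Measure ℝ) (x : ℝ) : ℝ :=
  (2 * Real.pi)⁻¹ * ∫ ξ in (-1 : ℝ)..1, (1 - |ξ|) *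
    ((charFun μ ξ - charFun ν ξ) / (ξ : ℂ) * Complex.I *
      Complex.exp (-(x * ξ * Complex.I))).re

section

variable (μ ν : Measure ℝ) [IsProbabilityMeasure μ] [IsProbabilityMeasure ν]

lemma norm_exp_neg_mul_I (x ξ : ℝ) : ‖Complex.exp (-(x * ξ * Complex.I))‖ = 1 := by
  rw [Complex.norm_exp]
  simp

lemma measurable_smoothDiff_integrand (x : ℝ) : Measurable fun ξ : ℝ => (1 - |ξ|) *
    ((charFun μ ξ - charFun ν ξ) / (ξ : ℂ) * Complex.I *
      Complex.exp (-(x * ξ * Complex.I))).re := by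
  have := measurable_charFun (μ := μ)
  have := measurable_charFun (μ := ν)
  fun_prop

omit [IsProbabilityMeasure μ] [IsProbabilityMeasure ν] in
lemma norm_smoothDiff_integrand_le (x : ℝ) {ξ : ℝ} (hξ : ξ ∈ Ioc (-1 : ℝ) 1) :
    ‖(1 - |ξ|) * ((charFun μ ξ - charFun ν ξ) / (ξ : ℂ) * Complex.I *
      Complex.exp (-(x * ξ * Complex.I))).re‖ ≤ ‖(charFun μ ξ - charFun ν ξ) / (ξ : ℂ)‖ := by
  have h1 : |ξ| ≤ 1 := abs_le.mpr (Ioc_subset_Icc_self hξ)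
  rw [norm_mul, Real.norm_eq_abs, Real.norm_eq_abs, abs_of_nonneg (by linarith)]
  refine (mul_le_of_le_one_left (abs_nonneg _) (by linarith [abs_nonneg ξ])).trans ?_
  refine (Complex.abs_re_le_norm _).trans ?_
  rw [norm_mul, norm_exp_neg_mul_I, norm_mul, Complex.norm_I, mul_one, mul_one]

variable {μ ν}

lemma intervalIntegrable_smoothDiff_integrand
    (hint : IntervalIntegrable (fun ξ : ℝ => ‖(charFun μ ξ - charFun ν ξ) / (ξ : ℂ)‖)
      volume (-1) 1) (x : ℝ) :
    IntervalIntegrable (fun ξ : ℝ => (1 - |ξ|) *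
      ((charFun μ ξ - charFun ν ξ) / (ξ : ℂ) * Complex.I *
        Complex.exp (-(x * ξ * Complex.I))).re) volume (-1) 1 := by
  refine hint.mono_fun (measurable_smoothDiff_integrand μ ν x).aestronglyMeasurable ?_
  filter_upwards [ae_restrict_mem measurableSet_uIoc] with ξ hξ
  rw [uIoc_of_le (by norm_num)] at hξ
  rw [norm_norm]
  exact norm_smoothDiff_integrand_le μ ν x hξ

omit [IsProbabilityMeasure μ] [IsProbabilityMeasure ν] in
lemma abs_smoothDiff_le
    (hint : IntervalIntegrable (fun ξ : ℝ => ‖(charFun μ ξ - charFun ν ξ) / (ξ : ℂ)‖)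
      volume (-1) 1) (x : ℝ) :
    |smoothDiff μ ν x| ≤
      (2 * Real.pi)⁻¹ * ∫ ξ in (-1 : ℝ)..1, ‖(charFun μ ξ - charFun ν ξ) / (ξ : ℂ)‖ := by
  rw [smoothDiff, abs_mul, abs_of_pos (by positivity)]
  gcongr
  rw [← Real.norm_eq_abs]
  refine (intervalIntegral.norm_integral_le_of_norm_le (by norm_num) ?_ hint)
  exact Eventually.of_forall fun ξ hξ => norm_smoothDiff_integrand_le μ ν x hξ

/-- Differentiating the exponential in x produces a factor ξ that cancels the denominator; the
differentiated integrand is bounded by |φ_μ - φ_ν| ≤ 2. -/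
lemma hasDerivAt_smoothDiff
    (hint : IntervalIntegrable (fun ξ : ℝ => ‖(charFun μ ξ - charFun ν ξ) / (ξ : ℂ)‖)
      volume (-1) 1) (x : ℝ) :
    HasDerivAt (smoothDiff μ ν) (smoothDensity μ x - smoothDensity ν x) x := by
  have hm1 := measurable_charFun (μ := μ)
  have hm2 := measurable_charFun (μ := ν)
  have hmain := intervalIntegral.hasDerivAt_integral_of_dominated_loc_of_deriv_le
    (μ := volume) (a := -1) (b := 1) (x₀ := x) (s := univ) (bound := fun _ => 2)
    (F := fun (x ξ : ℝ) => (1 - |ξ|) * ((charFun μ ξ - charFun ν ξ) / (ξ : ℂ) * Complex.I *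
        Complex.exp (-(x * ξ * Complex.I))).re)
    (F' := fun (x ξ : ℝ) => (1 - |ξ|) * ((charFun μ ξ - charFun ν ξ) / (ξ : ℂ) * Complex.I *
        (Complex.exp (-(x * ξ * Complex.I)) * (-(ξ * Complex.I)))).re)
    univ_mem
    (Eventually.of_forall fun x => (measurable_smoothDiff_integrand μ ν x).aestronglyMeasurable)
    (intervalIntegrable_smoothDiff_integrand hint x)
    (Measurable.aestronglyMeasurable (by fun_prop)) ?_ (by simp) ?_
  · have h2 := hmain.2.const_mul (2 * Real.pi)⁻¹
    unfold smoothDiff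
    convert! h2 using 1
    rw [smoothDensity_eq, smoothDensity_eq, ← mul_sub, ← intervalIntegral.integral_sub]
    · congr 1
      refine intervalIntegral.integral_congr_ae ?_
      have h0 : ∀ᵐ ξ : ℝ, ξ ≠ 0 := by simp [ae_iff]
      filter_upwards [h0] with ξ hξ _
      rw [← mul_sub, ← Complex.sub_re]
      congr 2
      have hξ' : (ξ : ℂ) ≠ 0 := by exact_mod_cast hξ
      field_simp
      rw [Complex.I_sq]
      ring
    all_goals
      refine Continuous.intervalIntegrable ?_ _ _
      have := continuous_charFun (μ := μ)
      have := continuous_charFun (μ := ν)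
      fun_prop
  · refine Eventually.of_forall fun ξ hξ y _ => ?_
    rw [uIoc_of_le (by norm_num)] at hξ
    have h1 : |ξ| ≤ 1 := abs_le.mpr (Ioc_subset_Icc_self hξ)
    rw [norm_mul, Real.norm_eq_abs, Real.norm_eq_abs, abs_of_nonneg (by linarith)]
    refine (mul_le_of_le_one_left (abs_nonneg _) (by linarith [abs_nonneg ξ])).trans ?_
    refine (Complex.abs_re_le_norm _).trans ?_
    rw [norm_mul, norm_mul, norm_mul, norm_exp_neg_mul_I, norm_neg, norm_mul, Complex.norm_I,
      mul_one, mul_one, one_mul, norm_div]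
    have h3 := norm_charFun_le_one (μ := μ) ξ
    have h4 := norm_charFun_le_one (μ := ν) ξ
    have h2 : ‖charFun μ ξ - charFun ν ξ‖ ≤ 2 := (norm_sub_le _ _).trans (by linarith)
    rcases eq_or_ne ‖(ξ : ℂ)‖ 0 with h | h
    · rw [h, mul_zero]
      norm_num
    · rwa [div_mul_cancel₀ _ h]
  · refine Eventually.of_forall fun ξ _ y _ => ?_
    refine HasDerivAt.const_mul _ ?_
    have hl : HasDerivAt (fun y : ℝ => -((y : ℂ) * ξ * Complex.I)) (-(ξ * Complex.I)) y := by
      have := (((hasDerivAt_id y).ofReal_comp).mul_const (ξ * Complex.I)).fun_neg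
      simpa [mul_assoc] using this
    have h := hl.cexp.const_mul ((charFun μ ξ - charFun ν ξ) / (ξ : ℂ) * Complex.I)
    exact (Complex.reCLM.hasFDerivAt.comp_hasDerivAt y h)

/-- The Riemann–Lebesgue lemma at frequency x / 2π. -/
lemma tendsto_smoothDiff_atTop
    (hint : IntervalIntegrable (fun ξ : ℝ => ‖(charFun μ ξ - charFun ν ξ) / (ξ : ℂ)‖)
      volume (-1) 1) :
    Tendsto (smoothDiff μ ν) atTop (𝓝 0) := by
  have hm1 := measurable_charFun (μ := μ)
  have hm2 := measurable_charFun (μ := ν)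
  let f : ℝ → ℂ := fun ξ => (Ioc (-1 : ℝ) 1).indicator (fun ξ => ((1 - |ξ| : ℝ) : ℂ) *
    ((charFun μ ξ - charFun ν ξ) / (ξ : ℂ) * Complex.I)) ξ
  have hRL := Real.tendsto_integral_exp_smul_cocompact f
  have hw : Tendsto (fun x : ℝ => x / (2 * Real.pi)) atTop (cocompact ℝ) :=
    (tendsto_id.atTop_div_const (by positivity)).mono_right atTop_le_cocompact
  have h := ((Complex.continuous_re.tendsto _).comp (hRL.comp hw)).const_mul (2 * Real.pi)⁻¹
  simp only [Complex.zero_re, mul_zero] at h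
  refine h.congr fun x => ?_
  simp only [Function.comp, smoothDiff]
  congr 1
  have he : ∀ v : ℝ, (Real.fourierChar (-(v * (x / (2 * Real.pi)))) • f v)
      = (Ioc (-1 : ℝ) 1).indicator (fun ξ => ((1 - |ξ| : ℝ) : ℂ) *
        ((charFun μ ξ - charFun ν ξ) / (ξ : ℂ) * Complex.I *
          Complex.exp (-(x * ξ * Complex.I)))) v := by
    intro v
    have hexp : ((Real.fourierChar (-(v * (x / (2 * Real.pi)))) : Circle) : ℂ)
        = Complex.exp (-(x * v * Complex.I)) := by
      rw [Real.fourierChar_apply]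
      congr 1
      have : (Real.pi : ℂ) ≠ 0 := by exact_mod_cast Real.pi_ne_zero
      push_cast
      field_simp
    rw [Circle.smul_def, hexp, smul_eq_mul]
    by_cases hv : v ∈ Ioc (-1 : ℝ) 1
    · simp only [f, indicator_of_mem hv]
      ring
    · simp only [f, indicator_of_notMem hv, mul_zero]
  simp_rw [he]
  rw [integral_indicator measurableSet_Ioc, ← intervalIntegral.integral_of_le (by norm_num)]
  have hii : IntervalIntegrable (fun ξ : ℝ => ((1 - |ξ| : ℝ) : ℂ) *
        ((charFun μ ξ - charFun ν ξ) / (ξ : ℂ) * Complex.I *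
          Complex.exp (-(x * ξ * Complex.I)))) volume (-1) 1 := by
    refine hint.mono_fun (Measurable.aestronglyMeasurable (by fun_prop)) ?_
    filter_upwards [ae_restrict_mem measurableSet_uIoc] with ξ hξ
    rw [uIoc_of_le (by norm_num)] at hξ
    have h1 : |ξ| ≤ 1 := abs_le.mpr (Ioc_subset_Icc_self hξ)
    rw [norm_norm, norm_mul, norm_mul, norm_exp_neg_mul_I, norm_mul, Complex.norm_I, mul_one,
      mul_one, Complex.norm_real, Real.norm_eq_abs, abs_of_nonneg (by linarith)]
    exact mul_le_of_le_one_left (norm_nonneg _) (by linarith [abs_nonneg ξ])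
  have hre := Complex.reCLM.intervalIntegral_comp_comm hii
  simp only [Complex.reCLM_apply] at hre
  rw [← hre]
  refine intervalIntegral.integral_congr fun ξ _ => ?_
  simp only [Complex.re_ofReal_mul]

/-- Both sides have the same derivative and the same limit 0 at +∞. -/
lemma smoothCdf_sub_smoothCdf_eq
    (hint : IntervalIntegrable (fun ξ : ℝ => ‖(charFun μ ξ - charFun ν ξ) / (ξ : ℂ)‖)
      volume (-1) 1) (x : ℝ) :
    smoothCdf μ x - smoothCdf ν x = smoothDiff μ ν x := by
  have hconst : ∀ y, x ≤ y → smoothCdf μ y - smoothCdf ν y - smoothDiff μ ν y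
      = smoothCdf μ x - smoothCdf ν x - smoothDiff μ ν x := by
    intro y hxy
    have h1 := smoothCdf_sub μ hxy
    have h2 := smoothCdf_sub ν hxy
    have hcμ := continuous_smoothDensity μ
    have hcν := continuous_smoothDensity ν
    have h3 : ∫ u in x..y, (smoothDensity μ u - smoothDensity ν u)
        = smoothDiff μ ν y - smoothDiff μ ν x :=
      intervalIntegral.integral_eq_sub_of_hasDerivAt (fun u _ => hasDerivAt_smoothDiff hint u)
        ((hcμ.sub hcν).intervalIntegrable _ _)
    rw [intervalIntegral.integral_sub (hcμ.intervalIntegrable _ _)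
      (hcν.intervalIntegrable _ _)] at h3
    linarith
  have hlim : Tendsto (fun y => smoothCdf μ y - smoothCdf ν y - smoothDiff μ ν y) atTop
      (𝓝 (1 - 1 - 0)) :=
    ((tendsto_smoothCdf_atTop μ).sub (tendsto_smoothCdf_atTop ν)).sub
      (tendsto_smoothDiff_atTop hint)
  have hlim2 : Tendsto (fun y => smoothCdf μ y - smoothCdf ν y - smoothDiff μ ν y) atTop
      (𝓝 (smoothCdf μ x - smoothCdf ν x - smoothDiff μ ν x)) :=
    tendsto_const_nhds.congr' (by
      filter_upwards [eventually_ge_atTop x] with y hy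
      exact (hconst y hy).symm)
  have := tendsto_nhds_unique hlim hlim2
  linarith

end

/-! ### The smoothing inequality -/

lemma integral_fejer_tail_le {δ : ℝ} (hδ : 0 < δ) :
    ∫ y, {y : ℝ | δ < |y|}.indicator fejer y ≤ 4 / (Real.pi * δ) := by
  have hset : {y : ℝ | δ < |y|} = Iio (-δ) ∪ Ioi δ := by
    ext y
    simp only [mem_ofPred_eq, lt_abs, mem_union, mem_Iio, mem_Ioi]
    rw [or_comm, lt_neg]
  have hdisj : Disjoint (Iio (-δ)) (Ioi δ) := by
    rw [Set.disjoint_left]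
    intro y h1 h2
    simp only [mem_Iio, mem_Ioi] at h1 h2
    linarith
  rw [hset, integral_indicator (measurableSet_Iio.union measurableSet_Ioi),
    setIntegral_union hdisj measurableSet_Ioi integrable_fejer.integrableOn
    integrable_fejer.integrableOn]
  have h1 : ∫ y in Iio (-δ), fejer y = ∫ y in Ioi δ, fejer y := by
    rw [← integral_Iic_eq_integral_Iio]
    have := integral_comp_neg_Ioi δ fejer
    simp only [fejer_neg] at this
    rw [this]
  have h2 := integral_fejer_Ioi_le hδ
  rw [h1]
  calc _ ≤ 2 / (Real.pi * δ) + 2 / (Real.pi * δ) := add_le_add h2 h2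
    _ = _ := by ring

/-- If a bounded function decreases with slope at most `m` to the right of a point, then its
positive value there is controlled by its averages against the Fejér kernel. -/
lemma sq_le_of_smoothed_le {D : ℝ → ℝ} (hD : Measurable D) {K Δ m x₀ : ℝ} (hK : ∀ x, |D x| ≤ K)
    (hΔ : ∀ x, |∫ y, D (x - y) * fejer y| ≤ Δ) (hm : 0 < m)
    (hs : ∀ s, 0 ≤ s → D x₀ - m * s ≤ D (x₀ + s)) (hx₀ : 0 < D x₀) :
    D x₀ ^ 2 ≤ 2 * Δ * K + 24 * m / Real.pi * K := by
  set κ := D x₀ with hκ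
  -- The average is taken around x₀ + δ. For |y| ≤ δ the point x₀ + δ - y lies to the right of x₀,
  -- where D is at least κ - m(δ - y) = κ/2 + m y; the part m y is odd and integrates to 0 against
  -- the kernel. For |y| > δ only D ≥ -K is used.
  set δ := κ / (2 * m) with hδ
  have hδ0 : 0 < δ := by positivity
  have hκK : κ ≤ K := (le_abs_self _).trans (hK x₀)
  have hmδ : m * δ = κ / 2 := by rw [hδ]; field_simp
  let A : Set ℝ := {y : ℝ | δ < |y|}
  have hA : MeasurableSet A := measurableSet_lt measurable_const measurable_norm
  have hi1 : Integrable fun y => κ / 2 * fejer y := integrable_fejer.const_mul _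
  have hi2 : Integrable fun y => Aᶜ.indicator (fun y => m * y) y * fejer y := by
    refine integrable_fejer.bdd_mul (c := m * δ)
      ((measurable_const.mul measurable_id).indicator hA.compl).aestronglyMeasurable ?_
    refine Eventually.of_forall fun y => ?_
    by_cases hy : y ∈ A
    · simp only [mem_compl_iff, hy, not_true_eq_false, not_false_eq_true, indicator_of_notMem,
        norm_zero]
      positivity
    · have hy' : |y| ≤ δ := not_lt.1 hy
      simp only [mem_compl_iff, hy, not_false_eq_true, indicator_of_mem, norm_mul,
        Real.norm_eq_abs, abs_of_pos hm]
      gcongr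
  have hi3 : Integrable fun y => (κ / 2 + K) * A.indicator fejer y :=
    (integrable_fejer.indicator hA).const_mul _
  have hi4 : Integrable fun y => D (x₀ + δ - y) * fejer y :=
    integrable_fejer.bdd_mul (c := K)
      (hD.comp (measurable_const.sub measurable_id)).aestronglyMeasurable
      (Eventually.of_forall fun y => hK _)
  have hodd : ∫ y, Aᶜ.indicator (fun y => m * y) y * fejer y = 0 := by
    have := integral_neg_eq_self (fun y => Aᶜ.indicator (fun y => m * y) y * fejer y) volume
    have h2 : ∀ y, Aᶜ.indicator (fun y => m * y) (-y) * fejer (-y)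
        = -(Aᶜ.indicator (fun y => m * y) y * fejer y) := by
      intro y
      have hmem : -y ∈ A ↔ y ∈ A := by simp [A]
      by_cases hy : y ∈ A
      · simp [hy, hmem]
      · simp [hy, hmem, fejer_neg]
    simp only [h2, integral_neg] at this
    linarith
  have hle : κ / 2 - (κ / 2 + K) * (4 / (Real.pi * δ)) ≤ Δ := by
    calc κ / 2 - (κ / 2 + K) * (4 / (Real.pi * δ))
        ≤ κ / 2 - (κ / 2 + K) * ∫ y, A.indicator fejer y := by
          have := integral_fejer_tail_le hδ0
          have h0 : 0 ≤ κ / 2 + K := by linarith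
          gcongr
      _ = ∫ y, (κ / 2 * fejer y + Aᶜ.indicator (fun y => m * y) y * fejer y
            - (κ / 2 + K) * A.indicator fejer y) := by
          have hi12 : Integrable fun y =>
              κ / 2 * fejer y + Aᶜ.indicator (fun y => m * y) y * fejer y := hi1.add hi2
          rw [integral_sub hi12 hi3, integral_add hi1 hi2, hodd, integral_const_mul,
            integral_const_mul, integral_fejer]
          ring
      _ ≤ ∫ y, D (x₀ + δ - y) * fejer y := by
          refine integral_mono ((hi1.add hi2).sub hi3) hi4 fun y => ?_
          have hf := fejer_nonneg y
          simp only
          by_cases hy : y ∈ A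
          · have h1 := neg_abs_le (D (x₀ + δ - y))
            have h2 := hK (x₀ + δ - y)
            simp only [mem_compl_iff, hy, not_true_eq_false, not_false_eq_true,
              indicator_of_notMem, indicator_of_mem]
            nlinarith
          · have hy' : |y| ≤ δ := not_lt.1 hy
            have h1 := hs (δ - y) (by linarith [le_abs_self y])
            rw [← add_sub_assoc] at h1
            simp only [mem_compl_iff, hy, not_false_eq_true,
              indicator_of_notMem, indicator_of_mem]
            have h3 : κ / 2 + m * y ≤ D (x₀ + δ - y) := by linarith
            nlinarith
      _ ≤ Δ := (le_abs_self _).trans (hΔ _)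
  have hfin : (κ / 2 + K) * (4 / (Real.pi * δ)) ≤ 12 * m / (Real.pi * κ) * K := by
    have h1 : 4 / (Real.pi * δ) = 8 * m / (Real.pi * κ) := by
      rw [hδ]; field_simp; norm_num
    rw [h1]
    have h2 : κ / 2 + K ≤ 3 / 2 * K := by linarith
    calc _ ≤ (3 / 2 * K) * (8 * m / (Real.pi * κ)) := by gcongr
      _ = _ := by ring
  have h3 : κ / 2 ≤ Δ + 12 * m / (Real.pi * κ) * K := by linarith
  have hΔ0 : 0 ≤ Δ := (abs_nonneg _).trans (hΔ 0)
  -- Replacing one factor κ by K makes the right side independent of x₀, so that the supremum over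
  -- x₀ can be taken afterwards.
  calc κ ^ 2 = 2 * κ * (κ / 2) := by ring
    _ ≤ 2 * κ * (Δ + 12 * m / (Real.pi * κ) * K) := by gcongr
    _ = 2 * Δ * κ + 24 * m / Real.pi * K := by field_simp; ring
    _ ≤ 2 * Δ * K + 24 * m / Real.pi * K := by gcongr

lemma abs_cdf_sub_cdf_le_one (μ ν : Measure ℝ) (x : ℝ) : |cdf μ x - cdf ν x| ≤ 1 := by
  rw [abs_le]
  constructor <;> linarith [cdf_nonneg μ x, cdf_nonneg ν x, cdf_le_one μ x, cdf_le_one ν x]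

lemma bddAbove_abs_cdf_sub_cdf (μ ν : Measure ℝ) :
    BddAbove (range fun x : ℝ => |cdf μ x - cdf ν x|) :=
  ⟨1, by rintro _ ⟨x, rfl⟩; exact abs_cdf_sub_cdf_le_one μ ν x⟩

lemma abs_cdf_sub_cdf_le (μ ν : Measure ℝ) (x : ℝ) :
    |cdf μ x - cdf ν x| ≤ kolmogorovDist μ ν :=
  le_ciSup (bddAbove_abs_cdf_sub_cdf μ ν) x

lemma kolmogorovDist_nonneg (μ ν : Measure ℝ) : 0 ≤ kolmogorovDist μ ν :=
  (abs_nonneg _).trans (abs_cdf_sub_cdf_le μ ν 0)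

lemma smoothCdf_sub_smoothCdf (μ ν : Measure ℝ) (x : ℝ) :
    ∫ y, (cdf μ (x - y) - cdf ν (x - y)) * fejer y = smoothCdf μ x - smoothCdf ν x := by
  rw [smoothCdf, smoothCdf, ← integral_sub (integrable_cdf_mul_fejer μ x)
    (integrable_cdf_mul_fejer ν x)]
  simp only [sub_mul]

/-- Every squared difference is at most (2Δ + 24m/π) K, where K is the distance itself. Taking the
supremum gives K² on the left, and one factor K cancels. -/
lemma kolmogorovDist_le_of_smoothed_le {μ ν : Measure ℝ} {m Δ : ℝ} (hm : 0 < m)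
    (hlip : ∀ x s, 0 ≤ s → cdf ν (x + s) ≤ cdf ν x + m * s)
    (hΔ : ∀ x, |smoothCdf μ x - smoothCdf ν x| ≤ Δ) :
    kolmogorovDist μ ν ≤ 2 * Δ + 24 * m / Real.pi := by
  set K := kolmogorovDist μ ν with hKdef
  have hK0 : 0 ≤ K := kolmogorovDist_nonneg μ ν
  have hΔ0 : 0 ≤ Δ := (abs_nonneg _).trans (hΔ 0)
  set B := 2 * Δ * K + 24 * m / Real.pi * K with hB
  have hB0 : 0 ≤ B := by positivity
  have key : ∀ x, (cdf μ x - cdf ν x) ^ 2 ≤ B := by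
    intro x
    rcases lt_trichotomy 0 (cdf μ x - cdf ν x) with h | h | h
    · refine sq_le_of_smoothed_le (D := fun x => cdf μ x - cdf ν x)
        ((measurable_cdf μ).sub (measurable_cdf ν)) (abs_cdf_sub_cdf_le μ ν)
        (fun x => ?_) hm (fun s hs => ?_) h
      · rw [smoothCdf_sub_smoothCdf]
        exact hΔ x
      · have h1 := monotone_cdf μ (le_add_of_nonneg_right hs : x ≤ x + s)
        have h2 := hlip x s hs
        linarith
    · rw [← h]
      simpa using hB0
    -- Where F_μ - F_ν is negative, both functions are reflected: on moving left by s, F_μ does not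
    -- increase and F_ν falls by at most m s.
    · have := sq_le_of_smoothed_le (D := fun x => -(cdf μ (-x) - cdf ν (-x))) (K := K) (Δ := Δ)
        (m := m) (x₀ := -x)
        (((measurable_cdf μ).comp measurable_neg).sub
          ((measurable_cdf ν).comp measurable_neg)).neg
        (fun x => by rw [abs_neg]; exact abs_cdf_sub_cdf_le μ ν _)
        (fun x => ?_) hm (fun s hs => ?_) (by simpa using h)
      · simp only [neg_neg, neg_sq] at this
        exact this
      · have h1 := hΔ (-x)
        rw [← smoothCdf_sub_smoothCdf, ← abs_neg, ← integral_neg] at h1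
        rw [← integral_neg_eq_self]
        simp only [fejer_neg, neg_mul] at h1 ⊢
        convert! h1 using 6
        ring_nf
      · have h1 := monotone_cdf μ (sub_le_self x hs)
        have h2 := hlip (x - s) s hs
        rw [sub_add_cancel] at h2
        have h3 : -(-x + s) = x - s := by ring
        simp only [neg_neg, h3]
        linarith
  have hKs : K ≤ √B := by
    refine ciSup_le fun x => Real.abs_le_sqrt (key x)
  have hK2 : K ^ 2 ≤ B := by
    calc K ^ 2 ≤ √B ^ 2 := by gcongr
      _ = B := Real.sq_sqrt hB0
  rcases hK0.eq_or_lt with h | h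
  · rw [← h]
    positivity
  · have h4 : K * K ≤ (2 * Δ + 24 * m / Real.pi) * K := by
      calc K * K = K ^ 2 := by ring
        _ ≤ B := hK2
        _ = _ := by rw [hB]; ring
    exact le_of_mul_le_mul_right h4 h

lemma cdf_add_le {ν : Measure ℝ} {m : ℝ} (hd : Differentiable ℝ fun x => cdf ν x)
    (hm : ∀ x : ℝ, |deriv (fun y => cdf ν y) x| ≤ m) (x s : ℝ) (hs : 0 ≤ s) :
    cdf ν (x + s) ≤ cdf ν x + m * s := by
  have := (convex_univ (𝕜 := ℝ) (E := ℝ)).norm_image_sub_le_of_norm_deriv_le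
    (f := fun y => cdf ν y) (fun y _ => hd y) (fun y _ => hm y) (mem_univ x) (mem_univ (x + s))
  simp only [add_sub_cancel_left, Real.norm_eq_abs, abs_of_nonneg hs] at this
  linarith [le_abs_self (cdf ν (x + s) - cdf ν x)]

lemma cdf_map_mul (μ : Measure ℝ) [IsProbabilityMeasure μ] {T : ℝ} (hT : 0 < T) (x : ℝ) :
    cdf (μ.map (T * ·)) x = cdf μ (x / T) := by
  have : IsProbabilityMeasure (μ.map (T * ·)) :=
    Measure.isProbabilityMeasure_map (by fun_prop)
  rw [cdf_eq_real, cdf_eq_real, map_measureReal_apply (by fun_prop) measurableSet_Iic]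
  congr 1
  ext y
  simp only [mem_preimage, mem_Iic, le_div_iff₀ hT, mul_comm]

/-- Scaling both laws by T reduces to the cutoff 1: the integral is unchanged and the slope bound
becomes m / T. The smoothed difference is at most 1/(2π) times the integral, which the factor 2 in
`kolmogorovDist_le_of_smoothed_le` turns into 1/π. -/
theorem exists_isBerryEsseenConstant : ∃ c : ℝ, IsBerryEsseenConstant c := by
  refine ⟨24 / Real.pi, ?_⟩
  intro μ ν m T hμ hν hT hd hm hint
  have hlip := cdf_add_le hd hm
  -- With m ≤ 0 the distribution function would be constant, against its limits 0 and 1.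
  have hm0 : 0 < m := by
    by_contra hle
    have hm' : ∀ x, deriv (fun y => cdf ν y) x = 0 := fun x =>
      abs_eq_zero.1 (le_antisymm ((hm x).trans (not_lt.1 hle)) (abs_nonneg _))
    have hc := is_const_of_deriv_eq_zero hd hm'
    have h0 := tendsto_nhds_unique (tendsto_cdf_atBot ν)
      (tendsto_const_nhds.congr fun y => hc 0 y)
    have h1 := tendsto_nhds_unique (tendsto_cdf_atTop ν)
      (tendsto_const_nhds.congr fun y => hc 0 y)
    linarith
  have hμ' : IsProbabilityMeasure (μ.map (T * ·)) :=
    Measure.isProbabilityMeasure_map (by fun_prop)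
  have hν' : IsProbabilityMeasure (ν.map (T * ·)) :=
    Measure.isProbabilityMeasure_map (by fun_prop)
  have hfun : ∀ ξ : ℝ, ‖(charFun (μ.map (T * ·)) ξ - charFun (ν.map (T * ·)) ξ) / (ξ : ℂ)‖
      = T * ‖(charFun μ (T * ξ) - charFun ν (T * ξ)) / ((T * ξ : ℝ) : ℂ)‖ := by
    intro ξ
    rw [charFun_map_mul, charFun_map_mul, norm_div, norm_div, Complex.norm_real,
      Complex.norm_real, norm_mul, Real.norm_of_nonneg hT.le]
    rcases eq_or_ne ‖ξ‖ 0 with h | h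
    · simp [h]
    · field_simp
  have hint' : IntervalIntegrable (fun ξ : ℝ =>
      ‖(charFun (μ.map (T * ·)) ξ - charFun (ν.map (T * ·)) ξ) / (ξ : ℂ)‖) volume (-1) 1 := by
    simp_rw [hfun]
    refine IntervalIntegrable.const_mul ?_ _
    have := hint.comp_mul_left (c := T)
    rw [neg_div, div_self hT.ne'] at this
    exact this
  have hval : ∫ ξ in (-1 : ℝ)..1,
      ‖(charFun (μ.map (T * ·)) ξ - charFun (ν.map (T * ·)) ξ) / (ξ : ℂ)‖
      = ∫ ξ in (-T)..T, ‖(charFun μ ξ - charFun ν ξ) / (ξ : ℂ)‖ := by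
    simp_rw [hfun]
    rw [intervalIntegral.integral_const_mul]
    have := intervalIntegral.mul_integral_comp_mul_left (a := -1) (b := 1)
      (f := fun ξ : ℝ => ‖(charFun μ ξ - charFun ν ξ) / (ξ : ℂ)‖) T
    simpa using this
  have hdist : kolmogorovDist μ ν = kolmogorovDist (μ.map (T * ·)) (ν.map (T * ·)) := by
    unfold kolmogorovDist
    simp_rw [cdf_map_mul _ hT]
    exact ((Equiv.mulRight₀ T⁻¹ (inv_ne_zero hT.ne')).iSup_comp
      (g := fun x => |cdf μ x - cdf ν x|)).symm.trans (by simp [div_eq_mul_inv])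
  rw [hdist]
  have := kolmogorovDist_le_of_smoothed_le (μ := μ.map (T * ·)) (ν := ν.map (T * ·))
    (m := m / T) (by positivity) (fun x s hs => ?_)
    (fun x => by
      rw [smoothCdf_sub_smoothCdf_eq hint' x]
      exact abs_smoothDiff_le hint' x)
  · rw [hval] at this
    refine this.trans (le_of_eq ?_)
    field_simp
  · rw [cdf_map_mul _ hT, cdf_map_mul _ hT, add_div]
    have := hlip (x / T) (s / T) (by positivity)
    calc _ ≤ _ := this
      _ = _ := by ring

/-! ### Densities from integrable characteristic functions -/

/-- The density given by Fourier inversion of an integrable characteristic function. -/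
noncomputable def invDensity (μ : Measure ℝ) (u : ℝ) : ℝ :=
  (2 * Real.pi)⁻¹ * ∫ ξ : ℝ, (charFun μ ξ * Complex.exp (-(u * ξ * Complex.I))).re

section

variable {μ : Measure ℝ} [IsProbabilityMeasure μ]

omit [IsProbabilityMeasure μ] in
lemma norm_re_charFun_mul_exp_le (u ξ : ℝ) :
    ‖(charFun μ ξ * Complex.exp (-(u * ξ * Complex.I))).re‖ ≤ ‖charFun μ ξ‖ := by
  refine (Complex.abs_re_le_norm _).trans ?_
  rw [norm_mul, norm_exp_neg_mul_I, mul_one]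

lemma continuous_invDensity (h : Integrable (charFun μ)) : Continuous (invDensity μ) := by
  have hc := continuous_charFun (μ := μ)
  refine continuous_const.mul (continuous_of_dominated (bound := fun ξ => ‖charFun μ ξ‖)
    (fun u => (Continuous.aestronglyMeasurable (by fun_prop)))
    (fun u => Eventually.of_forall fun ξ => norm_re_charFun_mul_exp_le u ξ) h.norm
    (Eventually.of_forall fun ξ => by fun_prop))

omit [IsProbabilityMeasure μ] in
lemma abs_invDensity_le (h : Integrable (charFun μ)) (u : ℝ) :
    |invDensity μ u| ≤ (2 * Real.pi)⁻¹ * ∫ ξ : ℝ, ‖charFun μ ξ‖ := by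
  rw [invDensity, abs_mul, abs_of_pos (by positivity)]
  gcongr
  exact norm_integral_le_of_norm_le h.norm
    (Eventually.of_forall fun ξ => norm_re_charFun_mul_exp_le u ξ)

/-- The density of `μ` smoothed at scale `1 / T`, in Fourier variables. -/
lemma mul_smoothDensity_map_mul {T : ℝ} (hT : 0 < T) (u : ℝ) :
    T * smoothDensity (μ.map (T * ·)) (T * u) = (2 * Real.pi)⁻¹ *
      ∫ ξ : ℝ, max (1 - |ξ| / T) 0 * (charFun μ ξ * Complex.exp (-(u * ξ * Complex.I))).re := by
  have hμ' : IsProbabilityMeasure (μ.map (T * ·)) :=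
    Measure.isProbabilityMeasure_map (by fun_prop)
  let f : ℝ → ℝ := fun ξ =>
    max (1 - |ξ| / T) 0 * (charFun μ ξ * Complex.exp (-(u * ξ * Complex.I))).re
  have hsupp : Function.support f ⊆ Ioc (-T) T := by
    intro ξ hξ
    by_contra h
    apply hξ
    have : 1 - |ξ| / T ≤ 0 := by
      rw [sub_nonpos, one_le_div hT]
      simp only [mem_Ioc, not_and_or, not_lt, not_le] at h
      rcases h with h | h
      · linarith [neg_le_abs ξ]
      · linarith [le_abs_self ξ]
    simp only [f, max_eq_right this, zero_mul]
  rw [smoothDensity_eq, mul_left_comm]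
  congr 1
  change _ = ∫ ξ, f ξ
  rw [← intervalIntegral.integral_eq_integral_of_support_subset hsupp]
  have := intervalIntegral.mul_integral_comp_mul_left (a := -1) (b := 1) (f := f) T
  rw [mul_neg_one, mul_one] at this
  rw [← this]
  congr 1
  refine intervalIntegral.integral_congr fun ξ hξ => ?_
  rw [uIcc_of_le (by norm_num)] at hξ
  have h1 : |ξ| ≤ 1 := abs_le.mpr hξ
  simp only [f]
  rw [abs_mul, abs_of_pos hT, mul_div_cancel_left₀ _ hT.ne', max_eq_left (by linarith),
    charFun_map_mul]
  congr 5
  push_cast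
  ring

/-- Scaling by T before smoothing amounts to smoothing at scale 1/T, an approximate identity as T →
∞. -/
lemma tendsto_smoothCdf_map_mul {x : ℝ} (hx : ContinuousAt (fun y => cdf μ y) x) :
    Tendsto (fun T : ℝ => smoothCdf (μ.map (T * ·)) (T * x)) atTop (𝓝 (cdf μ x)) := by
  have h1 : cdf μ x = ∫ y, cdf μ x * fejer y := by
    rw [integral_const_mul, integral_fejer, mul_one]
  rw [h1]
  refine tendsto_integral_filter_of_dominated_convergence fejer ?_ ?_ integrable_fejer ?_
  · exact Eventually.of_forall fun x => (integrable_cdf_mul_fejer _ _).aestronglyMeasurable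
  · refine Eventually.of_forall fun T => Eventually.of_forall fun y => ?_
    rw [Real.norm_of_nonneg (mul_nonneg (cdf_nonneg _ _) (fejer_nonneg y))]
    exact mul_le_of_le_one_left (fejer_nonneg y) (cdf_le_one _ _)
  · refine Eventually.of_forall fun y => ?_
    refine Tendsto.mul_const _ ?_
    have h2 : Tendsto (fun T : ℝ => x - y / T) atTop (𝓝 x) := by
      simpa using (tendsto_const_nhds (x := x)).sub (tendsto_const_nhds.div_atTop tendsto_id)
    refine (hx.tendsto.comp h2).congr' ?_
    filter_upwards [eventually_gt_atTop 0] with T hT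
    rw [cdf_map_mul _ hT, Function.comp]
    congr 1
    field_simp

lemma tendsto_mul_smoothDensity (h : Integrable (charFun μ)) (u : ℝ) :
    Tendsto (fun T : ℝ => T * smoothDensity (μ.map (T * ·)) (T * u)) atTop
      (𝓝 (invDensity μ u)) := by
  have hc := continuous_charFun (μ := μ)
  have hmain : Tendsto (fun T : ℝ => (2 * Real.pi)⁻¹ * ∫ ξ : ℝ, max (1 - |ξ| / T) 0 *
      (charFun μ ξ * Complex.exp (-(u * ξ * Complex.I))).re) atTop (𝓝 (invDensity μ u)) := by
    refine Tendsto.const_mul _ ?_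
    refine tendsto_integral_filter_of_dominated_convergence (fun ξ => ‖charFun μ ξ‖)
      ?_ ?_ h.norm ?_
    · exact Eventually.of_forall fun T => Continuous.aestronglyMeasurable (by fun_prop)
    · filter_upwards [eventually_gt_atTop 0] with T hT
      refine Eventually.of_forall fun ξ => ?_
      rw [norm_mul, Real.norm_of_nonneg (le_max_right _ _)]
      have h1 : max (1 - |ξ| / T) 0 ≤ 1 := max_le (by
        have : 0 ≤ |ξ| / T := by positivity
        linarith) zero_le_one
      exact (mul_le_of_le_one_left (norm_nonneg _) h1).trans (norm_re_charFun_mul_exp_le u ξ)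
    · refine Eventually.of_forall fun ξ => ?_
      have h2 : Tendsto (fun T : ℝ => max (1 - |ξ| / T) 0) atTop (𝓝 (max (1 - 0) 0)) :=
        ((tendsto_const_nhds.sub (tendsto_const_nhds.div_atTop tendsto_id)).max
          tendsto_const_nhds)
      simpa using h2.mul_const _
  refine hmain.congr' ?_
  filter_upwards [eventually_gt_atTop 0] with T hT
  rw [mul_smoothDensity_map_mul hT]

lemma abs_mul_smoothDensity_le (h : Integrable (charFun μ)) {T : ℝ} (hT : 0 < T) (u : ℝ) :
    |T * smoothDensity (μ.map (T * ·)) (T * u)| ≤ (2 * Real.pi)⁻¹ * ∫ ξ : ℝ, ‖charFun μ ξ‖ := by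
  rw [mul_smoothDensity_map_mul hT, abs_mul, abs_of_pos (by positivity)]
  gcongr
  rw [← Real.norm_eq_abs]
  refine norm_integral_le_of_norm_le h.norm (Eventually.of_forall fun ξ => ?_)
  rw [norm_mul, Real.norm_of_nonneg (le_max_right _ _)]
  have h1 : max (1 - |ξ| / T) 0 ≤ 1 := max_le (by
    have : 0 ≤ |ξ| / T := by positivity
    linarith) zero_le_one
  exact (mul_le_of_le_one_left (norm_nonneg _) h1).trans (norm_re_charFun_mul_exp_le u ξ)

/-- Let T → ∞ in `smoothCdf_sub` for the law scaled by T: the left side converges at continuity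
points, and the densities converge boundedly. -/
lemma cdf_sub_cdf_eq_of_continuousAt (h : Integrable (charFun μ)) {a b : ℝ} (hab : a ≤ b)
    (ha : ContinuousAt (fun y => cdf μ y) a) (hb : ContinuousAt (fun y => cdf μ y) b) :
    cdf μ b - cdf μ a = ∫ u in a..b, invDensity μ u := by
  have h1 := (tendsto_smoothCdf_map_mul hb).sub (tendsto_smoothCdf_map_mul ha)
  have h2 : Tendsto (fun T : ℝ => ∫ u in a..b, T * smoothDensity (μ.map (T * ·)) (T * u)) atTop
      (𝓝 (∫ u in a..b, invDensity μ u)) := by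
    refine intervalIntegral.tendsto_integral_filter_of_dominated_convergence
      (fun _ => (2 * Real.pi)⁻¹ * ∫ ξ : ℝ, ‖charFun μ ξ‖) ?_ ?_ (by simp) ?_
    · refine Eventually.of_forall fun T => Continuous.aestronglyMeasurable ?_
      by_cases hT : IsProbabilityMeasure (μ.map (T * ·))
      · have := continuous_smoothDensity (μ.map (T * ·))
        fun_prop
      · exact absurd (Measure.isProbabilityMeasure_map (by fun_prop)) hT
    · filter_upwards [eventually_gt_atTop 0] with T hT
      exact Eventually.of_forall fun u _ => abs_mul_smoothDensity_le h hT u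
    · exact Eventually.of_forall fun u _ => tendsto_mul_smoothDensity h u
  refine tendsto_nhds_unique h1 (h2.congr' ?_)
  filter_upwards [eventually_gt_atTop 0] with T hT
  have hμ' : IsProbabilityMeasure (μ.map (T * ·)) :=
    Measure.isProbabilityMeasure_map (by fun_prop)
  rw [smoothCdf_sub _ (by gcongr), intervalIntegral.integral_const_mul,
    intervalIntegral.mul_integral_comp_mul_left (f := smoothDensity (μ.map (T * ·)))]

/-- Continuity points are dense, and there the distribution function agrees with a primitive of
`invDensity`; right continuity extends the agreement to every point. -/
lemma hasDerivAt_cdf (h : Integrable (charFun μ)) (x : ℝ) :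
    HasDerivAt (fun y => cdf μ y) (invDensity μ x) x := by
  have hc := continuous_invDensity h
  have hD : Dense {y : ℝ | ContinuousAt (fun y => cdf μ y) y} := by
    have := (monotone_cdf μ).countable_not_continuousAt.dense_compl ℝ
    refine this.mono fun y hy => ?_
    simpa using hy
  obtain ⟨x₁, hx₁⟩ := hD.nonempty
  have hI : ∀ a b, IntervalIntegrable (invDensity μ) volume a b :=
    fun a b => hc.intervalIntegrable a b
  let P : ℝ → ℝ := fun y => cdf μ x₁ + ∫ u in x₁..y, invDensity μ u
  have hP : ∀ y, HasDerivAt P (invDensity μ y) y := fun y =>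
    (hc.integral_hasStrictDerivAt x₁ y).hasDerivAt.const_add _
  have hPD : ∀ y, ContinuousAt (fun y => cdf μ y) y → cdf μ y = P y := by
    intro y hy
    rcases le_total x₁ y with hle | hle
    · have := cdf_sub_cdf_eq_of_continuousAt h hle hx₁ hy
      simp only [P]
      linarith
    · have := cdf_sub_cdf_eq_of_continuousAt h hle hy hx₁
      simp only [P]
      rw [intervalIntegral.integral_symm]
      linarith
  have hall : ∀ y, cdf μ y = P y := by
    intro y
    let S := Ioi y ∩ {y : ℝ | ContinuousAt (fun y => cdf μ y) y}
    have hyS : y ∈ closure S := by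
      have h1 := hD.open_subset_closure_inter (isOpen_Ioi (a := y))
      have h2 : y ∈ closure (Ioi y) := by simp [closure_Ioi]
      exact closure_minimal h1 isClosed_closure h2
    have hne : (𝓝[S] y).NeBot := mem_closure_iff_nhdsWithin_neBot.1 hyS
    have hl1 : Tendsto (fun z => cdf μ z) (𝓝[S] y) (𝓝 (cdf μ y)) :=
      ((cdf μ).right_continuous y).mono_left (nhdsWithin_mono _
        (inter_subset_left.trans Ioi_subset_Ici_self))
    have hl2 : Tendsto (fun z => cdf μ z) (𝓝[S] y) (𝓝 (P y)) := by
      refine ((hP y).continuousAt.tendsto.mono_left nhdsWithin_le_nhds).congr' ?_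
      filter_upwards [self_mem_nhdsWithin] with z hz
      exact (hPD z hz.2).symm
    exact tendsto_nhds_unique hl1 hl2
  have : (fun y => cdf μ y) = P := funext hall
  rw [this]
  exact hP x

end

/-! ### The density of a symmetric stable law -/

lemma integrable_comp_abs {f : ℝ → ℝ} (h : IntegrableOn f (Ioi 0)) :
    Integrable fun x : ℝ => f |x| := by
  have h1 : IntegrableOn (fun x : ℝ => f |x|) (Ioi 0) :=
    h.congr_fun (fun x hx => by simp only [abs_of_pos (mem_Ioi.1 hx)]) measurableSet_Ioi
  have h2 : IntegrableOn (fun x : ℝ => f |x|) (Iic 0) := by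
    rw [integrableOn_Iic_iff_integrableOn_Iio]
    rw [← integrable_indicator_iff measurableSet_Iio]
    refine ((integrable_indicator_iff measurableSet_Ioi).2 h1).comp_neg.congr
      (Eventually.of_forall fun x => ?_)
    by_cases hx : x < 0 <;> simp [hx]
  rw [← integrableOn_univ, ← Iic_union_Ioi (a := (0 : ℝ))]
  exact h2.union h1

section

variable {α a₀ : ℝ} {G : Measure ℝ} [IsProbabilityMeasure G]

omit [IsProbabilityMeasure G] in
lemma IsSymmetricStable.integrable_charFun (hG : IsSymmetricStable α a₀ G) (hα : 0 < α)
    (ha₀ : 0 < a₀) : Integrable (charFun G) := by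
  have h1 : IntegrableOn (fun x : ℝ => Real.exp (-a₀ * x ^ α)) (Ioi 0) := by
    have := integrableOn_rpow_mul_exp_neg_mul_rpow (p := α) (s := 0) (b := a₀) (by norm_num) hα ha₀
    refine this.congr_fun (fun x _ => by simp) measurableSet_Ioi
  have h2 : Integrable fun x : ℝ => Real.exp (-a₀ * |x| ^ α) :=
    integrable_comp_abs (f := fun x => Real.exp (-a₀ * x ^ α)) h1
  refine h2.ofReal.congr (Eventually.of_forall fun x => ?_)
  rw [hG x]
  simp

lemma IsSymmetricStable.differentiable_cdf (hG : IsSymmetricStable α a₀ G) (hα : 0 < α)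
    (ha₀ : 0 < a₀) : Differentiable ℝ (fun x => cdf G x) :=
  fun x => (hasDerivAt_cdf (hG.integrable_charFun hα ha₀) x).differentiableAt

/-- The supremum of an unbounded family of reals is 0 by convention, so a bound on the density is
needed before `densitySupNorm` dominates anything. -/
lemma IsSymmetricStable.abs_deriv_cdf_le (hG : IsSymmetricStable α a₀ G) (hα : 0 < α)
    (ha₀ : 0 < a₀) (x : ℝ) : |deriv (fun y => cdf G y) x| ≤ densitySupNorm G := by
  have h := hG.integrable_charFun hα ha₀
  refine le_ciSup (f := fun x => |deriv (fun y => cdf G y) x|)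
    ⟨(2 * Real.pi)⁻¹ * ∫ ξ : ℝ, ‖charFun G ξ‖, ?_⟩ x
  rintro _ ⟨y, rfl⟩
  simp only
  rw [(hasDerivAt_cdf h y).deriv]
  exact abs_invDensity_le h y

end

/-! ### The modulus of φ₀ near 0 under normal attraction -/

section

variable {α : ℝ} {μ₀ : Measure ℝ} [IsProbabilityMeasure μ₀]

/-- Passing to the modulus removes the centring b. -/
lemma norm_charFun_normalized_sum (n : ℕ) (a b t : ℝ) :
    ‖charFun ((Measure.infinitePi (fun _ : ℕ => μ₀)).map
      (fun x : ℕ → ℝ => ((∑ i ∈ Finset.range n, x i) / a - b))) t‖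
      = ‖charFun μ₀ (t / a)‖ ^ n := by
  have hind : iIndepFun (fun (i : ℕ) (x : ℕ → ℝ) => x i)
      (Measure.infinitePi (fun _ : ℕ => μ₀)) :=
    iIndepFun_infinitePi (X := fun _ => id) (fun _ => measurable_id)
  have hsum : charFun ((Measure.infinitePi (fun _ : ℕ => μ₀)).map
      (fun x : ℕ → ℝ => ∑ i ∈ Finset.range n, x i)) (t / a) = charFun μ₀ (t / a) ^ n := by
    rw [(hind.restrict _).charFun_map_fun_finsetSum_eq_prod
      (fun i _ => (measurable_pi_apply i).aemeasurable)]
    simp [Measure.infinitePi_map_eval]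
  have hmap : (Measure.infinitePi (fun _ : ℕ => μ₀)).map
      (fun x : ℕ → ℝ => ((∑ i ∈ Finset.range n, x i) / a - b))
      = (((Measure.infinitePi (fun _ : ℕ => μ₀)).map
        (fun x : ℕ → ℝ => ∑ i ∈ Finset.range n, x i)).map (a⁻¹ * ·)).map (· + (-b)) := by
    rw [Measure.map_map (by fun_prop) (by fun_prop), Measure.map_map (by fun_prop) (by fun_prop)]
    congr 1
    ext x
    simp only [Function.comp]
    ring
  rw [hmap, charFun_map_add_const, charFun_map_mul, norm_mul]
  have : a⁻¹ * t = t / a := by ring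
  rw [this, hsum, norm_pow, Complex.norm_exp]
  simp

/-- A limit along integers n becomes a limit along real x → 0⁺. With n = ⌊x^{-α}⌋ the factor x
n^{1/α} tends to 1, so by Slutsky's theorem the normalized sum may be multiplied by it without
changing the limit law. The result is x times the sum, up to centring, and its characteristic
function at 1 has modulus |φ₀(x)|ⁿ. -/
lemma tendsto_norm_charFun_pow {a₀ : ℝ} {G : Measure ℝ} [IsProbabilityMeasure G]
    (hα : 0 < α) (hG : IsSymmetricStable α a₀ G)
    (hD : InDomainOfNormalAttraction α μ₀ G) :
    Tendsto (fun x : ℝ => ‖charFun μ₀ x‖ ^ ⌊x ^ (-α)⌋₊) (𝓝[>] 0) (𝓝 (Real.exp (-a₀))) := by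
  obtain ⟨m, hm⟩ := hD
  let N : ℝ → ℕ := fun x => ⌊x ^ (-α)⌋₊
  have hpow : Tendsto (fun x : ℝ => x ^ (-α)) (𝓝[>] 0) atTop := tendsto_rpow_neg_nhdsGT_zero (neg_lt_zero.2 hα)
  have hN : Tendsto N (𝓝[>] 0) atTop := tendsto_nat_floor_atTop.comp hpow
  let c : ℝ → ℝ := fun x => x * (N x : ℝ) ^ (1 / α)
  have hc : Tendsto c (𝓝[>] 0) (𝓝 1) := by
    have h1 : Tendsto (fun x : ℝ => ((N x : ℝ) / x ^ (-α)) ^ (1 / α)) (𝓝[>] 0) (𝓝 (1 ^ (1 / α))) :=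
      ((tendsto_nat_floor_div_atTop (R := ℝ)).comp hpow).rpow_const (Or.inl one_ne_zero)
    rw [Real.one_rpow] at h1
    refine h1.congr' ?_
    filter_upwards [self_mem_nhdsWithin] with x (hx : 0 < x)
    rw [Real.div_rpow (Nat.cast_nonneg _) (by positivity), ← Real.rpow_mul hx.le]
    have : -α * (1 / α) = -1 := by field_simp
    rw [this, Real.rpow_neg_one, div_inv_eq_mul, mul_comm]
  have hX : TendstoInDistribution (fun (x : ℝ) (ω : ℕ → ℝ) =>
      (∑ i ∈ Finset.range (N x), ω i) / ((N x : ℕ) : ℝ) ^ (1 / α) - m (N x)) (𝓝[>] 0)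
      (id : ℝ → ℝ) (fun _ => Measure.infinitePi (fun _ : ℕ => μ₀)) G :=
    { forall_aemeasurable := fun x => hm.forall_aemeasurable (N x)
      aemeasurable_limit := hm.aemeasurable_limit
      tendsto := hm.tendsto.comp hN }
  have hY : TendstoInMeasure (Measure.infinitePi (fun _ : ℕ => μ₀))
      (fun (x : ℝ) (_ : ℕ → ℝ) => c x) (𝓝[>] 0) (fun _ => (1 : ℝ)) := by
    intro ε hε
    refine tendsto_const_nhds.congr' ?_
    have := (EMetric.tendsto_nhds.1 hc) ε hε
    filter_upwards [this] with x hx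
    have hempty : {ω : ℕ → ℝ | ε ≤ edist (c x) 1} = ∅ := by
      ext ω
      simpa using hx
    rw [hempty, measure_empty]
  have hZ := hX.continuous_comp_prodMk_of_tendstoInMeasure_const
    (g := fun q : ℝ × ℝ => q.1 * q.2) (by fun_prop) hY (fun _ => by fun_prop)
  have h := (ProbabilityMeasure.tendsto_iff_forall_integral_rclike_tendsto ℂ).1 hZ.tendsto
  have h1 := (h (BoundedContinuousFunction.innerProbChar (1 : ℝ))).norm
  simp only [ProbabilityMeasure.coe_mk, ← charFun_eq_integral_innerProbChar, mul_one, id] at h1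
  rw [Measure.map_id', hG 1] at h1
  simp only [abs_one, Real.one_rpow, mul_one] at h1
  rw [Complex.norm_real, Real.norm_of_nonneg (Real.exp_nonneg _)] at h1
  refine h1.congr' ?_
  filter_upwards [self_mem_nhdsWithin, hN.eventually_ge_atTop 1] with x (hx : 0 < x) hNx
  have hmap : (fun ω : ℕ → ℝ => ((∑ i ∈ Finset.range (N x), ω i) / ((N x : ℕ) : ℝ) ^ (1 / α)
      - m (N x)) * c x) = fun ω : ℕ → ℝ => (∑ i ∈ Finset.range (N x), ω i) / (1 / x)
        - m (N x) * c x := by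
    ext ω
    have : ((N x : ℕ) : ℝ) ^ (1 / α) ≠ 0 := by
      have : (0 : ℝ) < N x := by exact_mod_cast hNx
      positivity
    simp only [c]
    field_simp
  rw [hmap, norm_charFun_normalized_sum]
  simp [N]

/-- With L = log|φ₀(x)| the preceding limit gives L / x^α → -a₀, and 1 - |φ₀|² = 1 - e^{2L} behaves
like -2L. -/
lemma tendsto_one_sub_normSq_charFun {a₀ : ℝ} {G : Measure ℝ} [IsProbabilityMeasure G]
    (hα : 0 < α) (hG : IsSymmetricStable α a₀ G)
    (hD : InDomainOfNormalAttraction α μ₀ G) :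
    Tendsto (fun x : ℝ => (1 - ‖charFun μ₀ x‖ ^ 2) / x ^ α) (𝓝[>] 0) (𝓝 (2 * a₀)) := by
  have h0 := tendsto_norm_charFun_pow hα hG hD
  have hpow : Tendsto (fun x : ℝ => x ^ (-α)) (𝓝[>] 0) atTop := tendsto_rpow_neg_nhdsGT_zero (neg_lt_zero.2 hα)
  have hxα : Tendsto (fun x : ℝ => x ^ α) (𝓝[>] 0) (𝓝 0) := by
    have : Tendsto (fun x : ℝ => x ^ α) (𝓝 0) (𝓝 (0 ^ α)) :=
      (Real.continuousAt_rpow_const 0 α (Or.inr hα.le)).tendsto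
    rw [Real.zero_rpow hα.ne'] at this
    exact this.mono_left nhdsWithin_le_nhds
  have hfl := (tendsto_nat_floor_div_atTop (R := ℝ)).comp hpow
  let L : ℝ → ℝ := fun x => Real.log ‖charFun μ₀ x‖
  have h1 : Tendsto (fun x => (⌊x ^ (-α)⌋₊ : ℝ) * L x) (𝓝[>] 0) (𝓝 (-a₀)) := by
    have := h0.log (Real.exp_pos _).ne'
    simpa [Real.log_exp, Real.log_pow] using this
  have h2 : Tendsto (fun x => L x / x ^ α) (𝓝[>] 0) (𝓝 (-a₀)) := by
    have := h1.div hfl one_ne_zero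
    rw [div_one] at this
    refine this.congr' ?_
    filter_upwards [self_mem_nhdsWithin, hpow.eventually_ge_atTop 1] with x (hx : 0 < x) hx1
    have hf : (0 : ℝ) < (⌊x ^ (-α)⌋₊ : ℝ) := by
      exact_mod_cast Nat.floor_pos.2 hx1
    simp only [Pi.div_apply, Function.comp]
    have h3 := Real.rpow_pos_of_pos hx α
    have h4 : x ^ (-α) = (x ^ α)⁻¹ := Real.rpow_neg hx.le α
    rw [h4] at hf ⊢
    generalize (⌊(x ^ α)⁻¹⌋₊ : ℝ) = k at hf ⊢
    field_simp
  have hL : Tendsto (fun x => 2 * L x) (𝓝[>] 0) (𝓝 0) := by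
    have := (h2.mul hxα).const_mul 2
    simp only [mul_zero] at this
    refine this.congr' ?_
    filter_upwards [self_mem_nhdsWithin] with x (hx : 0 < x)
    have := Real.rpow_pos_of_pos hx α
    field_simp
  -- `dslope` is (e^y - 1)/y continued by 1 at y = 0, so the case L = 0 needs no separate treatment.
  have hds : Tendsto (fun x => dslope Real.exp 0 (2 * L x)) (𝓝[>] 0) (𝓝 1) := by
    have hc : ContinuousAt (dslope Real.exp 0) 0 :=
      continuousAt_dslope_same.2 Real.differentiableAt_exp
    have := hc.tendsto.comp hL
    rw [dslope_same, Real.deriv_exp, Real.exp_zero] at this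
    exact this
  have h3 := ((h2.mul hds).const_mul (-2))
  have h4 : -2 * (-a₀ * 1) = 2 * a₀ := by ring
  rw [h4] at h3
  refine h3.congr' ?_
  have hpos : ∀ᶠ x in 𝓝[>] (0 : ℝ), 0 < ‖charFun μ₀ x‖ := by
    filter_upwards [h0.eventually_const_lt (Real.exp_pos (-a₀)),
      hpow.eventually_ge_atTop 1] with x hx hx1
    by_contra hn
    have hz : ‖charFun μ₀ x‖ = 0 := le_antisymm (not_lt.1 hn) (norm_nonneg _)
    rw [hz, zero_pow (Nat.floor_pos.2 hx1).ne'] at hx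
    exact lt_irrefl _ hx
  filter_upwards [hpos] with x hx
  have h5 := sub_smul_dslope Real.exp 0 (2 * L x)
  rw [sub_zero, smul_eq_mul, Real.exp_zero, mul_comm 2 (L x), Real.exp_mul, Real.exp_log hx,
    Real.rpow_two] at h5
  rw [← neg_sub, ← h5, mul_comm 2 (L x)]
  ring

end

/-! ### From the modulus to the real part of φ₀ -/

section

variable {α : ℝ} {μ₀ : Measure ℝ} [IsProbabilityMeasure μ₀]

lemma exists_one_sub_normSq_charFun_le {b : ℝ} (hα : 0 < α)
    (h : Tendsto (fun x : ℝ => (1 - ‖charFun μ₀ x‖ ^ 2) / x ^ α) (𝓝[>] 0) (𝓝 b)) :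
    ∃ C, 0 ≤ C ∧ ∀ t, 1 - ‖charFun μ₀ t‖ ^ 2 ≤ C * |t| ^ α := by
  have h1 := h.eventually_le_const (lt_add_one b)
  obtain ⟨δ, hδ, hδ'⟩ := mem_nhdsGT_iff_exists_Ioo_subset.1 h1
  have hδ0 : 0 < δ := hδ
  refine ⟨max (max (b + 1) (1 / δ ^ α)) 0, le_max_right _ _, fun t => ?_⟩
  rcases eq_or_ne t 0 with rfl | ht
  · simp [Real.zero_rpow hα.ne']
  have ht0 : 0 < |t| := abs_pos.2 ht
  have hta : 0 < |t| ^ α := Real.rpow_pos_of_pos ht0 α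
  have hnorm : ‖charFun μ₀ t‖ = ‖charFun μ₀ |t|‖ := by
    rcases abs_choice t with hc | hc
    · rw [hc]
    · rw [hc, charFun_neg, RCLike.norm_conj]
  rw [← div_le_iff₀ hta]
  rcases lt_or_ge |t| δ with hlt | hge
  · have := hδ' ⟨ht0, hlt⟩
    simp only [mem_ofPred_eq] at this
    rw [hnorm]
    exact this.trans ((le_max_left _ _).trans (le_max_left _ _))
  · refine le_trans ?_ ((le_max_right _ _).trans (le_max_left _ _))
    gcongr
    linarith [sq_nonneg ‖charFun μ₀ t‖]

/-- |φ₀|² is the characteristic function of X - X′ with X, X′ independent, and the tail of a law is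
controlled by the mean of 1 minus its characteristic function near 0. -/
lemma exists_tail_conv_le {C : ℝ} (hα : 0 < α) (hC : 0 ≤ C)
    (h : ∀ t, 1 - ‖charFun μ₀ t‖ ^ 2 ≤ C * |t| ^ α) {r : ℝ} (hr : 0 < r) :
    (μ₀ ∗ μ₀.map (fun x => -x)).real {x | r < |x|} ≤ 2 * C * 2 ^ α * r ^ (-α) := by
  have hneg : IsProbabilityMeasure (μ₀.map (fun x => -x)) :=
    Measure.isProbabilityMeasure_map (by fun_prop)
  have hcf : ∀ t, charFun (μ₀ ∗ μ₀.map (fun x => -x)) t = ((‖charFun μ₀ t‖ ^ 2 : ℝ) : ℂ) := by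
    intro t
    have h1 : (μ₀.map (fun x => -x)) = μ₀.map (fun x => (-1 : ℝ) * x) := by simp
    rw [charFun_conv, h1, charFun_map_mul, neg_one_mul, charFun_neg, Complex.mul_conj,
      Complex.normSq_eq_norm_sq]
  refine (measureReal_abs_gt_le_integral_charFun hr).trans ?_
  have h2 : ‖∫ t in (-2 * r⁻¹)..(2 * r⁻¹), 1 - charFun (μ₀ ∗ μ₀.map (fun x => -x)) t‖
      ≤ C * (2 * r⁻¹) ^ α * |2 * r⁻¹ - -2 * r⁻¹| := by
    refine intervalIntegral.norm_integral_le_of_norm_le_const fun t ht => ?_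
    rw [hcf, ← Complex.ofReal_one, ← Complex.ofReal_sub, Complex.norm_real]
    have h3 : ‖charFun μ₀ t‖ ^ 2 ≤ 1 := pow_le_one₀ (norm_nonneg _) (norm_charFun_le_one t)
    rw [Real.norm_of_nonneg (by linarith)]
    refine (h t).trans ?_
    rw [uIoc_of_le (by
      have : 0 < r⁻¹ := by positivity
      linarith)] at ht
    have : |t| ≤ 2 * r⁻¹ := abs_le.2 ⟨by linarith [ht.1], ht.2⟩
    gcongr
  calc _ ≤ 2⁻¹ * r * (C * (2 * r⁻¹) ^ α * |2 * r⁻¹ - -2 * r⁻¹|) := by gcongr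
    _ = 2 * C * 2 ^ α * r ^ (-α) := by
      have h4 : 2 * r⁻¹ - -2 * r⁻¹ = 4 * r⁻¹ := by ring
      rw [h4, abs_of_pos (by positivity), Real.mul_rpow (by norm_num) (by positivity),
        Real.inv_rpow hr.le, Real.rpow_neg hr.le]
      field_simp
      ring

/-- Weak symmetrization: choose A with |X′| ≤ A with probability at least 1/2. For r > 2A, on that
event |X| > r forces |X - X′| > r/2. For r ≤ 2A the constant (2A)^α makes the bound trivial. -/
lemma exists_tail_le {C : ℝ} (hα : 0 < α)
    (h : ∀ r : ℝ, 0 < r → (μ₀ ∗ μ₀.map (fun x => -x)).real {x | r < |x|} ≤ C * r ^ (-α)) :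
    ∃ C', 0 ≤ C' ∧ ∀ r : ℝ, 0 < r → μ₀.real {x | r < |x|} ≤ C' * r ^ (-α) := by
  have hneg : IsProbabilityMeasure (μ₀.map (fun x => -x)) :=
    Measure.isProbabilityMeasure_map (by fun_prop)
  have hC : 0 ≤ C := by
    have := (measureReal_nonneg).trans (h 1 one_pos)
    simpa using this
  obtain ⟨A, hA0, hA⟩ : ∃ A : ℝ, 0 < A ∧ 1 / 2 ≤ μ₀.real {x | |x| ≤ A} := by
    have h1 : Tendsto (fun n : ℕ => μ₀.real {x | |x| ≤ (n : ℝ)}) atTop (𝓝 (μ₀.real univ)) := by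
      have hU : (⋃ n : ℕ, {x : ℝ | |x| ≤ (n : ℝ)}) = univ := by
        ext x
        simpa using exists_nat_ge |x|
      rw [← hU]
      refine (ENNReal.tendsto_toReal (measure_ne_top _ _)).comp
        (tendsto_measure_iUnion_atTop ?_)
      intro a b hab x hx
      have hx' : |x| ≤ (a : ℝ) := hx
      exact hx'.trans (by exact_mod_cast hab)
    rw [probReal_univ] at h1
    obtain ⟨n, hn, hn1⟩ :=
      ((h1.eventually_const_le (by norm_num : (1 / 2 : ℝ) < 1)).and
        (eventually_ge_atTop 1)).exists
    exact ⟨n, by exact_mod_cast hn1, hn⟩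
  have hmeasA : MeasurableSet {x : ℝ | |x| ≤ A} := measurableSet_le measurable_norm measurable_const
  have hms : ∀ r : ℝ, MeasurableSet {x : ℝ | r < |x|} := fun r =>
    measurableSet_lt measurable_const measurable_norm
  refine ⟨max ((2 * A) ^ α) (2 * C * 2 ^ α), le_max_of_le_right (by positivity), fun r hr => ?_⟩
  rcases le_or_gt r (2 * A) with hle | hgt
  · calc μ₀.real {x | r < |x|} ≤ 1 := measureReal_le_one
      _ ≤ (2 * A) ^ α * r ^ (-α) := by
        rw [Real.rpow_neg hr.le, ← div_eq_mul_inv, one_le_div (by positivity)]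
        gcongr
      _ ≤ _ := by
        gcongr
        exact le_max_left _ _
  · have h2 : μ₀.real {x | r < |x|} * (1 / 2)
        ≤ (μ₀ ∗ μ₀.map (fun x => -x)).real {x | r / 2 < |x|} := by
      calc μ₀.real {x | r < |x|} * (1 / 2)
          ≤ μ₀.real {x | r < |x|} * μ₀.real {x | |x| ≤ A} := by gcongr
        _ = μ₀.real {x | r < |x|} * (μ₀.map (fun x => -x)).real {x | |x| ≤ A} := by
          rw [map_measureReal_apply (by fun_prop) hmeasA]
          simp
        _ = (μ₀.prod (μ₀.map (fun x => -x))).real ({x | r < |x|} ×ˢ {x | |x| ≤ A}) := by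
          rw [measureReal_prod_prod]
        _ ≤ (μ₀ ∗ μ₀.map (fun x => -x)).real {x | r / 2 < |x|} := by
          rw [Measure.conv, map_measureReal_apply (by fun_prop) (hms _)]
          refine measureReal_mono ?_
          rintro ⟨x, y⟩ ⟨hx, hy⟩
          simp only [mem_ofPred_eq, mem_preimage] at hx hy ⊢
          have := abs_sub_abs_le_abs_sub x (-y)
          rw [abs_neg, sub_neg_eq_add] at this
          linarith
    have h3 := h (r / 2) (by positivity)
    rw [Real.div_rpow hr.le (by norm_num), Real.rpow_neg (by norm_num : (0 : ℝ) ≤ 2),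
      div_inv_eq_mul] at h3
    calc μ₀.real {x | r < |x|} ≤ 2 * C * 2 ^ α * r ^ (-α) := by linarith
      _ ≤ _ := by
        gcongr
        exact le_max_right _ _

lemma abs_im_charFun_le (ξ : ℝ) :
    |(charFun μ₀ ξ).im| ≤ ∫ x, min 1 |ξ * x| ∂μ₀ := by
  rw [charFun_apply_real]
  have hi : Integrable (fun x : ℝ => Complex.exp (ξ * x * Complex.I)) μ₀ := by
    refine Integrable.of_bound (C := 1) (Continuous.aestronglyMeasurable (by fun_prop)) ?_
    refine Eventually.of_forall fun z => ?_
    rw [← Complex.ofReal_mul, Complex.norm_exp_ofReal_mul_I]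
  have hcomm := Complex.imCLM.integral_comp_comm hi
  simp only [Complex.imCLM_apply] at hcomm
  rw [← hcomm, ← Real.norm_eq_abs]
  refine norm_integral_le_of_norm_le ?_ ?_
  · refine Integrable.of_bound (C := 1) (Continuous.aestronglyMeasurable (by fun_prop)) ?_
    refine Eventually.of_forall fun x => ?_
    rw [Real.norm_of_nonneg (by positivity)]
    exact min_le_left _ _
  · refine Eventually.of_forall fun x => ?_
    rw [← Complex.ofReal_mul, Complex.exp_ofReal_mul_I_im, Real.norm_eq_abs]
    exact le_min (Real.abs_sin_le_one _) (Real.abs_sin_le_abs)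

/-- Layer-cake formula for E min(1, |ξX|). The tail probability P is enlarged to P^θ, so that
t^{-αθ} is integrable at 0 even when α ≥ 1. -/
lemma exists_abs_im_charFun_le {C θ : ℝ} (hC : 0 ≤ C)
    (h : ∀ r : ℝ, 0 < r → μ₀.real {x | r < |x|} ≤ C * r ^ (-α)) (hθ : 0 ≤ θ) (hθ1 : θ ≤ 1)
    (hαθ : α * θ < 1) :
    ∃ C', ∀ ξ, 0 < ξ → |(charFun μ₀ ξ).im| ≤ C' * ξ ^ (α * θ) := by
  refine ⟨C ^ θ * ∫ t in Ioc (0 : ℝ) 1, t ^ (-(α * θ)), fun ξ hξ => ?_⟩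
  refine (abs_im_charFun_le ξ).trans ?_
  have hi : Integrable (fun x => min 1 |ξ * x|) μ₀ := by
    refine Integrable.of_bound (C := 1) (Continuous.aestronglyMeasurable (by fun_prop)) ?_
    refine Eventually.of_forall fun x => ?_
    rw [Real.norm_of_nonneg (by positivity)]
    exact min_le_left _ _
  have hint : IntegrableOn (fun t : ℝ => t ^ (-(α * θ))) (Ioc 0 1) := by
    rw [← intervalIntegrable_iff_integrableOn_Ioc_of_le zero_le_one]
    exact intervalIntegral.intervalIntegrable_rpow' (by linarith)
  rw [hi.integral_eq_integral_meas_lt (Eventually.of_forall fun x => by positivity)]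
  calc ∫ t in Ioi (0 : ℝ), μ₀.real {x | t < min 1 |ξ * x|}
      = ∫ t in Ioc (0 : ℝ) 1, μ₀.real {x | t < min 1 |ξ * x|} := by
        refine setIntegral_eq_of_subset_of_forall_sdiff_eq_zero measurableSet_Ioi
          Ioc_subset_Ioi_self fun t ht => ?_
        have ht1 : 1 < t := by
          by_contra hn
          exact ht.2 ⟨ht.1, not_lt.1 hn⟩
        have : {x : ℝ | t < min 1 |ξ * x|} = ∅ := by
          ext x
          simp only [mem_ofPred_eq, mem_empty_iff_false, iff_false, not_lt]
          exact (min_le_left _ _).trans ht1.le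
        rw [this, measureReal_empty]
    _ ≤ ∫ t in Ioc (0 : ℝ) 1, (C ^ θ * ξ ^ (α * θ)) * t ^ (-(α * θ)) := by
        refine integral_mono_of_nonneg (Eventually.of_forall fun t => measureReal_nonneg)
          (hint.const_mul _) ?_
        filter_upwards [ae_restrict_mem measurableSet_Ioc] with t ht
        have ht0 : 0 < t := ht.1
        set P := μ₀.real {x | t / ξ < |x|} with hP
        have h1 : μ₀.real {x | t < min 1 |ξ * x|} ≤ P := by
          refine measureReal_mono fun x hx => ?_
          simp only [mem_ofPred_eq, lt_min_iff, abs_mul, abs_of_pos hξ] at hx ⊢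
          rw [div_lt_iff₀ hξ, mul_comm]
          exact hx.2
        have h2 : P ≤ P ^ θ := by
          have := Real.rpow_le_rpow_of_exponent_ge' (x := P) measureReal_nonneg measureReal_le_one
            hθ hθ1
          rwa [Real.rpow_one] at this
        calc _ ≤ P := h1
          _ ≤ P ^ θ := h2
          _ ≤ (C * (t / ξ) ^ (-α)) ^ θ := by
            have := h (t / ξ) (by positivity)
            gcongr
          _ = _ := by
            rw [Real.mul_rpow hC (by positivity), ← Real.rpow_mul (by positivity),
              Real.div_rpow ht0.le hξ.le, neg_mul, Real.rpow_neg hξ.le, div_inv_eq_mul]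
            ring
    _ = _ := by
        rw [integral_const_mul]
        ring

/-- Write 1 - |φ₀|² = (1 - Re φ₀)(1 + Re φ₀) - (Im φ₀)². The last square is O(x^{2αθ}) = o(x^α), and
1 + Re φ₀ → 2. -/
lemma tendsto_one_sub_re_charFun {a₀ : ℝ} {G : Measure ℝ} [IsProbabilityMeasure G]
    (hα : 0 < α) (hα2 : α < 2) (hG : IsSymmetricStable α a₀ G)
    (hD : InDomainOfNormalAttraction α μ₀ G) :
    Tendsto (fun x : ℝ => (1 - (charFun μ₀ x).re) / x ^ α) (𝓝[>] 0) (𝓝 a₀) := by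
  have h := tendsto_one_sub_normSq_charFun hα hG hD
  obtain ⟨C, hC, h1⟩ := exists_one_sub_normSq_charFun_le hα h
  obtain ⟨C₂, hC₂, h2⟩ := exists_tail_le hα fun r hr => exists_tail_conv_le hα hC h1 hr
  have hinv : 1 / 2 < 1 / α := one_div_lt_one_div_of_lt hα hα2
  -- Needed: θ ≤ 1, θ > 1/2 so that (Im φ₀)² = o(x^α), and θ < 1/α. The midpoint of 1/2 and 1/α
  -- serves because α < 2.
  let θ : ℝ := min 1 ((1 / 2 + 1 / α) / 2)
  have hθ : 1 / 2 < θ := lt_min (by norm_num) (by linarith)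
  have hαθ : α * θ < 1 := by
    have h3 : α * θ ≤ α * ((1 / 2 + 1 / α) / 2) := by
      gcongr
      exact min_le_right _ _
    have h4 : α * ((1 / 2 + 1 / α) / 2) = α / 4 + 1 / 2 := by field_simp; ring
    linarith
  obtain ⟨C₃, h3⟩ := exists_abs_im_charFun_le hC₂ h2 (by linarith) (min_le_left _ _) hαθ
  have him : Tendsto (fun x : ℝ => (charFun μ₀ x).im ^ 2 / x ^ α) (𝓝[>] 0) (𝓝 0) := by
    have hexp : 0 < 2 * (α * θ) - α := by nlinarith
    have hz : Tendsto (fun x : ℝ => C₃ ^ 2 * x ^ (2 * (α * θ) - α)) (𝓝[>] 0) (𝓝 0) := by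
      have : Tendsto (fun x : ℝ => C₃ ^ 2 * x ^ (2 * (α * θ) - α)) (𝓝 0)
          (𝓝 (C₃ ^ 2 * 0 ^ (2 * (α * θ) - α))) :=
        (Real.continuousAt_rpow_const 0 _ (Or.inr hexp.le)).tendsto.const_mul _
      rw [Real.zero_rpow hexp.ne', mul_zero] at this
      exact this.mono_left nhdsWithin_le_nhds
    refine squeeze_zero' ?_ ?_ hz
    · filter_upwards [self_mem_nhdsWithin] with x (hx : 0 < x)
      positivity
    · filter_upwards [self_mem_nhdsWithin] with x (hx : 0 < x)
      rw [div_le_iff₀ (by positivity), mul_assoc, ← Real.rpow_add hx, sub_add_cancel,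
        ← sq_abs]
      calc |(charFun μ₀ x).im| ^ 2 ≤ (C₃ * x ^ (α * θ)) ^ 2 := by
            have := h3 x hx
            gcongr
        _ = C₃ ^ 2 * x ^ (2 * (α * θ)) := by
            rw [mul_pow, ← Real.rpow_natCast (x ^ (α * θ)), ← Real.rpow_mul hx.le]
            congr 2
            push_cast
            ring
  have hre : Tendsto (fun x : ℝ => 1 + (charFun μ₀ x).re) (𝓝[>] 0) (𝓝 2) := by
    have hc : Continuous fun x : ℝ => 1 + (charFun μ₀ x).re :=
      continuous_const.add (Complex.continuous_re.comp continuous_charFun)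
    have := hc.tendsto 0
    simp only [charFun_zero, probReal_univ, Complex.ofReal_one, Complex.one_re] at this
    norm_num at this
    exact this.mono_left nhdsWithin_le_nhds
  have hfin := (h.add him).div hre two_ne_zero
  have he : (2 * a₀ + 0) / 2 = a₀ := by ring
  rw [he] at hfin
  refine hfin.congr' ?_
  filter_upwards [hre.eventually_const_lt (by norm_num : (0 : ℝ) < 2)] with x hx
  simp only [Pi.div_apply]
  rw [← add_div, ← Complex.normSq_eq_norm_sq, Complex.normSq_apply, div_right_comm]
  congr 1
  rw [div_eq_iff hx.ne']
  ring

/-! ### The function `v₀*` -/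

lemma vStar_abs (α a₀ : ℝ) (μ₀ : Measure ℝ) (ξ : ℝ) : vStar α a₀ μ₀ |ξ| = vStar α a₀ μ₀ ξ := by
  have hre : (charFun μ₀ |ξ|).re = (charFun μ₀ ξ).re := by
    rcases abs_choice ξ with hc | hc
    · rw [hc]
    · rw [hc, charFun_neg, Complex.conj_re]
  simp only [vStar, abs_eq_zero, abs_abs, hre]

lemma vStar_zero (α a₀ : ℝ) (μ₀ : Measure ℝ) : vStar α a₀ μ₀ 0 = 0 := by simp [vStar]

lemma one_sub_re_charFun_eq (a₀ : ℝ) (hα : 0 < α) (ξ : ℝ) :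
    1 - (charFun μ₀ ξ).re = (a₀ + vStar α a₀ μ₀ ξ) * |ξ| ^ α := by
  rcases eq_or_ne ξ 0 with rfl | h
  · simp [Real.zero_rpow hα.ne']
  · have : |ξ| ^ α ≠ 0 := (Real.rpow_pos_of_pos (abs_pos.2 h) α).ne'
    simp only [vStar, h, if_false]
    field_simp
    ring

lemma measurable_vStar (α a₀ : ℝ) : Measurable (vStar α a₀ μ₀) := by
  unfold vStar
  have := measurable_charFun (μ := μ₀)
  exact Measurable.ite (measurableSet_singleton 0) measurable_const (by fun_prop)

variable {a₀ : ℝ} {G : Measure ℝ} [IsProbabilityMeasure G]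

lemma tendsto_vStar (hα : 0 < α) (hα2 : α < 2) (hG : IsSymmetricStable α a₀ G)
    (hD : InDomainOfNormalAttraction α μ₀ G) :
    Tendsto (vStar α a₀ μ₀) (𝓝 0) (𝓝 0) := by
  have h := (tendsto_one_sub_re_charFun hα hα2 hG hD).sub_const a₀
  rw [sub_self] at h
  have h1 : Tendsto (vStar α a₀ μ₀) (𝓝[>] 0) (𝓝 0) := by
    refine h.congr' ?_
    filter_upwards [self_mem_nhdsWithin] with x (hx : 0 < x)
    simp [vStar, hx.ne', abs_of_pos hx]
  have h2 : Tendsto (vStar α a₀ μ₀) (𝓝[≥] 0) (𝓝 0) := by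
    rw [← Ioi_insert, nhdsWithin_insert]
    refine Tendsto.sup ?_ h1
    rw [tendsto_pure_left]
    intro s hs
    rw [vStar_zero]
    exact mem_of_mem_nhds hs
  have h3 : Tendsto (fun x : ℝ => |x|) (𝓝 0) (𝓝[≥] 0) := by
    refine tendsto_nhdsWithin_iff.2 ⟨?_, Eventually.of_forall fun x => abs_nonneg x⟩
    simpa using (continuous_abs (G := ℝ)).tendsto 0
  refine (h2.comp h3).congr fun x => ?_
  exact vStar_abs α a₀ μ₀ x

/-- Boundedness makes the suprema `vNorm` and `vBar` genuine upper bounds. Near 0 it follows from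
the limit, and elsewhere from 1 - Re φ₀ ≤ 2. -/
lemma exists_abs_vStar_le (hα : 0 < α) (hα2 : α < 2) (ha₀ : 0 < a₀)
    (hG : IsSymmetricStable α a₀ G) (hD : InDomainOfNormalAttraction α μ₀ G) :
    ∃ B, ∀ ξ, |vStar α a₀ μ₀ ξ| ≤ B := by
  have h := (tendsto_vStar hα hα2 hG hD).abs
  rw [abs_zero] at h
  obtain ⟨δ, hδ, hδ'⟩ := Metric.eventually_nhds_iff.1 (h.eventually_le_const one_pos)
  refine ⟨max 1 (2 / δ ^ α + a₀), fun ξ => ?_⟩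
  rcases lt_or_ge |ξ| δ with hlt | hge
  · exact (hδ' (by simpa using hlt)).trans (le_max_left _ _)
  · refine le_trans ?_ (le_max_right _ _)
    have hξ : ξ ≠ 0 := by
      rintro rfl
      rw [abs_zero] at hge
      linarith
    simp only [vStar, hξ, if_false]
    refine (abs_sub _ _).trans ?_
    rw [abs_of_pos ha₀, abs_div, abs_of_nonneg (Real.rpow_nonneg (abs_nonneg ξ) α)]
    have h1 : |1 - (charFun μ₀ ξ).re| ≤ 2 := by
      have := (Complex.abs_re_le_norm _).trans (norm_charFun_le_one (μ := μ₀) ξ)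
      rw [abs_le] at this ⊢
      constructor <;> linarith
    gcongr

end

/-! ### Admissible d and the comparison of products -/

section

variable {α a₀ : ℝ} {μ₀ : Measure ℝ}

lemma abs_vStar_le_vNorm {B : ℝ} (hB : ∀ ξ, |vStar α a₀ μ₀ ξ| ≤ B) (ξ : ℝ) :
    |vStar α a₀ μ₀ ξ| ≤ vNorm α a₀ μ₀ := by
  rw [← vStar_abs]
  exact le_csSup ⟨B, by rintro _ ⟨x, _, rfl⟩; exact hB x⟩ ⟨|ξ|, abs_nonneg ξ, rfl⟩

lemma vNorm_nonneg : 0 ≤ vNorm α a₀ μ₀ :=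
  Real.sSup_nonneg (by rintro _ ⟨x, _, rfl⟩; exact abs_nonneg _)

lemma constM_pos (ha₀ : 0 < a₀) : 0 < constM α a₀ μ₀ :=
  add_pos_of_pos_of_nonneg ha₀ vNorm_nonneg

lemma abs_vStar_le_vBar {B : ℝ} (hB : ∀ ξ, |vStar α a₀ μ₀ ξ| ≤ B) (ξ : ℝ) :
    |vStar α a₀ μ₀ ξ| ≤ vBar α a₀ μ₀ |ξ| := by
  rw [← vStar_abs]
  exact le_csSup ⟨B, by rintro _ ⟨x, _, rfl⟩; exact hB x⟩ ⟨|ξ|, ⟨abs_nonneg ξ, le_rfl⟩, rfl⟩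

lemma dTilde_pos (ha₀ : 0 < a₀) {d : ℝ} (hd : 0 < d) : 0 < dTilde α a₀ μ₀ d := by
  have := constM_pos (α := α) (μ₀ := μ₀) ha₀
  unfold dTilde
  positivity

/-- For d < 1 this value is below 3/8, which is how d̃ keeps 1 - Re φ₀ in the range of
`exists_one_sub_eq_exp`. -/
lemma dTilde_rpow (hα : 0 < α) (ha₀ : 0 < a₀) {d : ℝ} (hd : 0 < d) :
    constM α a₀ μ₀ * dTilde α a₀ μ₀ d ^ α = 3 * d / 8 := by
  have := constM_pos (α := α) (μ₀ := μ₀) ha₀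
  rw [dTilde, ← Real.rpow_mul (by positivity), one_div_mul_cancel hα.ne', Real.rpow_one]
  field_simp

/-- Both terms of the condition tend to 0 with x, and d̃ → 0 as d → 0⁺; each term is allotted η/2.
-/
lemma exists_isAdmissible [IsProbabilityMeasure μ₀] {η : ℝ} (hα : 0 < α) (ha₀ : 0 < a₀)
    (hη : 0 < η) (hv : Tendsto (vStar α a₀ μ₀) (𝓝 0) (𝓝 0)) :
    ∃ d, IsAdmissible α a₀ μ₀ η d := by
  have hM := constM_pos (α := α) (μ₀ := μ₀) ha₀
  have h1 := hv.abs
  rw [abs_zero] at h1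
  have h2 : Tendsto (fun x : ℝ => 4 / 5 * constM α a₀ μ₀ ^ 2 * |x| ^ α) (𝓝 0) (𝓝 0) := by
    have hc : Continuous fun x : ℝ => 4 / 5 * constM α a₀ μ₀ ^ 2 * |x| ^ α :=
      continuous_const.mul (continuous_abs.rpow_const fun _ => Or.inr hα.le)
    simpa [Real.zero_rpow hα.ne'] using hc.tendsto 0
  obtain ⟨δ, hδ, hδ'⟩ := Metric.eventually_nhds_iff.1
    ((h1.eventually_le_const (half_pos hη)).and (h2.eventually_le_const (half_pos hη)))
  have h3 : Tendsto (fun d => dTilde α a₀ μ₀ d) (𝓝[>] 0) (𝓝 0) := by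
    have hc : Continuous fun d => dTilde α a₀ μ₀ d := by
      unfold dTilde
      exact (by fun_prop : Continuous fun d : ℝ => 3 * d / (8 * constM α a₀ μ₀)).rpow_const
        fun _ => Or.inr (by positivity)
    have := hc.tendsto 0
    simp only [dTilde, mul_zero, zero_div, Real.zero_rpow (one_div_pos.2 hα).ne'] at this
    exact this.mono_left nhdsWithin_le_nhds
  obtain ⟨d, hdδ, hd⟩ := ((h3.eventually_lt_const hδ).and
    (Ioo_mem_nhdsGT (zero_lt_one (α := ℝ)))).exists
  refine ⟨d, hd, fun x hx => ?_⟩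
  have hxδ : |x| < δ := hx.trans_lt hdδ
  have h4 := (hδ' (y := x) (by simpa using hxδ)).2
  have h5 : vBar α a₀ μ₀ |x| ≤ η / 2 := by
    refine csSup_le ((nonempty_Icc.2 (abs_nonneg x)).image _) ?_
    rintro _ ⟨y, hy, rfl⟩
    refine (hδ' (y := y) ?_).1
    rw [dist_zero_right, Real.norm_of_nonneg hy.1]
    exact hy.2.trans_lt hxδ
  linarith

/-- The logarithm estimate behind the comparison of the product of characteristic functions with
an exponential. -/
lemma exists_one_sub_eq_exp {r : ℝ} (h0 : 0 ≤ r) (h1 : r ≤ 3 / 8) :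
    ∃ ρ, 0 ≤ ρ ∧ ρ ≤ 4 / 5 * r ^ 2 ∧ 1 - r = Real.exp (-(r + ρ)) := by
  have hpos : 0 < 1 - r := by linarith
  refine ⟨-Real.log (1 - r) - r, ?_, ?_, ?_⟩
  · linarith [Real.log_le_sub_one_of_pos hpos]
  · -- the function `t ↦ 4/5 t² + t + log (1 - t)` is increasing on `[0, 3/8]`
    have hmono : MonotoneOn (fun t : ℝ => 4 / 5 * t ^ 2 + t + Real.log (1 - t))
        (Icc 0 (3 / 8)) := by
      have hd : ∀ t ∈ Icc (0 : ℝ) (3 / 8), HasDerivAt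
          (fun t : ℝ => 4 / 5 * t ^ 2 + t + Real.log (1 - t))
          (4 / 5 * (2 * t) + 1 + -1 / (1 - t)) t := by
        intro t ht
        have ht1 : 1 - t ≠ 0 := by linarith [ht.2]
        have := (((hasDerivAt_pow 2 t).const_mul (4 / 5)).add (hasDerivAt_id t)).add
          (((hasDerivAt_id t).const_sub 1).log ht1)
        convert! this using 1
        simp
      refine monotoneOn_of_deriv_nonneg (convex_Icc _ _)
        (fun t ht => (hd t ht).continuousAt.continuousWithinAt)
        (fun t ht => ((hd t (interior_subset ht)).differentiableAt).differentiableWithinAt) ?_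
      intro t ht
      have ht' := interior_subset ht
      rw [(hd t ht').deriv]
      have ht1 : 0 < 1 - t := by linarith [ht'.2]
      -- The factor 3/5 - (8/5) t vanishes at t = 3/8; this pairs the constant 4/5 with the range r
      -- ≤ 3/8.
      have : 4 / 5 * (2 * t) + 1 + -1 / (1 - t) = t * (3 / 5 - 8 / 5 * t) / (1 - t) := by
        field_simp
        ring
      rw [this]
      refine div_nonneg (mul_nonneg ht'.1 ?_) ht1.le
      linarith [ht'.2]
    have := hmono ⟨le_rfl, by norm_num⟩ ⟨h0, h1⟩ h0
    simp only [ne_eq, OfNat.ofNat_ne_zero, not_false_eq_true, zero_pow, mul_zero, add_zero,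
      sub_zero, Real.log_one] at this
    linarith
  · rw [add_sub_cancel, neg_neg, Real.exp_log hpos]

/-- The product of the values at `b ξ`, `b ∈ L`, of the real part of the characteristic function
is close to that of the stable law. -/
lemma abs_prod_sub_exp_le [IsProbabilityMeasure μ₀] {η d B ξ : ℝ} (hα : 0 < α) (ha₀ : 0 < a₀)
    (hB : ∀ ξ, |vStar α a₀ μ₀ ξ| ≤ B) (hd : IsAdmissible α a₀ μ₀ η d) {L : List ℝ}
    (hL : (L.map fun b => |b| ^ α).sum = 1) (hξ : ∀ b ∈ L, |b * ξ| ≤ dTilde α a₀ μ₀ d) :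
    |(L.map fun b => (charFun μ₀ (b * ξ)).re).prod - Real.exp (-(a₀ * |ξ| ^ α))| ≤
      ((L.map fun b => |b| ^ α * |vStar α a₀ μ₀ (ξ * |b|)|).sum * |ξ| ^ α
        + 4 / 5 * constM α a₀ μ₀ ^ 2 * (L.map fun b => |b| ^ (2 * α)).sum * |ξ| ^ (2 * α)) *
        Real.exp (-((a₀ - η) * |ξ| ^ α)) := by
  have hM := constM_pos (α := α) (μ₀ := μ₀) ha₀
  have hv : ∀ b, vStar α a₀ μ₀ (b * ξ) = vStar α a₀ μ₀ (ξ * |b|) := by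
    intro b
    rw [← vStar_abs, ← vStar_abs (ξ := ξ * |b|), abs_mul, abs_mul, abs_abs, mul_comm]
  -- The product is written as one exponential with error exponent E. Two bounds on E are carried
  -- through the induction: a fine one, which becomes the estimate, and the crude one by η|ξ|^α ∑
  -- |b|^α from admissibility, which will control e^{|E|}. The normalization of ∑ |b|^α is not
  -- stable under removing an entry, so it is left out here.
  have key : ∀ L : List ℝ, (∀ b ∈ L, |b * ξ| ≤ dTilde α a₀ μ₀ d) →
      ∃ E, (L.map fun b => (charFun μ₀ (b * ξ)).re).prod
          = Real.exp (-(a₀ * |ξ| ^ α * (L.map fun b => |b| ^ α).sum) + E) ∧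
        |E| ≤ (L.map fun b => |b| ^ α * |vStar α a₀ μ₀ (ξ * |b|)|).sum * |ξ| ^ α
          + 4 / 5 * constM α a₀ μ₀ ^ 2 * (L.map fun b => |b| ^ (2 * α)).sum * |ξ| ^ (2 * α) ∧
        |E| ≤ η * |ξ| ^ α * (L.map fun b => |b| ^ α).sum := by
    intro L
    induction L with
    | nil => intro _; exact ⟨0, by simp, by simp, by simp⟩
    | cons b L ih =>
      intro hb
      obtain ⟨E, h1, h2, h3⟩ := ih fun c hc => hb c (List.mem_cons_of_mem _ hc)
      have hbξ := hb b List.mem_cons_self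
      set r := 1 - (charFun μ₀ (b * ξ)).re with hr
      set v := vStar α a₀ μ₀ (ξ * |b|) with hvd
      have hr1 : r = (a₀ + v) * |b * ξ| ^ α := by
        rw [hr, one_sub_re_charFun_eq a₀ hα, hv]
      have hr0 : 0 ≤ r := by
        have := (le_abs_self _).trans ((Complex.abs_re_le_norm _).trans
          (norm_charFun_le_one (μ := μ₀) (b * ξ)))
        linarith
      have hpow : 0 ≤ |b * ξ| ^ α := by positivity
      have hrM : r ≤ constM α a₀ μ₀ * |b * ξ| ^ α := by
        rw [hr1]
        have := (le_abs_self _).trans (abs_vStar_le_vNorm hB (ξ * |b|))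
        unfold constM
        gcongr
      have hr38 : r ≤ 3 / 8 := by
        have h4 : |b * ξ| ^ α ≤ dTilde α a₀ μ₀ d ^ α := by gcongr
        have h5 := dTilde_rpow (μ₀ := μ₀) hα ha₀ hd.1.1
        have h6 := hd.1.2
        calc r ≤ _ := hrM
          _ ≤ constM α a₀ μ₀ * dTilde α a₀ μ₀ d ^ α := by gcongr
          _ ≤ 3 / 8 := by rw [h5]; linarith
      obtain ⟨ρ, hρ0, hρ1, hρ⟩ := exists_one_sub_eq_exp hr0 hr38
      have hsplit : |b * ξ| ^ α = |b| ^ α * |ξ| ^ α := by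
        rw [abs_mul, Real.mul_rpow (abs_nonneg _) (abs_nonneg _)]
      have hsq : |b| ^ (2 * α) * |ξ| ^ (2 * α) = (|b * ξ| ^ α) ^ 2 := by
        rw [hsplit, mul_pow, ← Real.rpow_natCast, ← Real.rpow_natCast,
          ← Real.rpow_mul (abs_nonneg _), ← Real.rpow_mul (abs_nonneg _)]
        simp only [Nat.cast_ofNat, mul_comm α]
      have hρ2 : ρ ≤ 4 / 5 * constM α a₀ μ₀ ^ 2 * (|b * ξ| ^ α) ^ 2 := by
        calc ρ ≤ 4 / 5 * r ^ 2 := hρ1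
          _ ≤ 4 / 5 * (constM α a₀ μ₀ * |b * ξ| ^ α) ^ 2 := by gcongr
          _ = _ := by ring
      have hstep : |E - v * |b * ξ| ^ α - ρ| ≤ |E| + |v| * |b * ξ| ^ α + ρ := by
        refine (abs_sub _ _).trans ?_
        rw [abs_of_nonneg hρ0]
        gcongr
        refine (abs_sub _ _).trans ?_
        rw [abs_mul, abs_of_nonneg hpow]
      refine ⟨E - v * |b * ξ| ^ α - ρ, ?_, ?_, ?_⟩
      · have h7 : (charFun μ₀ (b * ξ)).re = 1 - r := by rw [hr]; ring
        rw [List.map_cons, List.prod_cons, h1, h7, hρ, ← Real.exp_add, List.map_cons,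
          List.sum_cons, hr1, hsplit]
        congr 1
        ring
      · refine hstep.trans ?_
        simp only [List.map_cons, List.sum_cons]
        have h8 : |b| ^ α * |v| * |ξ| ^ α = |v| * |b * ξ| ^ α := by rw [hsplit]; ring
        have h9 : 4 / 5 * constM α a₀ μ₀ ^ 2 * |b| ^ (2 * α) * |ξ| ^ (2 * α)
            = 4 / 5 * constM α a₀ μ₀ ^ 2 * (|b * ξ| ^ α) ^ 2 := by rw [← hsq]; ring
        rw [add_mul, mul_add (4 / 5 * constM α a₀ μ₀ ^ 2), add_mul, h8, h9]
        linarith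
      · refine hstep.trans ?_
        simp only [List.map_cons, List.sum_cons]
        have hadm := hd.2 (b * ξ) hbξ
        have hvb : |v| ≤ vBar α a₀ μ₀ |b * ξ| := by
          rw [hvd, ← hv]
          exact abs_vStar_le_vBar hB _
        have h10 : |v| * |b * ξ| ^ α + ρ ≤ η * |b * ξ| ^ α := by
          calc |v| * |b * ξ| ^ α + ρ
              ≤ vBar α a₀ μ₀ |b * ξ| * |b * ξ| ^ α
                + 4 / 5 * constM α a₀ μ₀ ^ 2 * (|b * ξ| ^ α) ^ 2 := by gcongr
            _ = (4 / 5 * constM α a₀ μ₀ ^ 2 * |b * ξ| ^ α + vBar α a₀ μ₀ |b * ξ|)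
                * |b * ξ| ^ α := by ring
            _ ≤ η * |b * ξ| ^ α := by gcongr
        have h11 : η * |ξ| ^ α * |b| ^ α = η * |b * ξ| ^ α := by rw [hsplit]; ring
        rw [mul_add, h11]
        linarith
  obtain ⟨E, h1, h2, h3⟩ := key L hξ
  rw [hL, mul_one] at h1 h3
  rw [h1, Real.exp_add]
  have hexp : |Real.exp E - 1| ≤ |E| * Real.exp |E| := by
    rcases le_total 0 E with h | h
    · rw [abs_of_nonneg h, abs_of_nonneg (by linarith [Real.add_one_le_exp E])]
      have h4 := Real.add_one_le_exp (-E)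
      have h5 : Real.exp (-E) * Real.exp E = 1 := by rw [← Real.exp_add]; simp
      nlinarith [Real.exp_pos E]
    · rw [abs_of_nonpos h, abs_of_nonpos (by
        have := Real.exp_le_one_iff.2 h
        linarith)]
      have h4 := Real.add_one_le_exp E
      have h5 := Real.one_le_exp (neg_nonneg.2 h)
      nlinarith
  calc |Real.exp (-(a₀ * |ξ| ^ α)) * Real.exp E - Real.exp (-(a₀ * |ξ| ^ α))|
      = Real.exp (-(a₀ * |ξ| ^ α)) * |Real.exp E - 1| := by
        rw [← mul_sub_one, abs_mul, abs_of_pos (Real.exp_pos _)]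
    _ ≤ Real.exp (-(a₀ * |ξ| ^ α)) * (|E| * Real.exp |E|) := by gcongr
    -- Since ∑ |b|^α = 1, the crude bound costs only the change of a₀ into a₀ - η in the exponent.
    _ ≤ Real.exp (-(a₀ * |ξ| ^ α)) * (|E| * Real.exp (η * |ξ| ^ α)) := by gcongr
    _ = |E| * Real.exp (-((a₀ - η) * |ξ| ^ α)) := by
        rw [mul_left_comm, ← Real.exp_add]
        congr 2
        ring
    _ ≤ _ := by gcongr

end

/-! ### Sequences of independent angles -/

/-- The sequence with first term `a` and remaining terms `x`. -/
def seqCons (q : ℝ × (ℕ → ℝ)) : ℕ → ℝ := fun k => Nat.casesOn k q.1 q.2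

@[simp] lemma seqCons_zero (q : ℝ × (ℕ → ℝ)) : seqCons q 0 = q.1 := rfl

@[simp] lemma seqCons_succ (q : ℝ × (ℕ → ℝ)) (k : ℕ) : seqCons q (k + 1) = q.2 k := rfl

lemma measurable_seqCons : Measurable seqCons := by
  rw [measurable_pi_iff]
  intro k
  cases k with
  | zero => exact measurable_fst
  | succ k => exact (measurable_pi_apply k).comp measurable_snd

section

variable {ν : Measure ℝ} [IsProbabilityMeasure ν]

/-- This separates the root angle from the others, leaving an independent copy of the sequence. It
is checked on cylinders, enlarged to an initial segment of coordinates so that the first one is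
always included. -/
lemma map_seqCons :
    (ν.prod (Measure.infinitePi fun _ : ℕ => ν)).map seqCons
      = Measure.infinitePi fun _ : ℕ => ν := by
  classical
  refine Measure.eq_infinitePi _ fun s t ht => ?_
  obtain ⟨N, hN⟩ : ∃ N, s ⊆ Finset.range (N + 1) :=
    ⟨s.sup id, fun i hi => Finset.mem_range.2 (Nat.lt_succ_of_le (Finset.le_sup (f := id) hi))⟩
  let t' : ℕ → Set ℝ := fun i => if i ∈ s then t i else univ
  have ht' : ∀ i, MeasurableSet (t' i) := by
    intro i
    by_cases hi : i ∈ s <;> simp [t', hi, ht]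
  have hpi : Set.pi (s : Set ℕ) t = Set.pi (Finset.range (N + 1) : Set ℕ) t' := by
    ext x
    simp only [Set.mem_pi, Finset.mem_coe]
    constructor
    · intro h i _
      by_cases hi : i ∈ s
      · simpa [t', hi] using h i hi
      · simp [t', hi]
    · intro h i hi
      simpa [t', hi] using h i (hN hi)
  have hpre : seqCons ⁻¹' (Set.pi (Finset.range (N + 1) : Set ℕ) t')
      = t' 0 ×ˢ Set.pi (Finset.range N : Set ℕ) (fun i => t' (i + 1)) := by
    ext q
    simp only [mem_preimage, Set.mem_pi, Finset.coe_range, mem_Iio, mem_prod]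
    constructor
    · intro h
      exact ⟨h 0 (Nat.succ_pos _), fun i hi => h (i + 1) (by lia)⟩
    · rintro ⟨h0, h⟩ i hi
      cases i with
      | zero => exact h0
      | succ i => exact h i (by lia)
  have hmeas : MeasurableSet (Set.pi (Finset.range (N + 1) : Set ℕ) t') :=
    MeasurableSet.pi (Finset.countable_toSet _) fun i _ => ht' i
  rw [hpi, Measure.map_apply measurable_seqCons hmeas, hpre, Measure.prod_prod,
    Measure.infinitePi_pi _ (fun i _ => ht' (i + 1)), mul_comm,
    ← Finset.prod_range_succ' (fun i => ν (t' i))]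
  rw [← Finset.prod_subset hN]
  · exact Finset.prod_congr rfl fun i hi => by simp [t', hi]
  · intro i _ hi
    simp [t', hi]

lemma integral_infinitePi_eq {f : (ℕ → ℝ) → ℝ} (hf : Measurable f) {C : ℝ}
    (hC : ∀ x, |f x| ≤ C) :
    ∫ x, f x ∂(Measure.infinitePi fun _ : ℕ => ν)
      = ∫ a, ∫ x, f (seqCons (a, x)) ∂(Measure.infinitePi fun _ : ℕ => ν) ∂ν := by
  conv_lhs => rw [← map_seqCons]
  rw [integral_map measurable_seqCons.aemeasurable hf.aestronglyMeasurable, integral_prod]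
  exact Integrable.of_bound (hf.comp measurable_seqCons).aestronglyMeasurable C
    (Eventually.of_forall fun q => hC _)

lemma map_shift (n : ℕ) :
    (Measure.infinitePi fun _ : ℕ => ν).map (fun x k => x (k + n))
      = Measure.infinitePi fun _ : ℕ => ν :=
  Measure.map_infinitePi_infinitePi_of_inj (P := fun _ : ℕ => ν) (f := fun k => k + n)
    (add_left_injective n)

lemma integral_comp_shift {f : (ℕ → ℝ) → ℝ} (hf : Measurable f) (n : ℕ) :
    ∫ x, f (fun k => x (k + n)) ∂(Measure.infinitePi fun _ : ℕ => ν)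
      = ∫ x, f x ∂(Measure.infinitePi fun _ : ℕ => ν) := by
  conv_rhs => rw [← map_shift (ν := ν) n]
  rw [integral_map (measurable_pi_lambda _ fun k => measurable_pi_apply _).aemeasurable
    hf.aestronglyMeasurable]

/-- A function of the first `n` coordinates is independent of a function of the others. -/
lemma integral_mul_comp_shift {f g : (ℕ → ℝ) → ℝ} (hf : Measurable f) (hg : Measurable g)
    {C D : ℝ} (hC : ∀ x, |f x| ≤ C) (hD : ∀ x, |g x| ≤ D) (n : ℕ)
    (hfn : ∀ x y : ℕ → ℝ, (∀ k < n, x k = y k) → f x = f y) :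
    ∫ x, f x * g (fun k => x (k + n)) ∂(Measure.infinitePi fun _ : ℕ => ν)
      = (∫ x, f x ∂(Measure.infinitePi fun _ : ℕ => ν)) *
        ∫ x, g x ∂(Measure.infinitePi fun _ : ℕ => ν) := by
  induction n generalizing f with
  | zero =>
    have hc : ∀ x, f x = f 0 := fun x => hfn x 0 (by simp)
    simp [hc, integral_const_mul]
  -- With the first coordinate fixed, f becomes a function of the next n coordinates.
  | succ n ih =>
    have hC0 : 0 ≤ C := (abs_nonneg _).trans (hC 0)
    have hm : Measurable fun x : ℕ → ℝ => f x * g (fun k => x (k + (n + 1))) :=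
      hf.mul (hg.comp (by fun_prop))
    have hb : ∀ x : ℕ → ℝ, |f x * g (fun k => x (k + (n + 1)))| ≤ C * D := by
      intro x
      rw [abs_mul]
      exact mul_le_mul (hC _) (hD _) (abs_nonneg _) hC0
    rw [integral_infinitePi_eq hm hb, integral_infinitePi_eq hf hC, ← integral_mul_const]
    congr 1
    ext a
    have hstep : ∀ x : ℕ → ℝ, (fun k => seqCons (a, x) (k + (n + 1))) = fun k => x (k + n) := by
      intro x
      ext k
      rw [← add_assoc, seqCons_succ]
    simp_rw [hstep]
    refine ih (f := fun x => f (seqCons (a, x)))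
      (hf.comp (measurable_seqCons.comp measurable_prodMk_left)) (fun x => hC _) ?_
    intro x y hxy
    refine hfn _ _ fun k hk => ?_
    cases k with
    | zero => rfl
    | succ k => exact hxy k (by lia)

end

/-! ### The law of the angles -/

instance : IsProbabilityMeasure angleLaw := by
  unfold angleLaw
  exact cond_isProbabilityMeasure_of_finite (by simp [Real.pi_pos])
    measure_Ico_lt_top.ne

lemma integral_angleLaw (f : ℝ → ℝ) :
    ∫ θ, f θ ∂angleLaw = 1 / (2 * Real.pi) * ∫ θ in (0 : ℝ)..(2 * Real.pi), f θ := by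
  rw [angleLaw, ProbabilityTheory.cond, integral_smul_measure,
    intervalIntegral.integral_of_le (by positivity), integral_Ico_eq_integral_Ioc]
  simp [Real.pi_pos.le]

@[fun_prop]
lemma measurable_cosP (p : ℝ) : Measurable (cosP p) := by
  unfold cosP
  fun_prop

@[fun_prop]
lemma measurable_sinP (p : ℝ) : Measurable (sinP p) := by
  unfold sinP
  fun_prop

lemma alpha_pos {p : ℝ} (hp : 0 < p) : 0 < alpha p := by
  unfold alpha
  positivity

lemma alpha_lt_two {p : ℝ} (hp : 0 < p) : alpha p < 2 := by
  unfold alpha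
  rw [div_lt_iff₀ (by positivity)]
  linarith

/-- The relation α(1 + p) = 2 turns powers of |c| and |s| into powers of |cos| and |sin|. -/
lemma abs_mul_abs_rpow_rpow {p : ℝ} (hp : 0 < p) (x s : ℝ) :
    |x * |x| ^ p| ^ (s * alpha p) = |x| ^ (2 * s) := by
  rcases eq_or_ne x 0 with rfl | hx
  · rcases eq_or_ne s 0 with rfl | hs
    · simp
    · have := (alpha_pos hp).ne'
      simp [Real.zero_rpow, hs, this]
  have hx0 : 0 < |x| := abs_pos.2 hx
  rw [abs_mul, abs_of_nonneg (Real.rpow_nonneg (abs_nonneg x) p)]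
  have h1 : |x| * |x| ^ p = |x| ^ (1 + p) := by rw [Real.rpow_add hx0, Real.rpow_one]
  rw [h1, ← Real.rpow_mul hx0.le]
  congr 1
  unfold alpha
  field_simp

lemma abs_cosP_rpow_add {p : ℝ} (hp : 0 < p) (θ : ℝ) :
    |cosP p θ| ^ alpha p + |sinP p θ| ^ alpha p = 1 := by
  have h1 := abs_mul_abs_rpow_rpow hp (Real.cos θ) 1
  have h2 := abs_mul_abs_rpow_rpow hp (Real.sin θ) 1
  rw [one_mul, mul_one, Real.rpow_two, sq_abs] at h1 h2
  rw [cosP, sinP, h1, h2, Real.cos_sq_add_sin_sq]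

lemma constA_two_mul_eq_sin {p : ℝ} (hp : 0 < p) (s : ℝ) :
    ∫ θ, |sinP p θ| ^ (s * alpha p) ∂angleLaw = constA (2 * s) := by
  rw [integral_angleLaw, constA]
  simp only [sinP, abs_mul_abs_rpow_rpow hp]

/-- A shift by π/2 turns sin into cos, and periodicity restores the interval. -/
lemma constA_two_mul_eq_cos {p : ℝ} (hp : 0 < p) (s : ℝ) :
    ∫ θ, |cosP p θ| ^ (s * alpha p) ∂angleLaw = constA (2 * s) := by
  rw [integral_angleLaw, constA]
  simp only [cosP, abs_mul_abs_rpow_rpow hp]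
  congr 1
  have hper : Function.Periodic (fun θ : ℝ => |Real.sin θ| ^ (2 * s)) (2 * Real.pi) := by
    intro θ
    simp
  have h1 := intervalIntegral.integral_comp_add_right (a := 0) (b := 2 * Real.pi)
    (fun θ : ℝ => |Real.sin θ| ^ (2 * s)) (Real.pi / 2)
  simp only [Real.sin_add_pi_div_two] at h1
  rw [h1, zero_add, add_comm (2 * Real.pi), hper.intervalIntegral_add_eq (Real.pi / 2) 0, zero_add]

lemma constA_four : constA 4 = 3 / 8 := by
  have h : ∀ θ : ℝ, |Real.sin θ| ^ (4 : ℝ) = Real.sin θ ^ 4 := by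
    intro θ
    have : (4 : ℝ) = ((4 : ℕ) : ℝ) := by norm_num
    rw [this, Real.rpow_natCast, Even.pow_abs (by decide)]
  simp only [constA, h]
  have h4 := integral_sin_pow (a := 0) (b := 2 * Real.pi) 2
  have h2 := integral_sin_pow (a := 0) (b := 2 * Real.pi) 0
  norm_num at h4 h2
  rw [h4, h2]
  field_simp
  norm_num

lemma constA_six : constA 6 = 5 / 16 := by
  have h : ∀ θ : ℝ, |Real.sin θ| ^ (6 : ℝ) = Real.sin θ ^ 6 := by
    intro θ
    have : (6 : ℝ) = ((6 : ℕ) : ℝ) := by norm_num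
    rw [this, Real.rpow_natCast, Even.pow_abs (by decide)]
  simp only [constA, h]
  have h6 := integral_sin_pow (a := 0) (b := 2 * Real.pi) 4
  have h4 := integral_sin_pow (a := 0) (b := 2 * Real.pi) 2
  have h2 := integral_sin_pow (a := 0) (b := 2 * Real.pi) 0
  norm_num at h6 h4 h2
  rw [h6, h4, h2]
  field_simp
  norm_num

/-! ### The weights -/

/-- The weights as measurable functions of the sequence of angles. -/
noncomputable def weightFns (p : ℝ) : BinaryTree Unit → List ((ℕ → ℝ) → ℝ)
  | .nil => [fun _ => 1]
  | .node _ l r =>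
      (weightFns p l).map (fun h θ => cosP p (θ 0) * h (fun k => θ (k + 1))) ++
        (weightFns p r).map (fun h θ => sinP p (θ 0) * h (fun k => θ (k + 1 + l.numNodes)))

lemma weights_eq (p : ℝ) (g : BinaryTree Unit) (θ : ℕ → ℝ) :
    weights p g θ = (weightFns p g).map fun h => h θ := by
  induction g generalizing θ with
  | nil => simp [weights, weightFns]
  | node _ l r hl hr => simp [weights, weightFns, hl, hr, Function.comp_def]

lemma measurable_of_mem_weightFns (p : ℝ) (g : BinaryTree Unit) :
    ∀ h ∈ weightFns p g, Measurable h := by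
  induction g with
  | nil => simp [weightFns]
  | node _ l r hl hr =>
    intro h hh
    simp only [weightFns, List.mem_append, List.mem_map] at hh
    rcases hh with ⟨k, hk, rfl⟩ | ⟨k, hk, rfl⟩
    · exact ((measurable_cosP p).comp (measurable_pi_apply 0)).mul
        ((hl k hk).comp (measurable_pi_lambda _ fun k => measurable_pi_apply _))
    · exact ((measurable_sinP p).comp (measurable_pi_apply 0)).mul
        ((hr k hk).comp (measurable_pi_lambda _ fun k => measurable_pi_apply _))

lemma measurable_sum_weights (p : ℝ) (g : BinaryTree Unit) {f : ℝ → ℝ} (hf : Measurable f) :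
    Measurable fun θ => ((weights p g θ).map f).sum := by
  have key : ∀ L : List ((ℕ → ℝ) → ℝ), (∀ h ∈ L, Measurable h) →
      Measurable fun θ => ((L.map fun h => h θ).map f).sum := by
    intro L
    induction L with
    | nil => simp
    | cons h L ih =>
      intro hL
      simp only [List.map_cons, List.sum_cons]
      exact (hf.comp (hL h List.mem_cons_self)).add
        (ih fun k hk => hL k (List.mem_cons_of_mem _ hk))
  simp only [weights_eq]
  exact key _ (measurable_of_mem_weightFns p g)

lemma measurable_prod_weights (p : ℝ) (g : BinaryTree Unit) {f : ℝ → ℝ} (hf : Measurable f) :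
    Measurable fun θ => ((weights p g θ).map f).prod := by
  have key : ∀ L : List ((ℕ → ℝ) → ℝ), (∀ h ∈ L, Measurable h) →
      Measurable fun θ => ((L.map fun h => h θ).map f).prod := by
    intro L
    induction L with
    | nil => simp
    | cons h L ih =>
      intro hL
      simp only [List.map_cons, List.prod_cons]
      exact (hf.comp (hL h List.mem_cons_self)).mul
        (ih fun k hk => hL k (List.mem_cons_of_mem _ hk))
  simp only [weights_eq]
  exact key _ (measurable_of_mem_weightFns p g)

lemma measurable_maxAbs_weights (p : ℝ) (g : BinaryTree Unit) :
    Measurable fun θ => maxAbs (weights p g θ) := by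
  have key : ∀ L : List ((ℕ → ℝ) → ℝ), (∀ h ∈ L, Measurable h) →
      Measurable fun θ => maxAbs (L.map fun h => h θ) := by
    intro L
    induction L with
    | nil => simp [maxAbs]
    | cons h L ih =>
      intro hL
      simp only [maxAbs, List.map_cons, List.foldr_cons] at ih ⊢
      exact (measurable_norm.comp (hL h List.mem_cons_self)).max
        (ih fun k hk => hL k (List.mem_cons_of_mem _ hk))
  simp only [weights_eq]
  exact key _ (measurable_of_mem_weightFns p g)

/-- In preorder numbering a tree reads only as many angles as it has internal nodes, so the two
subtrees of a node read disjoint blocks; their independence rests on this. -/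
lemma weights_congr (p : ℝ) (g : BinaryTree Unit) {θ θ' : ℕ → ℝ}
    (h : ∀ k < g.numNodes, θ k = θ' k) : weights p g θ = weights p g θ' := by
  induction g generalizing θ θ' with
  | nil => rfl
  | node _ l r hl hr =>
    simp only [BinaryTree.numNodes] at h
    rw [weights, weights, h 0 (by lia),
      hl (θ' := fun k => θ' (k + 1)) fun k hk => h (k + 1) (by lia),
      hr (θ' := fun k => θ' (k + 1 + l.numNodes))
        fun k hk => h (k + 1 + l.numNodes) (by lia)]

/-- At each branching |c|^α + |s|^α = 1 splits the mass between the two children, so the |β_j|^α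
form a probability vector whatever the tree and the angles. -/
lemma sum_abs_rpow_weights {p : ℝ} (hp : 0 < p) (g : BinaryTree Unit) (θ : ℕ → ℝ) :
    ((weights p g θ).map fun b => |b| ^ alpha p).sum = 1 := by
  induction g generalizing θ with
  | nil => simp [weights]
  | node _ l r hl hr =>
    have h : ∀ (c : ℝ) (L : List ℝ), (L.map fun b => |c * b| ^ alpha p).sum
        = |c| ^ alpha p * (L.map fun b => |b| ^ alpha p).sum := by
      intro c L
      rw [← List.sum_map_mul_left]
      congr 2
      ext b
      rw [abs_mul, Real.mul_rpow (abs_nonneg _) (abs_nonneg _)]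
    simp only [weights, List.map_append, List.map_map, List.sum_append, Function.comp_def, h, hl,
      hr, mul_one]
    exact abs_cosP_rpow_add hp _

lemma abs_le_maxAbs {L : List ℝ} {b : ℝ} (hb : b ∈ L) : |b| ≤ maxAbs L := by
  induction L with
  | nil => simp at hb
  | cons a L ih =>
    simp only [maxAbs, List.map_cons, List.foldr_cons] at ih ⊢
    rcases List.mem_cons.1 hb with rfl | h
    · exact le_max_left _ _
    · exact (ih h).trans (le_max_right _ _)

lemma maxAbs_nonneg (L : List ℝ) : 0 ≤ maxAbs L := by
  induction L with
  | nil => simp [maxAbs]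
  | cons a L ih =>
    simp only [maxAbs, List.map_cons, List.foldr_cons]
    exact le_max_of_le_left (abs_nonneg a)

lemma maxAbs_rpow_le_sum {s : ℝ} (hs : 0 < s) (L : List ℝ) :
    maxAbs L ^ s ≤ (L.map fun b => |b| ^ s).sum := by
  induction L with
  | nil => simp [maxAbs, Real.zero_rpow hs.ne']
  | cons a L ih =>
    have hsum : 0 ≤ (L.map fun b => |b| ^ s).sum :=
      (Real.rpow_nonneg (maxAbs_nonneg L) s).trans ih
    have ha : 0 ≤ |a| ^ s := by positivity
    simp only [maxAbs, List.map_cons, List.foldr_cons, List.sum_cons] at ih ⊢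
    rcases max_cases |a| ((L.map fun b => |b|).foldr max 0) with ⟨h, _⟩ | ⟨h, _⟩ <;> rw [h] <;>
      linarith

/-- Needed for the cutoff d̃ / max|β_j| in the smoothing inequality. -/
lemma maxAbs_weights_pos {p : ℝ} (hp : 0 < p) (g : BinaryTree Unit) (θ : ℕ → ℝ) :
    0 < maxAbs (weights p g θ) := by
  refine (maxAbs_nonneg _).lt_of_ne fun h => ?_
  have h1 : ∀ b ∈ weights p g θ, b = 0 := fun b hb =>
    abs_eq_zero.1 (le_antisymm (h ▸ abs_le_maxAbs hb) (abs_nonneg b))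
  have h2 := sum_abs_rpow_weights hp g θ
  have h3 : ((weights p g θ).map fun b => |b| ^ alpha p).sum = 0 := by
    refine List.sum_eq_zero ?_
    intro x hx
    obtain ⟨b, hb, rfl⟩ := List.mem_map.1 hx
    simp [h1 b hb, Real.zero_rpow (alpha_pos hp).ne']
  linarith

lemma maxAbs_weights_le_one {p : ℝ} (hp : 0 < p) (g : BinaryTree Unit) (θ : ℕ → ℝ) :
    maxAbs (weights p g θ) ≤ 1 := by
  have h := maxAbs_rpow_le_sum (alpha_pos hp) (weights p g θ)
  rw [sum_abs_rpow_weights hp] at h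
  by_contra hn
  exact absurd h (not_le.2 (Real.one_lt_rpow (not_le.1 hn) (alpha_pos hp)))

lemma abs_weights_le_one {p : ℝ} (hp : 0 < p) {g : BinaryTree Unit} {θ : ℕ → ℝ} {b : ℝ}
    (hb : b ∈ weights p g θ) : |b| ≤ 1 :=
  (abs_le_maxAbs hb).trans (maxAbs_weights_le_one hp g θ)

/-- A sum over the leaves with weights `|β|^α` is at most the bound on the terms. -/
lemma sum_weights_le {p C : ℝ} (hp : 0 < p) (g : BinaryTree Unit) (θ : ℕ → ℝ) {f : ℝ → ℝ}
    (hf : ∀ b ∈ weights p g θ, f b ≤ C * |b| ^ alpha p) :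
    ((weights p g θ).map f).sum ≤ C := by
  calc ((weights p g θ).map f).sum
      ≤ ((weights p g θ).map fun b => C * |b| ^ alpha p).sum := List.sum_le_sum hf
    _ = C := by rw [List.sum_map_mul_left, sum_abs_rpow_weights hp, mul_one]

lemma abs_prod_map_le_one {f : ℝ → ℝ} (hf : ∀ x, |f x| ≤ 1) (L : List ℝ) :
    |(L.map f).prod| ≤ 1 := by
  induction L with
  | nil => simp
  | cons a L ih =>
    rw [List.map_cons, List.prod_cons, abs_mul]
    exact mul_le_one₀ (hf a) (abs_nonneg _) ih

/-! ### Expectations over the angles for a fixed tree -/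

/-- The law of the sequence of angles. -/
noncomputable abbrev angleSeqLaw : Measure (ℕ → ℝ) := Measure.infinitePi fun _ : ℕ => angleLaw

/-- The expectation over the angles of `∏ F(β_j ξ)` for a given tree. -/
noncomputable def treeProd (p : ℝ) (F : ℝ → ℝ) (g : BinaryTree Unit) (ξ : ℝ) : ℝ :=
  ∫ θ, ((weights p g θ).map fun b => F (b * ξ)).prod ∂angleSeqLaw

section

variable {p : ℝ} {F : ℝ → ℝ}

lemma abs_treeProd_le (hF : ∀ x, |F x| ≤ 1) (g : BinaryTree Unit) (ξ : ℝ) :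
    |treeProd p F g ξ| ≤ 1 := by
  have := norm_integral_le_of_norm_le_const (μ := angleSeqLaw) (C := 1)
    (f := fun θ => ((weights p g θ).map fun b => F (b * ξ)).prod)
    (Eventually.of_forall fun θ => abs_prod_map_le_one (fun x => hF _) _)
  simpa [treeProd] using this

lemma treeProd_nil (ξ : ℝ) : treeProd p F .nil ξ = F ξ := by
  simp [treeProd, weights]

/-- Given the root angle, the two subtrees use disjoint blocks of independent angles, so the
expectation of the product factorizes. -/
lemma treeProd_node (hFm : Measurable F) (hF : ∀ x, |F x| ≤ 1) (l r : BinaryTree Unit) (ξ : ℝ) :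
    treeProd p F (.node () l r) ξ
      = ∫ θ, treeProd p F l (cosP p θ * ξ) * treeProd p F r (sinP p θ * ξ) ∂angleLaw := by
  have hm : ∀ (g : BinaryTree Unit) (ξ : ℝ),
      Measurable fun θ => ((weights p g θ).map fun b => F (b * ξ)).prod := fun g ξ =>
    measurable_prod_weights p g (hFm.comp (measurable_id.mul_const ξ))
  have hb : ∀ (g : BinaryTree Unit) (ξ : ℝ) (θ : ℕ → ℝ),
      |((weights p g θ).map fun b => F (b * ξ)).prod| ≤ 1 := fun g ξ θ =>
    abs_prod_map_le_one (fun x => hF _) _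
  rw [treeProd, integral_infinitePi_eq (hm _ ξ) (hb _ ξ)]
  congr 1
  ext a
  rw [treeProd, treeProd, ← integral_mul_comp_shift (hm l (cosP p a * ξ)) (hm r (sinP p a * ξ))
    (hb l _) (hb r _) l.numNodes (fun x y hxy => by rw [weights_congr p l hxy])]
  congr 1
  ext x
  simp only [weights, List.map_append, List.prod_append, List.map_map, Function.comp_def,
    seqCons_zero, seqCons_succ]
  congr 4
  · ext b; congr 1; ring
  · ext b; congr 1; ring
  · ext k
    have : k + 1 + l.numNodes = (k + l.numNodes) + 1 := by ring
    rw [this, seqCons_succ]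

lemma continuous_treeProd (hFc : Continuous F) (hF : ∀ x, |F x| ≤ 1) (g : BinaryTree Unit) :
    Continuous (treeProd p F g) := by
  unfold treeProd
  refine continuous_of_dominated (bound := fun _ => 1) (fun ξ => ?_) (fun ξ => ?_)
    (integrable_const _) ?_
  · exact (measurable_prod_weights p g (hFc.measurable.comp
      (measurable_id.mul_const ξ))).aestronglyMeasurable
  · exact Eventually.of_forall fun θ => abs_prod_map_le_one (fun x => hF _) _
  · refine Eventually.of_forall fun θ => ?_
    exact continuous_list_prod _ fun b _ => hFc.comp (continuous_const.mul continuous_id)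

/-- The expectation over the angles of `∑ |β_j|^s` for a given tree. -/
noncomputable def treePow (p s : ℝ) (g : BinaryTree Unit) : ℝ :=
  ∫ θ, ((weights p g θ).map fun b => |b| ^ s).sum ∂angleSeqLaw

lemma sum_abs_rpow_nonneg (s : ℝ) (L : List ℝ) : 0 ≤ (L.map fun b => |b| ^ s).sum := by
  refine List.sum_nonneg ?_
  intro x hx
  obtain ⟨b, _, rfl⟩ := List.mem_map.1 hx
  positivity

lemma sum_abs_rpow_le_one (hp : 0 < p) {s : ℝ} (hs : 1 ≤ s) (g : BinaryTree Unit) (θ : ℕ → ℝ) :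
    ((weights p g θ).map fun b => |b| ^ (s * alpha p)).sum ≤ 1 := by
  refine sum_weights_le hp g θ fun b hb => ?_
  rw [one_mul]
  have hα := alpha_pos hp
  rcases eq_or_ne b 0 with rfl | hb0
  · have : s * alpha p ≠ 0 := by positivity
    simp [Real.zero_rpow this, Real.zero_rpow hα.ne']
  · refine Real.rpow_le_rpow_of_exponent_ge (abs_pos.2 hb0) (abs_weights_le_one hp hb) ?_
    nlinarith

lemma treePow_nil (s : ℝ) : treePow p s .nil = 1 := by
  simp [treePow, weights]

lemma abs_treePow_le (hp : 0 < p) {s : ℝ} (hs : 1 ≤ s) (g : BinaryTree Unit) :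
    |treePow p (s * alpha p) g| ≤ 1 := by
  have := norm_integral_le_of_norm_le_const (μ := angleSeqLaw) (C := 1)
    (f := fun θ => ((weights p g θ).map fun b => |b| ^ (s * alpha p)).sum)
    (Eventually.of_forall fun θ => by
      rw [Real.norm_of_nonneg (sum_abs_rpow_nonneg _ _)]
      exact sum_abs_rpow_le_one hp hs g θ)
  simpa [treePow] using this

/-- The power sum is additive over the two subtrees, and the root contributes independent factors
|c|^{sα} and |s|^{sα}, both of mean A_{2s}. -/
lemma treePow_node (hp : 0 < p) {s : ℝ} (hs : 1 ≤ s) (l r : BinaryTree Unit) :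
    treePow p (s * alpha p) (.node () l r)
      = constA (2 * s) * (treePow p (s * alpha p) l + treePow p (s * alpha p) r) := by
  have hm : ∀ g : BinaryTree Unit,
      Measurable fun θ => ((weights p g θ).map fun b => |b| ^ (s * alpha p)).sum := fun g =>
    measurable_sum_weights p g (by fun_prop)
  have hb : ∀ (g : BinaryTree Unit) (θ : ℕ → ℝ),
      |((weights p g θ).map fun b => |b| ^ (s * alpha p)).sum| ≤ 1 := fun g θ => by
    rw [abs_of_nonneg (sum_abs_rpow_nonneg _ _)]
    exact sum_abs_rpow_le_one hp hs g θ
  have hi : ∀ g : BinaryTree Unit, Integrable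
      (fun θ => ((weights p g θ).map fun b => |b| ^ (s * alpha p)).sum) angleSeqLaw := fun g =>
    Integrable.of_bound (hm g).aestronglyMeasurable 1 (Eventually.of_forall (hb g))
  have hshift : ∀ n : ℕ, Measurable fun (x : ℕ → ℝ) k => x (k + n) := fun n =>
    measurable_pi_lambda _ fun k => measurable_pi_apply _
  have hi' : Integrable (fun θ : ℕ → ℝ => ((weights p r fun k => θ (k + l.numNodes)).map
      fun b => |b| ^ (s * alpha p)).sum) angleSeqLaw :=
    Integrable.of_bound ((hm r).comp (hshift l.numNodes)).aestronglyMeasurable 1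
      (Eventually.of_forall fun θ => hb r _)
  have hmul : ∀ (c : ℝ) (L : List ℝ), (L.map fun b => |c * b| ^ (s * alpha p)).sum
      = |c| ^ (s * alpha p) * (L.map fun b => |b| ^ (s * alpha p)).sum := by
    intro c L
    rw [← List.sum_map_mul_left]
    congr 2
    ext b
    rw [abs_mul, Real.mul_rpow (abs_nonneg _) (abs_nonneg _)]
  rw [treePow, integral_infinitePi_eq (hm _) (hb _)]
  have hinner : ∀ a : ℝ, ∫ x, ((weights p (.node () l r) (seqCons (a, x))).map
      fun b => |b| ^ (s * alpha p)).sum ∂angleSeqLaw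
      = |cosP p a| ^ (s * alpha p) * treePow p (s * alpha p) l
        + |sinP p a| ^ (s * alpha p) * treePow p (s * alpha p) r := by
    intro a
    have hk : ∀ x : ℕ → ℝ, (fun k => seqCons (a, x) (k + 1 + l.numNodes))
        = fun k => x (k + l.numNodes) := by
      intro x
      ext k
      have : k + 1 + l.numNodes = (k + l.numNodes) + 1 := by ring
      rw [this, seqCons_succ]
    simp only [weights, List.map_append, List.sum_append, List.map_map, Function.comp_def,
      seqCons_zero, seqCons_succ, hk, hmul]
    rw [integral_add ((hi l).const_mul _) (hi'.const_mul _), integral_const_mul,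
      integral_const_mul, treePow, treePow,
      integral_comp_shift (ν := angleLaw) (hm r) l.numNodes]
  simp_rw [hinner]
  have hbd : ∀ f : ℝ → ℝ, Measurable f → (∀ x, |f x| ≤ 1) →
      Integrable (fun a => |f a| ^ (s * alpha p)) angleLaw := by
    intro f hf hf1
    refine Integrable.of_bound (Measurable.aestronglyMeasurable (by fun_prop)) 1
      (Eventually.of_forall fun x => ?_)
    rw [Real.norm_of_nonneg (by positivity)]
    refine Real.rpow_le_one (abs_nonneg _) (hf1 x) ?_
    have := alpha_pos hp
    positivity
  have hc1 : ∀ x, |cosP p x| ≤ 1 := fun x => by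
    rw [cosP, abs_mul, abs_of_nonneg (Real.rpow_nonneg (abs_nonneg _) p)]
    exact mul_le_one₀ (Real.abs_cos_le_one x) (by positivity)
      (Real.rpow_le_one (abs_nonneg _) (Real.abs_cos_le_one x) hp.le)
  have hs1 : ∀ x, |sinP p x| ≤ 1 := fun x => by
    rw [sinP, abs_mul, abs_of_nonneg (Real.rpow_nonneg (abs_nonneg _) p)]
    exact mul_le_one₀ (Real.abs_sin_le_one x) (by positivity)
      (Real.rpow_le_one (abs_nonneg _) (Real.abs_sin_le_one x) hp.le)
  rw [integral_add ((hbd _ (measurable_cosP p) hc1).mul_const _)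
    ((hbd _ (measurable_sinP p) hs1).mul_const _), integral_mul_const, integral_mul_const,
    constA_two_mul_eq_cos hp, constA_two_mul_eq_sin hp]
  ring

end

/-! ### Sums over trees -/

lemma sum_treesOfNumNodesEq_succ (m : ℕ) (f : BinaryTree Unit → ℝ) :
    ∑ g ∈ BinaryTree.treesOfNumNodesEq (m + 1), f g
      = ∑ ij ∈ Finset.HasAntidiagonal.antidiagonal m, ∑ l ∈ BinaryTree.treesOfNumNodesEq ij.1,
          ∑ r ∈ BinaryTree.treesOfNumNodesEq ij.2, f (.node () l r) := by
  rw [BinaryTree.treesOfNumNodesEq_succ, Finset.sum_biUnion]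
  · refine Finset.sum_congr rfl fun ij _ => ?_
    rw [Finset.sum_map, Finset.sum_product]
    rfl
  · simp_rw [Set.PairwiseDisjoint, Set.Pairwise, Finset.disjoint_left]
    aesop

/-- The average over the trees with `m` internal nodes. -/
noncomputable def treeAvg (f : BinaryTree Unit → ℝ) (m : ℕ) : ℝ :=
  ∑ g ∈ BinaryTree.treesOfNumNodesEq m, treeProb g * f g

lemma treeProb_nonneg (g : BinaryTree Unit) : 0 ≤ treeProb g := by
  induction g with
  | nil => simp [treeProb]
  | node _ l r hl hr =>
    rw [treeProb]
    positivity

lemma treeAvg_zero (f : BinaryTree Unit → ℝ) : treeAvg f 0 = f .nil := by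
  simp [treeAvg, treeProb]

/-- All trees with m + 1 internal nodes carry the same factor 1/(m + 1) at the root. Clearing it
leaves a convolution over the sizes of the two subtrees, which the generating function turns into a
differential equation. -/
lemma succ_mul_treeAvg (f : BinaryTree Unit → ℝ) (m : ℕ) :
    ((m : ℝ) + 1) * treeAvg f (m + 1)
      = ∑ ij ∈ Finset.HasAntidiagonal.antidiagonal m, ∑ l ∈ BinaryTree.treesOfNumNodesEq ij.1,
          ∑ r ∈ BinaryTree.treesOfNumNodesEq ij.2, treeProb l * treeProb r *
            f (.node () l r) := by
  rw [treeAvg, sum_treesOfNumNodesEq_succ, Finset.mul_sum]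
  refine Finset.sum_congr rfl fun ij hij => ?_
  rw [Finset.mul_sum]
  refine Finset.sum_congr rfl fun l hl => ?_
  rw [Finset.mul_sum]
  refine Finset.sum_congr rfl fun r hr => ?_
  rw [BinaryTree.mem_treesOfNumNodesEq] at hl hr
  rw [Finset.HasAntidiagonal.mem_antidiagonal] at hij
  rw [treeProb, hl, hr, hij]
  push_cast
  field_simp

/-- The m + 1 ways of distributing m internal nodes over the two subtrees contribute 1 each. -/
lemma sum_treeProb (m : ℕ) : ∑ g ∈ BinaryTree.treesOfNumNodesEq m, treeProb g = 1 := by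
  induction m using Nat.strong_induction_on with
  | _ m ih =>
    cases m with
    | zero => simp [treeProb]
    | succ m =>
      have h := succ_mul_treeAvg (fun _ => 1) m
      have h2 : ∀ ij ∈ Finset.HasAntidiagonal.antidiagonal m, ∑ l ∈ BinaryTree.treesOfNumNodesEq ij.1,
          ∑ r ∈ BinaryTree.treesOfNumNodesEq ij.2, treeProb l * treeProb r * 1 = 1 := by
        intro ij hij
        rw [Finset.HasAntidiagonal.mem_antidiagonal] at hij
        simp_rw [mul_one]
        rw [← Finset.sum_mul_sum, ih ij.1 (by lia), ih ij.2 (by lia), mul_one]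
      rw [Finset.sum_congr rfl h2] at h
      simp only [treeAvg, mul_one, Finset.sum_const, Finset.Nat.card_antidiagonal,
        nsmul_eq_mul] at h
      push_cast at h
      have : ((m : ℝ) + 1) ≠ 0 := by positivity
      exact mul_left_cancel₀ this (by rw [h, mul_one])

lemma abs_treeAvg_le {f : BinaryTree Unit → ℝ} {C : ℝ} (hf : ∀ g, |f g| ≤ C) (m : ℕ) :
    |treeAvg f m| ≤ C := by
  calc |treeAvg f m| ≤ ∑ g ∈ BinaryTree.treesOfNumNodesEq m, |treeProb g * f g| :=
        Finset.abs_sum_le_sum_abs _ _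
    _ ≤ ∑ g ∈ BinaryTree.treesOfNumNodesEq m, treeProb g * C := by
        refine Finset.sum_le_sum fun g _ => ?_
        rw [abs_mul, abs_of_nonneg (treeProb_nonneg g)]
        exact mul_le_mul_of_nonneg_left (hf g) (treeProb_nonneg g)
    _ = C := by rw [← Finset.sum_mul, sum_treeProb, one_mul]

/-! ### The law of the random tree -/

lemma one_sub_exp_nonneg {t : ℝ} (ht : 0 ≤ t) : 0 ≤ 1 - Real.exp (-t) := by
  have := Real.exp_le_one_iff.2 (neg_nonpos.2 ht)
  linarith

lemma one_sub_exp_lt_one (t : ℝ) : 1 - Real.exp (-t) < 1 := by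
  have := Real.exp_pos (-t)
  linarith

instance : Countable (BinaryTree Unit) := by
  have h : (univ : Set (BinaryTree Unit))
      = ⋃ n, (BinaryTree.treesOfNumNodesEq n : Set (BinaryTree Unit)) := by
    ext g
    simp
  rw [← Set.countable_univ_iff, h]
  exact Set.countable_iUnion fun n => Finset.countable_toSet _

instance : MeasurableSingletonClass (BinaryTree Unit) := ⟨fun _ => trivial⟩

lemma isProbabilityMeasure_treeLaw {t : ℝ} (ht : 0 ≤ t) : IsProbabilityMeasure (treeLaw t) := by
  have hu0 := one_sub_exp_nonneg ht
  have hu1 := one_sub_exp_lt_one t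
  constructor
  rw [treeLaw, Measure.sum_apply _ MeasurableSet.univ]
  have h1 : ∀ m : ℕ, (ENNReal.ofReal (Real.exp (-t) * (1 - Real.exp (-t)) ^ m) •
      ∑ g ∈ BinaryTree.treesOfNumNodesEq m, ENNReal.ofReal (treeProb g) • Measure.dirac g) univ
      = ENNReal.ofReal (Real.exp (-t) * (1 - Real.exp (-t)) ^ m) := by
    intro m
    rw [Measure.smul_apply, Measure.finsetSum_apply]
    simp only [Measure.smul_apply, measure_univ, smul_eq_mul, mul_one]
    rw [← ENNReal.ofReal_sum_of_nonneg fun g _ => treeProb_nonneg g, sum_treeProb,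
      ENNReal.ofReal_one, mul_one]
  simp_rw [h1]
  have hs : HasSum (fun m : ℕ => Real.exp (-t) * (1 - Real.exp (-t)) ^ m) 1 := by
    have := (hasSum_geometric_of_lt_one hu0 hu1).mul_left (Real.exp (-t))
    rw [sub_sub_cancel, mul_inv_cancel₀ (Real.exp_pos _).ne'] at this
    exact this
  rw [← ENNReal.ofReal_tsum_of_nonneg (fun m => by positivity) hs.summable, hs.tsum_eq,
    ENNReal.ofReal_one]

/-- The expectation of the random tree functional with averages `a m`. -/
noncomputable def expAvg (a : ℕ → ℝ) (t : ℝ) : ℝ :=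
  Real.exp (-t) * ∑' m, a m * (1 - Real.exp (-t)) ^ m

lemma integral_treeLaw {t : ℝ} (ht : 0 ≤ t) {f : BinaryTree Unit → ℝ} {C : ℝ}
    (hf : ∀ g, |f g| ≤ C) : ∫ g, f g ∂(treeLaw t) = expAvg (treeAvg f) t := by
  have hP := isProbabilityMeasure_treeLaw ht
  have hu0 := one_sub_exp_nonneg ht
  have hi : Integrable f (treeLaw t) :=
    Integrable.of_bound (Measurable.aestronglyMeasurable (measurable_from_top)) C
      (Eventually.of_forall hf)
  have h := hasSum_integral_measure (μ := fun m : ℕ =>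
    ENNReal.ofReal (Real.exp (-t) * (1 - Real.exp (-t)) ^ m) •
      ∑ g ∈ BinaryTree.treesOfNumNodesEq m, ENNReal.ofReal (treeProb g) • Measure.dirac g) hi
  rw [treeLaw, ← h.tsum_eq, expAvg, ← tsum_mul_left]
  congr 1
  ext m
  rw [integral_smul_measure, integral_finsetSum_measure]
  · rw [ENNReal.toReal_ofReal (by positivity), smul_eq_mul, treeAvg, mul_assoc,
      mul_comm _ ((1 - Real.exp (-t)) ^ m)]
    congr 2
    refine Finset.sum_congr rfl fun g _ => ?_
    rw [integral_smul_measure, integral_dirac, ENNReal.toReal_ofReal (treeProb_nonneg g),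
      smul_eq_mul]
  · intro g _
    exact (integrable_dirac (by simp)).smul_measure ENNReal.ofReal_ne_top

instance : SFinite angleSeqLaw := inferInstance

lemma integral_treeAngleLaw {t : ℝ} (ht : 0 ≤ t) {H : BinaryTree Unit × (ℕ → ℝ) → ℝ}
    (hH : Measurable H) {C : ℝ} (hC : ∀ ω, |H ω| ≤ C) :
    ∫ ω, H ω ∂(treeAngleLaw t)
      = expAvg (treeAvg fun g => ∫ θ, H (g, θ) ∂angleSeqLaw) t := by
  have hP := isProbabilityMeasure_treeLaw ht
  rw [treeAngleLaw, integral_prod]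
  · refine integral_treeLaw ht (C := C) fun g => ?_
    have := norm_integral_le_of_norm_le_const (μ := angleSeqLaw) (C := C)
      (f := fun θ => H (g, θ)) (Eventually.of_forall fun θ => hC (g, θ))
    simpa using this
  · exact Integrable.of_bound hH.aestronglyMeasurable C (Eventually.of_forall hC)

lemma isProbabilityMeasure_treeAngleLaw {t : ℝ} (ht : 0 ≤ t) :
    IsProbabilityMeasure (treeAngleLaw t) := by
  have := isProbabilityMeasure_treeLaw ht
  unfold treeAngleLaw
  infer_instance

/-! ### The generating function -/

lemma summable_mul_pow {a : ℕ → ℝ} (ha : ∀ m, |a m| ≤ 1) {u : ℝ} (hu : |u| < 1) :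
    Summable fun m => a m * u ^ m := by
  refine Summable.of_norm_bounded (summable_geometric_of_lt_one (abs_nonneg u) hu) fun m => ?_
  rw [norm_mul, norm_pow, Real.norm_eq_abs, Real.norm_eq_abs]
  exact mul_le_of_le_one_left (by positivity) (ha m)

/-- The index of the derivative is shifted so that its coefficients match the left side of
`succ_mul_treeAvg`. -/
lemma hasDerivAt_tsum_mul_pow {a : ℕ → ℝ} (ha : ∀ m, |a m| ≤ 1) {u : ℝ} (hu : |u| < 1) :
    HasDerivAt (fun u => ∑' m, a m * u ^ m) (∑' m : ℕ, ((m : ℝ) + 1) * a (m + 1) * u ^ m) u := by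
  obtain ⟨r, hur, hr⟩ := exists_between hu
  have hr0 : 0 < r := (abs_nonneg u).trans_lt hur
  have hbsum : Summable fun m : ℕ => (m : ℝ) * r ^ (m - 1) := by
    have h1 : Summable fun m : ℕ => (m : ℝ) ^ 1 * r ^ m :=
      summable_pow_mul_geometric_of_norm_lt_one 1 (by rwa [Real.norm_of_nonneg hr0.le])
    refine (h1.mul_left r⁻¹).congr fun m => ?_
    cases m with
    | zero => simp
    | succ m =>
      simp only [Nat.add_sub_cancel, pow_succ]
      field_simp
  have h := hasDerivAt_tsum_of_isPreconnected (t := Metric.ball (0 : ℝ) r) (y₀ := 0) (y := u)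
    (g := fun m u => a m * u ^ m) (g' := fun m u => a m * ((m : ℝ) * u ^ (m - 1))) hbsum
    Metric.isOpen_ball (convex_ball _ _).isPreconnected
    (fun m y _ => (hasDerivAt_pow m y).const_mul (a m)) ?_ (by simpa using hr0) ?_
    (by simpa using hur)
  · convert! h using 1
    have hsum : Summable fun m : ℕ => a m * ((m : ℝ) * u ^ (m - 1)) := by
      refine Summable.of_norm_bounded hbsum fun m => ?_
      rw [norm_mul, norm_mul, norm_pow, Real.norm_eq_abs, Real.norm_eq_abs, Real.norm_eq_abs,
        Nat.abs_cast]
      refine (mul_le_of_le_one_left (by positivity) (ha m)).trans ?_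
      gcongr
    rw [hsum.tsum_eq_zero_add]
    simp only [CharP.cast_eq_zero, zero_mul, mul_zero, zero_add, Nat.add_sub_cancel]
    congr 1
    ext m
    push_cast
    ring
  · intro m y hy
    rw [norm_mul, norm_mul, norm_pow, Real.norm_eq_abs, Real.norm_eq_abs, Real.norm_eq_abs,
      Nat.abs_cast]
    refine (mul_le_of_le_one_left (by positivity) (ha m)).trans ?_
    have : |y| < r := by simpa using hy
    gcongr
  · exact summable_mul_pow ha (by simp)

lemma abs_one_sub_exp_lt_one {t : ℝ} (ht : 0 ≤ t) : |1 - Real.exp (-t)| < 1 := by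
  rw [abs_of_nonneg (one_sub_exp_nonneg ht)]
  exact one_sub_exp_lt_one t

/-- With u = 1 - e^{-t} one has u′ = e^{-t}, which gives the gain term; the prefactor e^{-t} gives
the loss term. -/
lemma hasDerivAt_expAvg {a b : ℕ → ℝ} (ha : ∀ m, |a m| ≤ 1)
    (hab : ∀ m : ℕ, ((m : ℝ) + 1) * a (m + 1) = b m) {t : ℝ} (ht : 0 ≤ t) :
    HasDerivAt (expAvg a) (Real.exp (-t) * expAvg b t - expAvg a t) t := by
  have hu : HasDerivAt (fun t => 1 - Real.exp (-t)) (Real.exp (-t)) t := by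
    have := ((hasDerivAt_neg t).exp).const_sub 1
    simpa using this
  have hd := (hasDerivAt_tsum_mul_pow ha (abs_one_sub_exp_lt_one ht)).comp t hu
  have h := ((hasDerivAt_neg t).exp).mul hd
  unfold expAvg
  simp only [hab] at h
  convert! h using 1
  rw [Function.comp_apply]
  ring

lemma expAvg_zero (a : ℕ → ℝ) : expAvg a 0 = a 0 := by
  rw [expAvg, neg_zero, Real.exp_zero, one_mul, sub_self, tsum_eq_single 0]
  · simp
  · intro m hm
    simp [hm]

/-- A Cauchy product; the extra e^{-t} supplies the prefactor of the second series. -/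
lemma expAvg_antidiagonal {a b : ℕ → ℝ} (ha : ∀ m, |a m| ≤ 1) (hb : ∀ m, |b m| ≤ 1) {t : ℝ}
    (ht : 0 ≤ t) :
    Real.exp (-t) * expAvg (fun m => ∑ ij ∈ Finset.HasAntidiagonal.antidiagonal m, a ij.1 * b ij.2) t
      = expAvg a t * expAvg b t := by
  have hu := abs_one_sub_exp_lt_one ht
  have h := tsum_mul_tsum_eq_tsum_sum_antidiagonal_of_summable_norm
    (summable_mul_pow ha hu).norm (summable_mul_pow hb hu).norm
  simp only [expAvg]
  rw [mul_mul_mul_comm, h, ← mul_assoc]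
  congr 2
  ext m
  rw [Finset.sum_mul]
  refine Finset.sum_congr rfl fun ij hij => ?_
  rw [Finset.HasAntidiagonal.mem_antidiagonal] at hij
  rw [← hij, pow_add]
  ring

lemma abs_expAvg_le {a : ℕ → ℝ} (ha : ∀ m, |a m| ≤ 1) {t : ℝ} (ht : 0 ≤ t) :
    |expAvg a t| ≤ 1 := by
  have hu := abs_one_sub_exp_lt_one ht
  have hs := hasSum_geometric_of_lt_one (one_sub_exp_nonneg ht) (one_sub_exp_lt_one t)
  rw [sub_sub_cancel] at hs
  have h : ‖∑' m, a m * (1 - Real.exp (-t)) ^ m‖ ≤ (Real.exp (-t))⁻¹ := by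
    refine tsum_of_norm_bounded hs fun m => ?_
    rw [norm_mul, norm_pow, Real.norm_of_nonneg (one_sub_exp_nonneg ht)]
    exact mul_le_of_le_one_left (pow_nonneg (one_sub_exp_nonneg ht) m) (ha m)
  rw [expAvg, abs_mul, abs_of_pos (Real.exp_pos _)]
  calc _ ≤ Real.exp (-t) * (Real.exp (-t))⁻¹ := by gcongr; exact h
    _ = 1 := mul_inv_cancel₀ (Real.exp_pos _).ne'

/-! ### The power sums of the weights -/

/-- By the node recursion the expectation y(t) satisfies y′ = (2A_{2s} - 1) y, with y(0) = 1 from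
the one-leaf tree. -/
lemma expAvg_treePow {p : ℝ} (hp : 0 < p) {s : ℝ} (hs : 1 ≤ s) {t : ℝ} (ht : 0 ≤ t) :
    expAvg (treeAvg (treePow p (s * alpha p))) t = Real.exp (-(t * (1 - 2 * constA (2 * s)))) := by
  set a := treeAvg (treePow p (s * alpha p)) with ha_def
  have ha : ∀ m, |a m| ≤ 1 := abs_treeAvg_le (abs_treePow_le hp hs)
  let b : ℕ → ℝ := fun m => constA (2 * s) * (∑ ij ∈ Finset.HasAntidiagonal.antidiagonal m, a ij.1 * 1)
    + constA (2 * s) * ∑ ij ∈ Finset.HasAntidiagonal.antidiagonal m, 1 * a ij.2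
  have hab : ∀ m : ℕ, ((m : ℝ) + 1) * a (m + 1) = b m := by
    intro m
    simp only [b]
    rw [ha_def, succ_mul_treeAvg, Finset.mul_sum, Finset.mul_sum, ← Finset.sum_add_distrib]
    refine Finset.sum_congr rfl fun ij _ => ?_
    simp only [treePow_node hp hs]
    have h1 : ∀ l r, treeProb l * treeProb r * (constA (2 * s) *
        (treePow p (s * alpha p) l + treePow p (s * alpha p) r))
        = constA (2 * s) * (treeProb l * treePow p (s * alpha p) l * treeProb r)
          + constA (2 * s) * (treeProb l * (treeProb r * treePow p (s * alpha p) r)) := by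
      intro l r
      ring
    simp only [h1, Finset.sum_add_distrib, ← Finset.mul_sum]
    simp only [← Finset.sum_mul, sum_treeProb, treeAvg]
  have hone : ∀ t, 0 ≤ t → expAvg (fun _ => 1) t = 1 := by
    intro t ht
    have hs := hasSum_geometric_of_lt_one (one_sub_exp_nonneg ht) (one_sub_exp_lt_one t)
    rw [sub_sub_cancel] at hs
    simp only [expAvg, one_mul]
    rw [hs.tsum_eq, mul_inv_cancel₀ (Real.exp_pos _).ne']
  have hbe : ∀ t, 0 ≤ t → Real.exp (-t) * expAvg b t = 2 * constA (2 * s) * expAvg a t := by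
    intro t ht
    have h1 := expAvg_antidiagonal ha (b := fun _ => 1) (by simp) ht
    have h2 := expAvg_antidiagonal (a := fun _ => 1) (by simp) ha ht
    rw [hone t ht] at h1 h2
    have hsym : (fun m => ∑ ij ∈ Finset.HasAntidiagonal.antidiagonal m, 1 * a ij.2)
        = fun m => ∑ ij ∈ Finset.HasAntidiagonal.antidiagonal m, a ij.1 * 1 := by
      ext m
      rw [← Finset.Nat.sum_antidiagonal_swap]
      simp
    have hb2 : b = fun m => 2 * constA (2 * s) *
        ∑ ij ∈ Finset.HasAntidiagonal.antidiagonal m, a ij.1 * 1 := by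
      ext m
      have := congrFun hsym m
      simp only [b, this]
      ring
    have h3 : expAvg b t = 2 * constA (2 * s) *
        expAvg (fun m => ∑ ij ∈ Finset.HasAntidiagonal.antidiagonal m, a ij.1 * 1) t := by
      rw [hb2]
      simp only [expAvg, mul_assoc, tsum_mul_left]
      ring
    rw [h3, mul_left_comm, h1, mul_one]
  set κ := 2 * constA (2 * s) - 1 with hκ
  have hderiv : ∀ t, 0 ≤ t → HasDerivAt (fun t => Real.exp (-(κ * t)) * expAvg a t) 0 t := by
    intro t ht
    have h1 := hasDerivAt_expAvg ha hab ht
    rw [hbe t ht] at h1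
    have h2 : HasDerivAt (fun t => Real.exp (-(κ * t))) (Real.exp (-(κ * t)) * -κ) t := by
      have := (((hasDerivAt_id t).const_mul κ).neg).exp
      simpa using this
    convert! h2.mul h1 using 1
    rw [hκ]
    ring
  have hconst : ∀ t, 0 ≤ t → Real.exp (-(κ * t)) * expAvg a t = 1 := by
    intro t ht
    have h0 := constant_of_has_deriv_right_zero (f := fun t => Real.exp (-(κ * t)) * expAvg a t)
      (a := 0) (b := t)
      (fun x hx => (hderiv x hx.1).continuousAt.continuousWithinAt)
      (fun x hx => (hderiv x hx.1).hasDerivWithinAt) t ⟨ht, le_rfl⟩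
    rw [h0, expAvg_zero]
    simp [ha_def, treeAvg_zero, treePow_nil]
  have h4 := hconst t ht
  have h5 : expAvg a t = Real.exp (κ * t) := by
    rw [Real.exp_neg] at h4
    field_simp at h4
    exact h4
  rw [h5, hκ]
  congr 1
  ring

/-! ### The Wild series -/

/-- Termwise integration. The bound m + 1 counts the terms of the antidiagonal sums to which this is
applied, and ∑ (m + 1) uᵐ converges for 0 ≤ u < 1. -/
lemma expAvg_integral {q : ℕ → ℝ → ℝ} (hqm : ∀ m, Measurable (q m))
    (hq : ∀ m θ, |q m θ| ≤ (m : ℝ) + 1) {t : ℝ} (ht : 0 ≤ t) :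
    ∫ θ, expAvg (fun m => q m θ) t ∂angleLaw
      = expAvg (fun m => ∫ θ, q m θ ∂angleLaw) t := by
  have hu0 := one_sub_exp_nonneg ht
  have hu1 := one_sub_exp_lt_one t
  have hsum : Summable fun m : ℕ => ((m : ℝ) + 1) * (1 - Real.exp (-t)) ^ m := by
    have h1 : Summable fun m : ℕ => (m : ℝ) ^ 1 * (1 - Real.exp (-t)) ^ m :=
      summable_pow_mul_geometric_of_norm_lt_one 1 (by rwa [Real.norm_of_nonneg hu0])
    refine (h1.add (summable_geometric_of_lt_one hu0 hu1)).congr fun m => ?_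
    ring
  have hb : ∀ (m : ℕ) θ, ‖q m θ * (1 - Real.exp (-t)) ^ m‖
      ≤ ((m : ℝ) + 1) * (1 - Real.exp (-t)) ^ m := by
    intro m θ
    rw [norm_mul, Real.norm_of_nonneg (pow_nonneg hu0 m)]
    exact mul_le_mul_of_nonneg_right (hq m θ) (pow_nonneg hu0 m)
  have hi : ∀ m : ℕ, Integrable (fun θ => q m θ * (1 - Real.exp (-t)) ^ m) angleLaw := fun m =>
    Integrable.of_bound ((hqm m).mul_const _).aestronglyMeasurable _
      (Eventually.of_forall (hb m))
  have h := hasSum_integral_of_summable_integral_norm hi ?_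
  · simp only [expAvg]
    rw [integral_const_mul, ← h.tsum_eq]
    simp only [integral_mul_const]
  · refine Summable.of_nonneg_of_le (fun m => integral_nonneg fun θ => norm_nonneg _)
      (fun m => ?_) hsum
    refine (integral_mono_of_nonneg (Eventually.of_forall fun θ => norm_nonneg _)
      (integrable_const _) (Eventually.of_forall (hb m))).trans ?_
    simp

section

variable {p : ℝ} {F : ℝ → ℝ}

/-- The expectation `E_t[∏_j F(β_j ξ)]`. -/
noncomputable def wildSum (p : ℝ) (F : ℝ → ℝ) (t ξ : ℝ) : ℝ :=
  expAvg (treeAvg fun g => treeProd p F g ξ) t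

lemma abs_wildSum_le (hF : ∀ x, |F x| ≤ 1) {t : ℝ} (ht : 0 ≤ t) (ξ : ℝ) :
    |wildSum p F t ξ| ≤ 1 :=
  abs_expAvg_le (abs_treeAvg_le fun g => abs_treeProd_le hF g ξ) ht

lemma wildSum_zero (ξ : ℝ) : wildSum p F 0 ξ = F ξ := by
  rw [wildSum, expAvg_zero, treeAvg_zero, treeProd_nil]

lemma continuous_treeAvg_treeProd (hFc : Continuous F) (hF : ∀ x, |F x| ≤ 1) (m : ℕ) :
    Continuous fun ξ => treeAvg (fun g => treeProd p F g ξ) m := by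
  unfold treeAvg
  exact continuous_finsetSum _ fun g _ => continuous_const.mul (continuous_treeProd hFc hF g)

lemma continuous_wildSum (hFc : Continuous F) (hF : ∀ x, |F x| ≤ 1) {t : ℝ} (ht : 0 ≤ t) :
    Continuous (wildSum p F t) := by
  unfold wildSum expAvg
  refine continuous_const.mul (continuous_tsum
    (fun m => (continuous_treeAvg_treeProd hFc hF m).mul continuous_const)
    (summable_geometric_of_lt_one (one_sub_exp_nonneg ht) (one_sub_exp_lt_one t)) fun m ξ => ?_)
  rw [norm_mul, norm_pow, Real.norm_of_nonneg (one_sub_exp_nonneg ht)]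
  exact mul_le_of_le_one_left (pow_nonneg (one_sub_exp_nonneg ht) m)
    (abs_treeAvg_le (fun g => abs_treeProd_le hF g ξ) m)

/-- The convolution over subtree sizes becomes a product of two Wild sums, and averaging over the
root angle gives the collision integral. -/
lemma hasDerivAt_wildSum (hFc : Continuous F) (hF : ∀ x, |F x| ≤ 1) {t : ℝ} (ht : 0 ≤ t) (ξ : ℝ) :
    HasDerivAt (fun t => wildSum p F t ξ)
      ((∫ θ, wildSum p F t (cosP p θ * ξ) * wildSum p F t (sinP p θ * ξ) ∂angleLaw)
        - wildSum p F t ξ) t := by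
  set Q : ℝ → ℕ → ℝ := fun ξ => treeAvg fun g => treeProd p F g ξ with hQ
  have hQb : ∀ ξ m, |Q ξ m| ≤ 1 := fun ξ => abs_treeAvg_le fun g => abs_treeProd_le hF g ξ
  have hQc : ∀ m, Continuous fun ξ => Q ξ m := continuous_treeAvg_treeProd hFc hF
  set q : ℕ → ℝ → ℝ := fun m θ => ∑ ij ∈ Finset.HasAntidiagonal.antidiagonal m,
    Q (cosP p θ * ξ) ij.1 * Q (sinP p θ * ξ) ij.2 with hq
  have hQm : ∀ (f : ℝ → ℝ), Measurable f → ∀ m, Measurable fun θ => Q (f θ * ξ) m :=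
    fun f hf m => (hQc m).measurable.comp (hf.mul_const ξ)
  have hqm : ∀ m, Measurable (q m) := fun m =>
    Finset.measurable_sum _ fun ij _ =>
      (hQm _ (measurable_cosP p) _).mul (hQm _ (measurable_sinP p) _)
  have hqb : ∀ m θ, |q m θ| ≤ (m : ℝ) + 1 := by
    intro m θ
    refine (Finset.abs_sum_le_sum_abs _ _).trans ?_
    have : ∀ ij ∈ Finset.HasAntidiagonal.antidiagonal m,
        |Q (cosP p θ * ξ) ij.1 * Q (sinP p θ * ξ) ij.2| ≤ 1 := fun ij _ => by
      rw [abs_mul]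
      exact mul_le_one₀ (hQb _ _) (abs_nonneg _) (hQb _ _)
    refine (Finset.sum_le_sum this).trans ?_
    simp
  have hTm : ∀ g (f : ℝ → ℝ), Measurable f → Measurable fun θ => treeProd p F g (f θ * ξ) :=
    fun g f hf => (continuous_treeProd hFc hF g).measurable.comp (hf.mul_const ξ)
  have hTi : ∀ l r, Integrable
      (fun θ => treeProd p F l (cosP p θ * ξ) * treeProd p F r (sinP p θ * ξ)) angleLaw := by
    intro l r
    refine Integrable.of_bound ((hTm l _ (measurable_cosP p)).mul
      (hTm r _ (measurable_sinP p))).aestronglyMeasurable 1 (Eventually.of_forall fun θ => ?_)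
    rw [norm_mul]
    exact mul_le_one₀ (abs_treeProd_le hF _ _) (norm_nonneg _) (abs_treeProd_le hF _ _)
  have hab : ∀ m : ℕ, ((m : ℝ) + 1) * Q ξ (m + 1) = ∫ θ, q m θ ∂angleLaw := by
    intro m
    rw [hQ, succ_mul_treeAvg]
    simp only [hq, hQ, treeAvg, Finset.sum_mul_sum]
    have hre : ∀ θ l r, treeProb l * treeProd p F l (cosP p θ * ξ) *
        (treeProb r * treeProd p F r (sinP p θ * ξ)) = treeProb l * treeProb r *
        (treeProd p F l (cosP p θ * ξ) * treeProd p F r (sinP p θ * ξ)) := by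
      intro θ l r
      ring
    simp only [hre]
    rw [integral_finsetSum _ fun ij _ => integrable_finsetSum _ fun l _ =>
      integrable_finsetSum _ fun r _ => (hTi l r).const_mul _]
    refine Finset.sum_congr rfl fun ij _ => ?_
    rw [integral_finsetSum _ fun l _ => integrable_finsetSum _ fun r _ => (hTi l r).const_mul _]
    refine Finset.sum_congr rfl fun l _ => ?_
    rw [integral_finsetSum _ fun r _ => (hTi l r).const_mul _]
    refine Finset.sum_congr rfl fun r _ => ?_
    rw [integral_const_mul, treeProd_node hFc.measurable hF]
  have h := hasDerivAt_expAvg (hQb ξ) hab ht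
  rw [← expAvg_integral hqm hqb ht, ← integral_const_mul] at h
  simp only [hq, expAvg_antidiagonal (hQb _) (hQb _) ht] at h
  exact h

end

/-! ### Symmetrization of the kinetic equation -/

lemma cosP_neg (p θ : ℝ) : cosP p (-θ) = cosP p θ := by simp [cosP]

lemma sinP_neg (p θ : ℝ) : sinP p (-θ) = -sinP p θ := by simp [sinP]

lemma cosP_pi_sub (p θ : ℝ) : cosP p (Real.pi - θ) = -cosP p θ := by simp [cosP, Real.cos_pi_sub]

lemma sinP_pi_sub (p θ : ℝ) : sinP p (Real.pi - θ) = sinP p θ := by simp [sinP, Real.sin_pi_sub]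

lemma periodic_sinP_cosP (p : ℝ) (K : ℝ → ℝ → ℂ) :
    Function.Periodic (fun θ => K (sinP p θ) (cosP p θ)) (2 * Real.pi) := by
  intro θ
  simp [sinP, cosP]

/-- The substitution θ ↦ -θ flips s and leaves c fixed; periodicity brings the interval back. -/
lemma integral_neg_sinP (p : ℝ) (K : ℝ → ℝ → ℂ) :
    ∫ θ in (0 : ℝ)..(2 * Real.pi), K (-sinP p θ) (cosP p θ)
      = ∫ θ in (0 : ℝ)..(2 * Real.pi), K (sinP p θ) (cosP p θ) := by
  have h1 := intervalIntegral.integral_comp_neg (a := 0) (b := 2 * Real.pi)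
    (fun θ => K (sinP p θ) (cosP p θ))
  simp only [sinP_neg, cosP_neg] at h1
  have h2 := (periodic_sinP_cosP p K).intervalIntegral_add_eq (-(2 * Real.pi)) 0
  simp only [neg_add_cancel, zero_add] at h2
  rw [h1, neg_zero, h2]

/-- Here θ ↦ π - θ flips c and leaves s fixed. -/
lemma integral_neg_cosP (p : ℝ) (K : ℝ → ℝ → ℂ) :
    ∫ θ in (0 : ℝ)..(2 * Real.pi), K (sinP p θ) (-cosP p θ)
      = ∫ θ in (0 : ℝ)..(2 * Real.pi), K (sinP p θ) (cosP p θ) := by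
  have h1 := intervalIntegral.integral_comp_sub_left (a := 0) (b := 2 * Real.pi)
    (fun θ => K (sinP p θ) (cosP p θ)) Real.pi
  simp only [sinP_pi_sub, cosP_pi_sub] at h1
  have h2 := (periodic_sinP_cosP p K).intervalIntegral_add_eq (Real.pi - 2 * Real.pi) 0
  simp only [sub_add_cancel, zero_add] at h2
  rw [h1, sub_zero, h2]

lemma charFun_add_charFun_neg (μ : Measure ℝ) (ξ : ℝ) :
    charFun μ ξ + charFun μ (-ξ) = 2 * (((charFun μ ξ).re : ℝ) : ℂ) := by
  rw [charFun_neg, Complex.add_conj]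
  push_cast
  ring

lemma continuous_re_charFun (μ : Measure ℝ) [IsProbabilityMeasure μ] :
    Continuous fun ξ => (charFun μ ξ).re :=
  Complex.continuous_re.comp continuous_charFun

lemma abs_re_charFun_le_one (μ : Measure ℝ) [IsProbabilityMeasure μ] (ξ : ℝ) :
    |(charFun μ ξ).re| ≤ 1 :=
  (Complex.abs_re_le_norm _).trans (norm_charFun_le_one ξ)

/-- The four sign patterns of (s, c) give the same integral; averaging over them replaces each φ(y)
by (φ(y) + φ(-y))/2 = Re φ(y). So the collision term is real and closed in Re φ. -/
lemma integral_charFun_mul_charFun (p : ℝ) (μ : Measure ℝ) [IsProbabilityMeasure μ] (ξ : ℝ) :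
    (1 / (2 * (Real.pi : ℂ))) * (∫ θ in (0 : ℝ)..(2 * Real.pi),
        charFun μ (ξ * sinP p θ) * charFun μ (ξ * cosP p θ))
      = ((∫ θ, (charFun μ (cosP p θ * ξ)).re * (charFun μ (sinP p θ * ξ)).re ∂angleLaw : ℝ) : ℂ) := by
  have hc : Continuous (charFun μ) := continuous_charFun
  have hm : ∀ f g : ℝ → ℝ, Measurable f → Measurable g →
      IntervalIntegrable (fun θ => charFun μ (f θ) * charFun μ (g θ)) volume 0 (2 * Real.pi) := by
    intro f g hf hg
    rw [intervalIntegrable_iff_integrableOn_Ioc_of_le (by positivity)]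
    refine Integrable.of_bound ((hc.measurable.comp hf).mul
      (hc.measurable.comp hg)).aestronglyMeasurable 1 (Eventually.of_forall fun θ => ?_)
    rw [norm_mul]
    exact mul_le_one₀ (norm_charFun_le_one _) (norm_nonneg _) (norm_charFun_le_one _)
  have hms := measurable_sinP p
  have hmc := measurable_cosP p
  let J : ℝ → ℝ → ℂ := fun x y => charFun μ (ξ * x) * charFun μ (ξ * y)
  have e1 := integral_neg_sinP p J
  have e2 := integral_neg_cosP p J
  have e3 := integral_neg_sinP p fun x y => J x (-y)
  simp only [J] at e1 e2 e3
  have hsum : ∫ θ in (0 : ℝ)..(2 * Real.pi),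
      (charFun μ (ξ * sinP p θ) * charFun μ (ξ * cosP p θ)
        + charFun μ (ξ * -sinP p θ) * charFun μ (ξ * cosP p θ)
        + charFun μ (ξ * sinP p θ) * charFun μ (ξ * -cosP p θ)
        + charFun μ (ξ * -sinP p θ) * charFun μ (ξ * -cosP p θ))
      = 4 * ∫ θ in (0 : ℝ)..(2 * Real.pi), charFun μ (ξ * sinP p θ) * charFun μ (ξ * cosP p θ) := by
    rw [intervalIntegral.integral_add, intervalIntegral.integral_add,
      intervalIntegral.integral_add, e3, e2, e1]
    · ring
    all_goals first
      | exact hm _ _ (by fun_prop) (by fun_prop)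
      | exact (hm _ _ (by fun_prop) (by fun_prop)).add (hm _ _ (by fun_prop) (by fun_prop))
      | exact ((hm _ _ (by fun_prop) (by fun_prop)).add (hm _ _ (by fun_prop) (by fun_prop))).add
          (hm _ _ (by fun_prop) (by fun_prop))
  have hpt : ∀ θ, charFun μ (ξ * sinP p θ) * charFun μ (ξ * cosP p θ)
        + charFun μ (ξ * -sinP p θ) * charFun μ (ξ * cosP p θ)
        + charFun μ (ξ * sinP p θ) * charFun μ (ξ * -cosP p θ)
        + charFun μ (ξ * -sinP p θ) * charFun μ (ξ * -cosP p θ)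
      = ((4 * ((charFun μ (cosP p θ * ξ)).re * (charFun μ (sinP p θ * ξ)).re) : ℝ) : ℂ) := by
    intro θ
    have h1 := charFun_add_charFun_neg μ (ξ * sinP p θ)
    have h2 := charFun_add_charFun_neg μ (ξ * cosP p θ)
    rw [mul_comm (cosP p θ), mul_comm (sinP p θ), mul_neg, mul_neg]
    push_cast
    calc _ = (charFun μ (ξ * sinP p θ) + charFun μ (-(ξ * sinP p θ))) *
          (charFun μ (ξ * cosP p θ) + charFun μ (-(ξ * cosP p θ))) := by ring
      _ = _ := by rw [h1, h2]; ring
  simp only [hpt] at hsum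
  rw [intervalIntegral.integral_ofReal, intervalIntegral.integral_const_mul] at hsum
  rw [integral_angleLaw]
  push_cast at hsum ⊢
  rw [mul_left_cancel₀ (by norm_num) hsum]

lemma IsSolution.hasDerivAt_re {p : ℝ} {μ₀ : Measure ℝ} {μ : ℝ → Measure ℝ}
    [∀ t, IsProbabilityMeasure (μ t)] (h : IsSolution p μ₀ μ) {t : ℝ} (ht : 0 < t) (ξ : ℝ) :
    HasDerivAt (fun t => (charFun (μ t) ξ).re)
      ((∫ θ, (charFun (μ t) (cosP p θ * ξ)).re * (charFun (μ t) (sinP p θ * ξ)).re ∂angleLaw)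
        - (charFun (μ t) ξ).re) t := by
  have h1 := h.evolution t ht ξ
  rw [integral_charFun_mul_charFun] at h1
  have h2 := Complex.reCLM.hasFDerivAt.comp_hasDerivAt t h1
  simpa [Function.comp_def] using h2

lemma IsSolution.hasDerivAt_im {p : ℝ} {μ₀ : Measure ℝ} {μ : ℝ → Measure ℝ}
    [∀ t, IsProbabilityMeasure (μ t)] (h : IsSolution p μ₀ μ) {t : ℝ} (ht : 0 < t) (ξ : ℝ) :
    HasDerivAt (fun t => (charFun (μ t) ξ).im) (-(charFun (μ t) ξ).im) t := by
  have h1 := h.evolution t ht ξ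
  rw [integral_charFun_mul_charFun] at h1
  have h2 := Complex.imCLM.hasFDerivAt.comp_hasDerivAt t h1
  simpa [Function.comp_def] using h2

lemma IsSolution.continuousOn_charFun {p : ℝ} {μ₀ : Measure ℝ} {μ : ℝ → Measure ℝ}
    (h : IsSolution p μ₀ μ) (ξ : ℝ) : ContinuousOn (fun t => charFun (μ t) ξ) (Ici 0) := by
  intro t ht
  rcases (mem_Ici.1 ht).eq_or_lt with rfl | ht
  · exact h.continuous_zero ξ
  · exact (h.evolution t ht ξ).continuousAt.continuousWithinAt

/-- The collision term is real, so e^t Im φ has zero derivative for t > 0; the mean value theorem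
reaches t = 0 by continuity alone. -/
lemma IsSolution.im_charFun_eq {p : ℝ} {μ₀ : Measure ℝ} {μ : ℝ → Measure ℝ}
    [∀ t, IsProbabilityMeasure (μ t)] (h : IsSolution p μ₀ μ) {t : ℝ} (ht : 0 ≤ t) (ξ : ℝ) :
    (charFun (μ t) ξ).im = Real.exp (-t) * (charFun μ₀ ξ).im := by
  rcases ht.eq_or_lt with rfl | ht
  · simp [h.initial]
  have hd : ∀ s ∈ Ioo 0 t, HasDerivAt (fun s => Real.exp s * (charFun (μ s) ξ).im) 0 s := by
    intro s hs
    convert! (Real.hasDerivAt_exp s).mul (h.hasDerivAt_im hs.1 ξ) using 1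
    ring
  have hc : ContinuousOn (fun s => Real.exp s * (charFun (μ s) ξ).im) (Icc 0 t) :=
    Real.continuous_exp.continuousOn.mul (Complex.continuous_im.comp_continuousOn
      ((h.continuousOn_charFun ξ).mono Icc_subset_Ici_self))
  obtain ⟨s, hs, hs'⟩ := exists_hasDerivAt_eq_slope _ _ ht hc hd
  have h0 : Real.exp t * (charFun (μ t) ξ).im = (charFun μ₀ ξ).im := by
    have := (eq_div_iff (sub_pos.2 ht).ne').1 hs'
    simp only [zero_mul, Real.exp_zero, one_mul, h.initial] at this
    linarith
  rw [← h0, ← mul_assoc, ← Real.exp_add]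
  simp

/-! ### Uniqueness -/

/-- One step of a Picard iteration, for functions differentiable only at t > 0. -/
lemma le_of_deriv_le_pow {w w' : ℝ → ℝ} {C : ℝ} {n : ℕ} (hc : ContinuousOn w (Ici 0))
    (h0 : w 0 = 0) (hd : ∀ t, 0 < t → HasDerivAt w (w' t) t)
    (hb : ∀ t, 0 < t → w' t ≤ C * t ^ n) {t : ℝ} (ht : 0 ≤ t) :
    w t ≤ C * t ^ (n + 1) / ((n : ℝ) + 1) := by
  have hn : ((n : ℝ) + 1) ≠ 0 := by positivity
  have hd2 : ∀ t, 0 < t → HasDerivAt (fun t => C * t ^ (n + 1) / ((n : ℝ) + 1) - w t)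
      (C * t ^ n - w' t) t := by
    intro t ht
    have h1 := (((hasDerivAt_pow (n + 1) t).const_mul C).div_const ((n : ℝ) + 1)).sub (hd t ht)
    convert! h1 using 1
    push_cast [Nat.add_sub_cancel]
    field_simp
  have hmono : MonotoneOn (fun t => C * t ^ (n + 1) / ((n : ℝ) + 1) - w t) (Ici 0) := by
    refine monotoneOn_of_deriv_nonneg (convex_Ici 0) ?_ ?_ ?_
    · exact ContinuousOn.sub (by fun_prop) hc
    · rw [interior_Ici]
      exact fun t ht => (hd2 t ht).differentiableAt.differentiableWithinAt
    · rw [interior_Ici]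
      intro t ht
      rw [(hd2 t ht).deriv]
      linarith [hb t ht]
  have := hmono (mem_Ici.2 le_rfl) (mem_Ici.2 ht) ht
  simp only [h0, ne_eq, Nat.add_eq_zero_iff, one_ne_zero, and_false, not_false_eq_true, zero_pow,
    mul_zero, zero_div, sub_zero] at this
  linarith

/-- The real part of the characteristic function of a solution is given by the Wild series. -/
theorem IsSolution.re_charFun_eq {p : ℝ} {μ₀ : Measure ℝ} {μ : ℝ → Measure ℝ}
    [IsProbabilityMeasure μ₀] [∀ t, IsProbabilityMeasure (μ t)] (h : IsSolution p μ₀ μ) {t : ℝ}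
    (ht : 0 ≤ t) (ξ : ℝ) :
    (charFun (μ t) ξ).re = wildSum p (fun ξ => (charFun μ₀ ξ).re) t ξ := by
  set F : ℝ → ℝ := fun ξ => (charFun μ₀ ξ).re with hF
  have hFc : Continuous F := continuous_re_charFun μ₀
  have hFb : ∀ x, |F x| ≤ 1 := abs_re_charFun_le_one μ₀
  set f : ℝ → ℝ → ℝ := fun t ξ => (charFun (μ t) ξ).re with hf
  set ψ : ℝ → ℝ → ℝ := wildSum p F with hψ
  have hfc : ∀ t, Continuous (f t) := fun t => continuous_re_charFun (μ t)
  have hfb : ∀ t ξ, |f t ξ| ≤ 1 := fun t => abs_re_charFun_le_one (μ t)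
  have hψc : ∀ t, 0 ≤ t → Continuous (ψ t) := fun t ht => continuous_wildSum hFc hFb ht
  have hψb : ∀ t, 0 ≤ t → ∀ ξ, |ψ t ξ| ≤ 1 := fun t ht => abs_wildSum_le hFb ht
  have hprod : ∀ φ : ℝ → ℝ, Continuous φ → (∀ x, |φ x| ≤ 1) → ∀ ξ,
      Integrable (fun θ => φ (cosP p θ * ξ) * φ (sinP p θ * ξ)) angleLaw := by
    intro φ hφ hφb ξ
    refine Integrable.of_bound ((hφ.measurable.comp ((measurable_cosP p).mul_const ξ)).mul
      (hφ.measurable.comp ((measurable_sinP p).mul_const ξ))).aestronglyMeasurable 1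
      (Eventually.of_forall fun θ => ?_)
    rw [norm_mul]
    exact mul_le_one₀ (hφb _) (norm_nonneg _) (hφb _)
  have hd : ∀ ξ t, 0 < t → HasDerivAt (fun t => f t ξ - ψ t ξ)
      ((∫ θ, (f t (cosP p θ * ξ) * f t (sinP p θ * ξ) - ψ t (cosP p θ * ξ) * ψ t (sinP p θ * ξ))
        ∂angleLaw) - (f t ξ - ψ t ξ)) t := by
    intro ξ t ht
    convert! (h.hasDerivAt_re ht ξ).sub (hasDerivAt_wildSum (p := p) hFc hFb ht.le ξ) using 1
    rw [integral_sub (hprod _ (hfc t) (hfb t) ξ) (hprod _ (hψc t ht.le) (hψb t ht.le) ξ)]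
    ring
  have hcont : ∀ ξ, ContinuousOn (fun t => f t ξ - ψ t ξ) (Ici 0) := by
    intro ξ
    refine (Complex.continuous_re.comp_continuousOn (h.continuousOn_charFun ξ)).sub fun t ht => ?_
    exact (hasDerivAt_wildSum (p := p) hFc hFb ht ξ).continuousAt.continuousWithinAt
  have h0 : ∀ ξ, f 0 ξ - ψ 0 ξ = 0 := by
    intro ξ
    simp only [hf, hψ, wildSum_zero, h.initial, hF, sub_self]
  -- The difference is at most 2, and each integration in time gains a factor 3t/(n + 1): the
  -- product of two functions bounded by 1 contributes 2 to the 3, and the loss term contributes 1.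
  -- The bounds tend to 0 like (3t)ⁿ/n!.
  have key : ∀ n : ℕ, ∀ t, 0 ≤ t → ∀ ξ,
      |f t ξ - ψ t ξ| ≤ 2 * 3 ^ n / (n.factorial : ℝ) * t ^ n := by
    intro n
    induction n with
    | zero =>
      intro t ht ξ
      have h1 := abs_sub (f t ξ) (ψ t ξ)
      have h2 := hfb t ξ
      have h3 := hψb t ht ξ
      simp only [pow_zero, Nat.factorial_zero, Nat.cast_one, mul_one, div_one]
      linarith
    | succ n ih =>
      intro t ht ξ
      have hbound : ∀ t, 0 < t →
          |(∫ θ, (f t (cosP p θ * ξ) * f t (sinP p θ * ξ)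
              - ψ t (cosP p θ * ξ) * ψ t (sinP p θ * ξ)) ∂angleLaw) - (f t ξ - ψ t ξ)|
            ≤ 3 * (2 * 3 ^ n / (n.factorial : ℝ)) * t ^ n := by
        intro t ht
        set B := 2 * 3 ^ n / (n.factorial : ℝ) * t ^ n with hB
        have h1 : ‖∫ θ, (f t (cosP p θ * ξ) * f t (sinP p θ * ξ)
              - ψ t (cosP p θ * ξ) * ψ t (sinP p θ * ξ)) ∂angleLaw‖ ≤ 2 * B := by
          have := norm_integral_le_of_norm_le_const (μ := angleLaw) (C := 2 * B)
            (f := fun θ => f t (cosP p θ * ξ) * f t (sinP p θ * ξ)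
              - ψ t (cosP p θ * ξ) * ψ t (sinP p θ * ξ)) (Eventually.of_forall fun θ => ?_)
          · simpa using this
          · set x := cosP p θ * ξ
            set y := sinP p θ * ξ
            have e : f t x * f t y - ψ t x * ψ t y
                = (f t x - ψ t x) * f t y + ψ t x * (f t y - ψ t y) := by ring
            rw [e]
            refine (norm_add_le _ _).trans ?_
            rw [norm_mul, norm_mul, two_mul]
            refine add_le_add ?_ ?_
            · exact (mul_le_of_le_one_right (norm_nonneg _) (hfb t y)).trans (ih t ht.le x)
            · exact (mul_le_of_le_one_left (norm_nonneg _) (hψb t ht.le x)).trans (ih t ht.le y)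
        have h2 := ih t ht.le ξ
        have h3 := abs_sub (∫ θ, (f t (cosP p θ * ξ) * f t (sinP p θ * ξ)
              - ψ t (cosP p θ * ξ) * ψ t (sinP p θ * ξ)) ∂angleLaw) (f t ξ - ψ t ξ)
        rw [Real.norm_eq_abs] at h1
        linarith
      have hu := le_of_deriv_le_pow (hcont ξ) (h0 ξ) (hd ξ)
        (fun t ht => (le_abs_self _).trans (hbound t ht)) ht
      have hl := le_of_deriv_le_pow (w := fun t => -(f t ξ - ψ t ξ)) (hcont ξ).neg (by simp [h0 ξ])
        (fun t ht => (hd ξ t ht).fun_neg)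
        (fun t ht => (neg_le_abs _).trans (hbound t ht)) ht
      have e : 3 * (2 * 3 ^ n / (n.factorial : ℝ)) * t ^ (n + 1) / ((n : ℝ) + 1)
          = 2 * 3 ^ (n + 1) / ((n + 1).factorial : ℝ) * t ^ (n + 1) := by
        rw [Nat.factorial_succ]
        push_cast
        field_simp
        ring
      rw [e] at hu hl
      exact abs_le.2 ⟨by linarith, hu⟩
  have hlim : Tendsto (fun n : ℕ => 2 * ((3 * t) ^ n / (n.factorial : ℝ))) atTop (𝓝 (2 * 0)) :=
    (FloorSemiring.tendsto_pow_div_factorial_atTop (3 * t)).const_mul 2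
  have hle : |f t ξ - ψ t ξ| ≤ 2 * 0 := by
    refine ge_of_tendsto' hlim fun n => (key n t ht ξ).trans_eq ?_
    rw [mul_pow]
    ring
  rw [mul_zero] at hle
  exact sub_eq_zero.1 (abs_nonpos_iff.1 hle)

/-! ### Symmetrization of the initial law -/

section

variable {μ₀ : Measure ℝ} [IsProbabilityMeasure μ₀]

/-- The symmetrization of a law on the line. -/
noncomputable def symmetrized (μ₀ : Measure ℝ) : Measure ℝ :=
  (2⁻¹ : NNReal) • (μ₀ + μ₀.map (fun x => -x))

instance : IsProbabilityMeasure (symmetrized μ₀) := by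
  have : IsProbabilityMeasure (μ₀.map fun x => -x) :=
    Measure.isProbabilityMeasure_map (by fun_prop)
  constructor
  rw [symmetrized, Measure.smul_apply, Measure.add_apply, measure_univ, measure_univ]
  rw [one_add_one_eq_two, ENNReal.smul_def, smul_eq_mul, ENNReal.coe_inv (by norm_num)]
  exact ENNReal.inv_mul_cancel (by norm_num) (by norm_num)

omit [IsProbabilityMeasure μ₀] in
lemma charFun_nnreal_smul (r : NNReal) (μ : Measure ℝ) (ξ : ℝ) :
    charFun (r • μ) ξ = ((r : ℝ) : ℂ) * charFun μ ξ := by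
  rw [charFun_apply, charFun_apply, integral_smul_nnreal_measure]
  rfl

omit [IsProbabilityMeasure μ₀] in
lemma charFun_measure_add (μ ν : Measure ℝ) [IsFiniteMeasure μ] [IsFiniteMeasure ν] (ξ : ℝ) :
    charFun (μ + ν) ξ = charFun μ ξ + charFun ν ξ := by
  have h : ∀ μ : Measure ℝ, IsFiniteMeasure μ →
      Integrable (fun x : ℝ => Complex.exp (inner ℝ x ξ * Complex.I)) μ := fun μ _ =>
    Integrable.of_bound (Continuous.aestronglyMeasurable (by fun_prop)) 1
      (Eventually.of_forall fun x => (Complex.norm_exp_ofReal_mul_I _).le)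
  simp only [charFun_apply]
  rw [integral_add_measure (h μ inferInstance) (h ν inferInstance)]

lemma charFun_symmetrized (ξ : ℝ) :
    charFun (symmetrized μ₀) ξ = (((charFun μ₀ ξ).re : ℝ) : ℂ) := by
  have : IsProbabilityMeasure (μ₀.map fun x => -x) :=
    Measure.isProbabilityMeasure_map (by fun_prop)
  have h : (fun x : ℝ => -x) = fun x => (-1) * x := by
    ext x
    ring
  rw [symmetrized, charFun_nnreal_smul, charFun_measure_add]
  rw [h, charFun_map_mul, neg_one_mul, charFun_add_charFun_neg]
  push_cast
  ring

lemma measureReal_Iio_eq_leftLim (x : ℝ) :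
    Function.leftLim (fun y => cdf μ₀ y) x = μ₀.real (Iio x) := by
  have h := StieltjesFunction.measure_Iio (cdf μ₀) (tendsto_cdf_atBot μ₀) x
  rw [measure_cdf, sub_zero] at h
  rw [measureReal_def, h, ENNReal.toReal_ofReal]
  exact ((monotone_cdf μ₀).le_leftLim (sub_one_lt x)).trans' (cdf_nonneg μ₀ _)

/-- The left limit enters through P(-X ≤ x) = P(X ≥ -x) = 1 - F₀(-x - 0). -/
lemma cdf_symmetrized (x : ℝ) :
    cdf (symmetrized μ₀) x
      = 2⁻¹ * (cdf μ₀ x + (1 - Function.leftLim (fun y => cdf μ₀ y) (-x))) := by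
  have : IsProbabilityMeasure (μ₀.map fun x => -x) :=
    Measure.isProbabilityMeasure_map (by fun_prop)
  rw [cdf_eq_real, cdf_eq_real, measureReal_Iio_eq_leftLim, symmetrized,
    measureReal_nnreal_smul_apply, measureReal_add_apply,
    map_measureReal_apply (by fun_prop) measurableSet_Iic,
    ← probReal_compl_eq_one_sub measurableSet_Iio]
  have : (fun x : ℝ => -x) ⁻¹' Iic x = (Iio (-x))ᶜ := by
    ext y
    simp
  rw [this]
  rfl

lemma abs_le_asymmetry (x : ℝ) :
    |cdf μ₀ x + Function.leftLim (fun y => cdf μ₀ y) (-x) - 1| ≤ asymmetry μ₀ := by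
  refine le_ciSup (f := fun x => |cdf μ₀ x + Function.leftLim (fun y => cdf μ₀ y) (-x) - 1|)
    ⟨1, ?_⟩ x
  rintro _ ⟨y, rfl⟩
  simp only [measureReal_Iio_eq_leftLim]
  have h1 := cdf_nonneg μ₀ y
  have h2 := cdf_le_one μ₀ y
  have h3 : 0 ≤ μ₀.real (Iio (-y)) := measureReal_nonneg
  have h4 : μ₀.real (Iio (-y)) ≤ 1 := measureReal_le_one
  rw [abs_le]
  constructor <;> linarith

end

/-! ### Weighted sums of independent variables -/

/-- The sum `∑_j b_j x_j`. -/
def listDot : List ℝ → (ℕ → ℝ) → ℝ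
  | [], _ => 0
  | b :: L, x => b * x 0 + listDot L (fun k => x (k + 1))

lemma measurable_shift (n : ℕ) : Measurable fun (x : ℕ → ℝ) k => x (k + n) :=
  measurable_pi_lambda _ fun _ => measurable_pi_apply _

lemma measurable_listDot (L : List ℝ) : Measurable (listDot L) := by
  induction L with
  | nil => exact measurable_const
  | cons b L ih =>
    exact (measurable_const.mul (measurable_pi_apply 0)).add (ih.comp (measurable_shift 1))

/-- There are countably many trees, so joint measurability may be checked tree by tree. -/
lemma measurable_listDot_weights (p : ℝ) :
    Measurable fun q : (BinaryTree Unit × (ℕ → ℝ)) × (ℕ → ℝ) =>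
      listDot (weights p q.1.1 q.1.2) q.2 := by
  have key : ∀ L : List ((ℕ → ℝ) → ℝ), (∀ h ∈ L, Measurable h) →
      Measurable fun q : (ℕ → ℝ) × (ℕ → ℝ) => listDot (L.map fun h => h q.1) q.2 := by
    intro L
    induction L with
    | nil => intro _; exact measurable_const
    | cons h L ih =>
      intro hL
      have h1 := (ih fun k hk => hL k (List.mem_cons_of_mem _ hk)).comp
        (measurable_fst.prodMk ((measurable_shift 1).comp measurable_snd))
      exact (((hL h List.mem_cons_self).comp measurable_fst).mul
        ((measurable_pi_apply 0).comp measurable_snd)).add h1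
  have h2 : Measurable fun q : BinaryTree Unit × ((ℕ → ℝ) × (ℕ → ℝ)) =>
      listDot (weights p q.1 q.2.1) q.2.2 := by
    refine measurable_from_prod_countable_right fun g => ?_
    simp only [weights_eq]
    exact key _ (measurable_of_mem_weightFns p g)
  exact h2.comp ((measurable_fst.comp measurable_fst).prodMk
    ((measurable_snd.comp measurable_fst).prodMk measurable_snd))

/-- The law of `∑_j b_j X_j`, for independent variables `X_j` with law `ν`. -/
noncomputable def listLaw (ν : Measure ℝ) [IsProbabilityMeasure ν] (L : List ℝ) : Measure ℝ :=
  (Measure.infinitePi fun _ : ℕ => ν).map (listDot L)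

section

variable {ν : Measure ℝ} [IsProbabilityMeasure ν]

instance (L : List ℝ) : IsProbabilityMeasure (listLaw ν L) :=
  Measure.isProbabilityMeasure_map (measurable_listDot L).aemeasurable

lemma listLaw_cons (b : ℝ) (L : List ℝ) :
    listLaw ν (b :: L) = (ν.map (b * ·)).conv (listLaw ν L) := by
  have hb : Measurable fun x : ℝ => b * x := by fun_prop
  rw [listLaw, ← map_seqCons, Measure.map_map (measurable_listDot _) measurable_seqCons, listLaw,
    Measure.conv, Measure.map_prod_map _ _ hb (measurable_listDot L),
    Measure.map_map (by fun_prop) (hb.prodMap (measurable_listDot L))]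
  rfl

lemma charFun_listLaw (L : List ℝ) (ξ : ℝ) :
    charFun (listLaw ν L) ξ = (L.map fun b => charFun ν (b * ξ)).prod := by
  induction L with
  | nil =>
    have : listLaw ν [] = Measure.dirac 0 := by
      have : listDot [] = fun _ => 0 := rfl
      rw [listLaw, this, Measure.map_const, measure_univ, one_smul]
    simp [this]
  | cons b L ih =>
    have : IsProbabilityMeasure (ν.map (b * ·)) :=
      Measure.isProbabilityMeasure_map (by fun_prop)
    rw [listLaw_cons, charFun_conv, ih, charFun_map_mul, List.map_cons, List.prod_cons]

end

lemma charFun_listLaw_symmetrized (μ₀ : Measure ℝ) [IsProbabilityMeasure μ₀] (L : List ℝ) (ξ : ℝ) :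
    charFun (listLaw (symmetrized μ₀) L) ξ
      = (((L.map fun b => (charFun μ₀ (b * ξ)).re).prod : ℝ) : ℂ) := by
  rw [charFun_listLaw]
  simp only [charFun_symmetrized]
  induction L with
  | nil => simp
  | cons b L ih => simp only [List.map_cons, List.prod_cons, ih, Complex.ofReal_mul]

/-! ### The law of the weighted sum with random weights -/

/-- The law of `∑_j β_{j,t} X_j`, for independent `X_j` with law `ν`, independent of the weights. -/
noncomputable def wildLaw (p : ℝ) (ν : Measure ℝ) [IsProbabilityMeasure ν] (t : ℝ) : Measure ℝ :=
  ((treeAngleLaw t).prod (Measure.infinitePi fun _ : ℕ => ν)).map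
    fun q => listDot (weights p q.1.1 q.1.2) q.2

section

variable {p : ℝ} {ν : Measure ℝ} [IsProbabilityMeasure ν]

lemma isProbabilityMeasure_wildLaw {t : ℝ} (ht : 0 ≤ t) : IsProbabilityMeasure (wildLaw p ν t) := by
  have := isProbabilityMeasure_treeAngleLaw ht
  exact Measure.isProbabilityMeasure_map (measurable_listDot_weights p).aemeasurable

lemma charFun_wildLaw {t : ℝ} (ht : 0 ≤ t) (ξ : ℝ) :
    charFun (wildLaw p ν t) ξ
      = ∫ ω, charFun (listLaw ν (weights p ω.1 ω.2)) ξ ∂(treeAngleLaw t) := by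
  have := isProbabilityMeasure_treeAngleLaw ht
  have hm := measurable_listDot_weights p
  rw [charFun_apply_real, wildLaw, integral_map hm.aemeasurable
    (Continuous.aestronglyMeasurable (by fun_prop)), integral_prod]
  · refine integral_congr_ae (Eventually.of_forall fun ω => ?_)
    simp only
    rw [charFun_apply_real, listLaw, integral_map (measurable_listDot _).aemeasurable
      (Continuous.aestronglyMeasurable (by fun_prop))]
  · refine Integrable.of_bound (Measurable.aestronglyMeasurable (by fun_prop)) 1
      (Eventually.of_forall fun q => ?_)
    rw [← Complex.ofReal_mul]
    exact (Complex.norm_exp_ofReal_mul_I _).le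

lemma measurable_cdf_listLaw_weights (y : ℝ) :
    Measurable fun ω : BinaryTree Unit × (ℕ → ℝ) => cdf (listLaw ν (weights p ω.1 ω.2)) y := by
  have h := measurable_measure_prodMk_left (ν := Measure.infinitePi fun _ : ℕ => ν)
    ((measurable_listDot_weights p) (measurableSet_Iic (a := y)))
  simp only [cdf_eq_real, measureReal_def]
  convert! ENNReal.measurable_toReal.comp h using 2
  rw [listLaw, Measure.map_apply (measurable_listDot _) measurableSet_Iic]
  rfl

lemma cdf_wildLaw {t : ℝ} (ht : 0 ≤ t) (y : ℝ) :
    cdf (wildLaw p ν t) y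
      = ∫ ω, cdf (listLaw ν (weights p ω.1 ω.2)) y ∂(treeAngleLaw t) := by
  have := isProbabilityMeasure_treeAngleLaw ht
  have := isProbabilityMeasure_wildLaw (p := p) (ν := ν) ht
  have hm := measurable_listDot_weights p
  rw [cdf_eq_real, measureReal_def, wildLaw, Measure.map_apply hm measurableSet_Iic,
    Measure.prod_apply (hm measurableSet_Iic)]
  rw [integral_eq_lintegral_of_nonneg_ae (Eventually.of_forall fun ω => cdf_nonneg _ _)
    (measurable_cdf_listLaw_weights y).aestronglyMeasurable]
  congr 1
  refine lintegral_congr fun ω => ?_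
  rw [cdf_eq_real, measureReal_def, ENNReal.ofReal_toReal (measure_ne_top _ _), listLaw,
    Measure.map_apply (measurable_listDot _) measurableSet_Iic]
  rfl

end

section

variable {p : ℝ} {μ₀ : Measure ℝ} [IsProbabilityMeasure μ₀]

lemma charFun_wildLaw_symmetrized {t : ℝ} (ht : 0 ≤ t) (ξ : ℝ) :
    charFun (wildLaw p (symmetrized μ₀) t) ξ
      = ((wildSum p (fun ξ => (charFun μ₀ ξ).re) t ξ : ℝ) : ℂ) := by
  rw [charFun_wildLaw ht]
  simp only [charFun_listLaw_symmetrized]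
  rw [integral_complex_ofReal, integral_treeAngleLaw ht (C := 1)]
  · rfl
  · refine measurable_from_prod_countable_right fun g => ?_
    exact measurable_prod_weights p g
      ((continuous_re_charFun μ₀).measurable.comp (measurable_id.mul_const ξ))
  · exact fun ω => abs_prod_map_le_one (fun b => abs_re_charFun_le_one μ₀ _) _

/-- The law of a solution differs from the law of the weighted sum of symmetrized variables by the
antisymmetric part of the initial law, damped by `e^{-t}`. -/
lemma IsSolution.add_symmetrized_eq {μ : ℝ → Measure ℝ} [∀ t, IsProbabilityMeasure (μ t)]
    (h : IsSolution p μ₀ μ) {t : ℝ} (ht : 0 ≤ t) :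
    μ t + (Real.exp (-t)).toNNReal • symmetrized μ₀
      = wildLaw p (symmetrized μ₀) t + (Real.exp (-t)).toNNReal • μ₀ := by
  have := isProbabilityMeasure_wildLaw (p := p) (ν := symmetrized μ₀) ht
  -- The terms in e^{-t} stand on opposite sides so that both sides are positive finite measures, to
  -- which uniqueness of characteristic functions applies.
  refine Measure.ext_of_charFun (funext fun ξ => ?_)
  rw [charFun_measure_add, charFun_measure_add, charFun_nnreal_smul, charFun_nnreal_smul,
    charFun_symmetrized, charFun_wildLaw_symmetrized ht, ← h.re_charFun_eq ht,
    Real.coe_toNNReal _ (Real.exp_pos _).le]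
  apply Complex.ext
  · simp only [Complex.add_re, Complex.ofReal_re, Complex.re_ofReal_mul]
  · simp only [Complex.add_im, Complex.ofReal_im, Complex.im_ofReal_mul, h.im_charFun_eq ht]
    ring

lemma IsSolution.cdf_sub_cdf_wildLaw {μ : ℝ → Measure ℝ} [∀ t, IsProbabilityMeasure (μ t)]
    (h : IsSolution p μ₀ μ) {t : ℝ} (ht : 0 ≤ t) (x : ℝ) :
    cdf (μ t) x - cdf (wildLaw p (symmetrized μ₀) t) x
      = Real.exp (-t) / 2 * (cdf μ₀ x + Function.leftLim (fun y => cdf μ₀ y) (-x) - 1) := by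
  have := isProbabilityMeasure_wildLaw (p := p) (ν := symmetrized μ₀) ht
  have h1 : (μ t + (Real.exp (-t)).toNNReal • symmetrized μ₀).real (Iic x)
      = (wildLaw p (symmetrized μ₀) t + (Real.exp (-t)).toNNReal • μ₀).real (Iic x) := by
    rw [h.add_symmetrized_eq ht]
  rw [measureReal_add_apply, measureReal_add_apply, measureReal_nnreal_smul_apply,
    measureReal_nnreal_smul_apply, ← cdf_eq_real, ← cdf_eq_real, ← cdf_eq_real, ← cdf_eq_real,
    cdf_symmetrized, Real.coe_toNNReal _ (Real.exp_pos _).le] at h1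
  linear_combination h1

end

/-! ### The radial integral -/

/-- The integral `∫_0^∞ H(ξ, q) ξ^{α-1} e^{-(a₀-η) ξ^α} dξ`. -/
noncomputable def integralH (α a₀ η : ℝ) (μ₀ : Measure ℝ) (q : ℝ) : ℝ :=
  ∫ ξ in Ioi (0 : ℝ), funH α a₀ μ₀ ξ q * ξ ^ (α - 1) * Real.exp (-((a₀ - η) * ξ ^ α))

section

variable {α a₀ η B : ℝ} {μ₀ : Measure ℝ}

lemma funH_nonneg (ξ q : ℝ) : 0 ≤ funH α a₀ μ₀ ξ q := by
  unfold funH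
  positivity

/-- The comparison of characteristic functions produces |v₀*| alone; the second factor of H, at
least 1, is given away. -/
lemma abs_vStar_le_funH (ξ q : ℝ) : |vStar α a₀ μ₀ (ξ * q)| ≤ funH α a₀ μ₀ ξ q := by
  unfold funH
  refine le_mul_of_one_le_right (abs_nonneg _) ?_
  have : 0 ≤ 2 * |ξ| ^ α * |vStar α a₀ μ₀ (ξ * q)| := by positivity
  linarith

lemma funH_le (hB : ∀ ξ, |vStar α a₀ μ₀ ξ| ≤ B) (ξ q : ℝ) :
    funH α a₀ μ₀ ξ q ≤ B * (1 + 2 * |ξ| ^ α * B) := by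
  have hB0 : 0 ≤ B := (abs_nonneg _).trans (hB 0)
  have := hB (ξ * q)
  unfold funH
  gcongr

lemma measurable_funH [IsProbabilityMeasure μ₀] :
    Measurable fun x : ℝ × ℝ => funH α a₀ μ₀ x.1 x.2 := by
  have := measurable_vStar α a₀ (μ₀ := μ₀)
  unfold funH
  fun_prop

lemma integrableOn_rpow_mul_exp {κ s : ℝ} (hα : 0 < α) (hκ : 0 < κ) (hs : 0 < s) :
    IntegrableOn (fun ξ : ℝ => ξ ^ (s - 1) * Real.exp (-(κ * ξ ^ α))) (Ioi 0) := by
  have := integrableOn_rpow_mul_exp_neg_mul_rpow (p := α) (s := s - 1) (b := κ) (by linarith) hα hκ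
  simpa only [neg_mul] using this

/-- A majorant independent of q: it gives integrability, a uniform bound on `integralH`, and
dominated convergence as q → 0. -/
lemma integrableOn_majorant (hα : 0 < α) (hη : η < a₀) (B : ℝ) :
    IntegrableOn (fun ξ : ℝ => B * (1 + 2 * |ξ| ^ α * B) * ξ ^ (α - 1) *
      Real.exp (-((a₀ - η) * ξ ^ α))) (Ioi 0) := by
  have h1 := (integrableOn_rpow_mul_exp hα (sub_pos.2 hη) hα).const_mul B
  have h2 := (integrableOn_rpow_mul_exp hα (sub_pos.2 hη) (s := 2 * α)
    (by positivity)).const_mul (2 * B ^ 2)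
  refine IntegrableOn.congr_fun (h1.add h2) (fun ξ hξ => ?_) measurableSet_Ioi
  have hξ0 : 0 < ξ := hξ
  have e : ξ ^ (2 * α - 1) = ξ ^ α * ξ ^ (α - 1) := by
    rw [← Real.rpow_add hξ0]
    ring_nf
  simp only [Pi.add_apply, e, abs_of_pos hξ0]
  ring

lemma norm_integrand_le (hB : ∀ ξ, |vStar α a₀ μ₀ ξ| ≤ B) {ξ : ℝ} (hξ : 0 < ξ) (q : ℝ) :
    ‖funH α a₀ μ₀ ξ q * ξ ^ (α - 1) * Real.exp (-((a₀ - η) * ξ ^ α))‖ ≤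
      B * (1 + 2 * |ξ| ^ α * B) * ξ ^ (α - 1) * Real.exp (-((a₀ - η) * ξ ^ α)) := by
  rw [Real.norm_of_nonneg
    (mul_nonneg (mul_nonneg (funH_nonneg _ _) (by positivity)) (by positivity))]
  gcongr
  exact funH_le hB ξ q

lemma measurable_integrand [IsProbabilityMeasure μ₀] :
    Measurable fun x : ℝ × ℝ =>
      funH α a₀ μ₀ x.1 x.2 * x.1 ^ (α - 1) * Real.exp (-((a₀ - η) * x.1 ^ α)) := by
  have := measurable_funH (α := α) (a₀ := a₀) (μ₀ := μ₀)
  fun_prop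

lemma integrableOn_integrand [IsProbabilityMeasure μ₀] (hα : 0 < α) (hη : η < a₀)
    (hB : ∀ ξ, |vStar α a₀ μ₀ ξ| ≤ B) (q : ℝ) :
    IntegrableOn (fun ξ => funH α a₀ μ₀ ξ q * ξ ^ (α - 1) * Real.exp (-((a₀ - η) * ξ ^ α)))
      (Ioi 0) := by
  refine Integrable.mono' (integrableOn_majorant hα hη B)
    (measurable_integrand.comp (measurable_id.prodMk measurable_const)).aestronglyMeasurable ?_
  filter_upwards [ae_restrict_mem measurableSet_Ioi] with ξ hξ
  exact norm_integrand_le hB hξ q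

lemma integralH_nonneg (q : ℝ) : 0 ≤ integralH α a₀ η μ₀ q := by
  refine setIntegral_nonneg measurableSet_Ioi fun ξ hξ => ?_
  have : 0 < ξ := hξ
  exact mul_nonneg (mul_nonneg (funH_nonneg _ _) (by positivity)) (by positivity)

lemma exists_integralH_le [IsProbabilityMeasure μ₀] (hα : 0 < α) (hη : η < a₀)
    (hB : ∀ ξ, |vStar α a₀ μ₀ ξ| ≤ B) :
    ∃ C, 0 ≤ C ∧ ∀ q, integralH α a₀ η μ₀ q ≤ C := by
  have h : ∀ q, integralH α a₀ η μ₀ q ≤ ∫ ξ in Ioi (0 : ℝ), B * (1 + 2 * |ξ| ^ α * B) *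
      ξ ^ (α - 1) * Real.exp (-((a₀ - η) * ξ ^ α)) := by
    intro q
    exact setIntegral_mono_on (integrableOn_integrand hα hη hB q) (integrableOn_majorant hα hη B)
      measurableSet_Ioi fun ξ hξ => (le_abs_self _).trans (norm_integrand_le hB hξ q)
  exact ⟨_, (integralH_nonneg 0).trans (h 0), h⟩

lemma measurable_integralH [IsProbabilityMeasure μ₀] : Measurable (integralH α a₀ η μ₀) := by
  have h := (measurable_integrand (α := α) (a₀ := a₀) (η := η) (μ₀ := μ₀)).comp measurable_swap
  exact (h.stronglyMeasurable.integral_prod_right'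
    (ν := volume.restrict (Ioi (0 : ℝ)))).measurable

lemma tendsto_integralH [IsProbabilityMeasure μ₀] (hα : 0 < α) (hη : η < a₀)
    (hB : ∀ ξ, |vStar α a₀ μ₀ ξ| ≤ B) (hv : Tendsto (vStar α a₀ μ₀) (𝓝 0) (𝓝 0)) :
    Tendsto (integralH α a₀ η μ₀) (𝓝 0) (𝓝 0) := by
  have h0 : ∫ ξ in Ioi (0 : ℝ), (0 : ℝ) = 0 := by simp
  suffices h : Tendsto (integralH α a₀ η μ₀) (𝓝 0) (𝓝 (∫ ξ in Ioi (0 : ℝ), (0 : ℝ))) by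
    rwa [h0] at h
  refine tendsto_integral_filter_of_dominated_convergence _
    (Eventually.of_forall fun q => (integrableOn_integrand hα hη hB q).aestronglyMeasurable)
    (Eventually.of_forall fun q => ?_) (integrableOn_majorant hα hη B)
    (Eventually.of_forall fun ξ => ?_)
  · filter_upwards [ae_restrict_mem measurableSet_Ioi] with ξ hξ
    exact norm_integrand_le hB hξ q
  · have h1 : Tendsto (fun q : ℝ => ξ * q) (𝓝 0) (𝓝 0) := by
      have := (continuous_const_mul ξ).tendsto 0
      rwa [mul_zero] at this
    have h2 := (hv.comp h1).abs
    rw [abs_zero] at h2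
    have h3 := ((h2.mul ((h2.const_mul (2 * |ξ| ^ α)).const_add 1)).mul_const
      (ξ ^ (α - 1))).mul_const (Real.exp (-((a₀ - η) * ξ ^ α)))
    simp only [zero_mul] at h3
    exact h3

/-! ### The bound for fixed weights -/

lemma sum_map_le_of_le {L : List ℝ} {f g : ℝ → ℝ} (h : ∀ b, f b ≤ g b) :
    (L.map f).sum ≤ (L.map g).sum := List.sum_le_sum fun b _ => h b

lemma integrableOn_list_sum {L : List ℝ} {f : ℝ → ℝ → ℝ} {s : Set ℝ}
    (h : ∀ b, IntegrableOn (f b) s) :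
    IntegrableOn (fun ξ => (L.map fun b => f b ξ).sum) s := by
  induction L with
  | nil => simp
  | cons b L ih =>
    simp only [List.map_cons, List.sum_cons]
    exact (h b).add ih

lemma integral_list_sum {L : List ℝ} {f : ℝ → ℝ → ℝ} {s : Set ℝ}
    (h : ∀ b, IntegrableOn (f b) s) :
    ∫ ξ in s, (L.map fun b => f b ξ).sum = (L.map fun b => ∫ ξ in s, f b ξ).sum := by
  induction L with
  | nil => simp
  | cons b L ih =>
    simp only [List.map_cons, List.sum_cons]
    rw [integral_add (h b) (integrableOn_list_sum h), ih]

/-- The cutoff T = d̃ / max|b| is the largest for which |ξ| ≤ T forces every |b ξ| ≤ d̃. The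
resulting even majorant is integrated over the whole line, so 1/π becomes 2/π on the half-line, and
8/(5π) = (2/π)(4/5). -/
lemma kolmogorovDist_listLaw_le [IsProbabilityMeasure μ₀] {G : Measure ℝ} [IsProbabilityMeasure G]
    {c d : ℝ} (hc : IsBerryEsseenConstant c) (hα : 0 < α) (ha₀ : 0 < a₀) (hη : η < a₀)
    (hG : IsSymmetricStable α a₀ G) (hB : ∀ ξ, |vStar α a₀ μ₀ ξ| ≤ B)
    (hd : IsAdmissible α a₀ μ₀ η d) {L : List ℝ} (hL : (L.map fun b => |b| ^ α).sum = 1)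
    (hmax : 0 < maxAbs L) :
    kolmogorovDist (listLaw (symmetrized μ₀) L) G ≤
      2 / Real.pi * (L.map fun b => |b| ^ α * integralH α a₀ η μ₀ |b|).sum
      + c * densitySupNorm G / dTilde α a₀ μ₀ d * maxAbs L
      + 8 / (5 * Real.pi) * constM α a₀ μ₀ ^ 2 * constN α a₀ η (2 * α) *
        (L.map fun b => |b| ^ (2 * α)).sum := by
  set ν := listLaw (symmetrized μ₀) L with hν
  set S := (L.map fun b => |b| ^ (2 * α)).sum with hS
  have hS0 : 0 ≤ S := sum_abs_rpow_nonneg _ _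
  have hdt := dTilde_pos (α := α) (μ₀ := μ₀) ha₀ hd.1.1
  set T := dTilde α a₀ μ₀ d / maxAbs L with hT
  have hT0 : 0 < T := div_pos hdt hmax
  -- The bound of `abs_prod_sub_exp_le` divided by ξ, for ξ > 0, with |v₀*| enlarged to H.
  let k : ℝ → ℝ := fun ξ =>
    (L.map fun b => |b| ^ α *
      (funH α a₀ μ₀ ξ |b| * ξ ^ (α - 1) * Real.exp (-((a₀ - η) * ξ ^ α)))).sum
    + 4 / 5 * constM α a₀ μ₀ ^ 2 * S * (ξ ^ (2 * α - 1) * Real.exp (-((a₀ - η) * ξ ^ α)))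
  have hk1 : ∀ b : ℝ, IntegrableOn (fun ξ => |b| ^ α *
      (funH α a₀ μ₀ ξ |b| * ξ ^ (α - 1) * Real.exp (-((a₀ - η) * ξ ^ α)))) (Ioi 0) := fun b =>
    (integrableOn_integrand hα hη hB |b|).const_mul _
  have hk2 := (integrableOn_rpow_mul_exp hα (sub_pos.2 hη) (s := 2 * α)
    (by positivity)).const_mul (4 / 5 * constM α a₀ μ₀ ^ 2 * S)
  have hk : IntegrableOn k (Ioi 0) := (integrableOn_list_sum hk1).add hk2
  have hkint : ∫ ξ in Ioi (0 : ℝ), k ξ = (L.map fun b => |b| ^ α * integralH α a₀ η μ₀ |b|).sum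
      + 4 / 5 * constM α a₀ μ₀ ^ 2 * S * constN α a₀ η (2 * α) := by
    simp only [k]
    rw [integral_add (integrableOn_list_sum hk1) hk2, integral_list_sum hk1, integral_const_mul]
    simp only [integral_const_mul, integralH, constN]
    congr 2
    refine integral_congr_ae (Eventually.of_forall fun ξ => ?_)
    simp only [mul_comm]
  have hk0 : ∀ ξ, 0 ≤ k |ξ| := by
    intro ξ
    refine add_nonneg (List.sum_nonneg ?_) (by positivity)
    intro x hx
    obtain ⟨b, _, rfl⟩ := List.mem_map.1 hx
    have := funH_nonneg (α := α) (a₀ := a₀) (μ₀ := μ₀) |ξ| |b|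
    positivity
  have hD : ∀ ξ, |ξ| ≤ T → ‖(charFun ν ξ - charFun G ξ) / (ξ : ℂ)‖ ≤ k |ξ| := by
    intro ξ hξ
    -- At ξ = 0 the quotient is 0 by the convention for division.
    rcases eq_or_ne ξ 0 with rfl | hξ0
    · simpa using hk0 0
    have hpos : 0 < |ξ| := abs_pos.2 hξ0
    have hsmall : ∀ b ∈ L, |b * ξ| ≤ dTilde α a₀ μ₀ d := by
      intro b hb
      rw [abs_mul]
      calc |b| * |ξ| ≤ maxAbs L * T := by
            have := abs_le_maxAbs hb
            gcongr
        _ = dTilde α a₀ μ₀ d := by rw [hT]; field_simp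
    have h1 := abs_prod_sub_exp_le hα ha₀ hB hd hL hsmall
    rw [hν, charFun_listLaw_symmetrized, hG ξ, ← Complex.ofReal_sub, ← Complex.ofReal_div,
      Complex.norm_real, norm_div, Real.norm_eq_abs, Real.norm_eq_abs, div_le_iff₀ hpos]
    refine h1.trans ?_
    have h2 : (L.map fun b => |b| ^ α * |vStar α a₀ μ₀ (ξ * |b|)|).sum
        ≤ (L.map fun b => |b| ^ α * funH α a₀ μ₀ |ξ| |b|).sum := by
      refine sum_map_le_of_le fun b => ?_
      have h3 := abs_vStar_le_funH (α := α) (a₀ := a₀) (μ₀ := μ₀) |ξ| |b|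
      rw [← vStar_abs, abs_mul, abs_abs]
      gcongr
    have e1 : |ξ| ^ (α - 1) * |ξ| = |ξ| ^ α := by
      rw [Real.rpow_sub_one hpos.ne', div_mul_cancel₀ _ hpos.ne']
    have e2 : |ξ| ^ (2 * α - 1) * |ξ| = |ξ| ^ (2 * α) := by
      rw [Real.rpow_sub_one hpos.ne', div_mul_cancel₀ _ hpos.ne']
    have e3 : k |ξ| * |ξ| = ((L.map fun b => |b| ^ α * funH α a₀ μ₀ |ξ| |b|).sum * |ξ| ^ α
        + 4 / 5 * constM α a₀ μ₀ ^ 2 * S * |ξ| ^ (2 * α)) *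
        Real.exp (-((a₀ - η) * |ξ| ^ α)) := by
      have e4 : (L.map fun b => |b| ^ α * (funH α a₀ μ₀ |ξ| |b| * |ξ| ^ (α - 1) *
          Real.exp (-((a₀ - η) * |ξ| ^ α)))).sum
          = (L.map fun b => |b| ^ α * funH α a₀ μ₀ |ξ| |b|).sum *
            (|ξ| ^ (α - 1) * Real.exp (-((a₀ - η) * |ξ| ^ α))) := by
        rw [← List.sum_map_mul_right]
        congr 2
        ext b
        ring
      simp only [k]
      rw [e4, ← e1, ← e2]
      ring
    rw [e3]
    gcongr
  have hkabs : Integrable fun ξ => k |ξ| := integrable_comp_abs hk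
  have hTT : -T ≤ T := by linarith
  have hmeas : Measurable fun ξ : ℝ => ‖(charFun ν ξ - charFun G ξ) / (ξ : ℂ)‖ := by
    have h1 : Measurable (charFun ν) := continuous_charFun.measurable
    have h2 : Measurable (charFun G) := continuous_charFun.measurable
    fun_prop
  have hii : IntegrableOn (fun ξ : ℝ => ‖(charFun ν ξ - charFun G ξ) / (ξ : ℂ)‖) (Ioc (-T) T) := by
    refine Integrable.mono' hkabs.integrableOn hmeas.aestronglyMeasurable ?_
    filter_upwards [ae_restrict_mem measurableSet_Ioc] with ξ hξ
    rw [norm_norm]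
    exact hD ξ (abs_le.2 ⟨hξ.1.le, hξ.2⟩)
  have hle : ∫ ξ in (-T)..T, ‖(charFun ν ξ - charFun G ξ) / (ξ : ℂ)‖
      ≤ 2 * ∫ ξ in Ioi (0 : ℝ), k ξ := by
    rw [intervalIntegral.integral_of_le hTT, ← integral_comp_abs]
    refine (setIntegral_mono_on hii hkabs.integrableOn measurableSet_Ioc fun ξ hξ =>
      hD ξ (abs_le.2 ⟨hξ.1.le, hξ.2⟩)).trans ?_
    exact setIntegral_le_integral hkabs (Eventually.of_forall hk0)
  have hBE := hc ν G (densitySupNorm G) T inferInstance inferInstance hT0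
    (hG.differentiable_cdf hα ha₀) (hG.abs_deriv_cdf_le hα ha₀)
    ((intervalIntegrable_iff_integrableOn_Ioc_of_le hTT).2 hii)
  rw [hkint] at hle
  have e5 : c * densitySupNorm G / T = c * densitySupNorm G / dTilde α a₀ μ₀ d * maxAbs L := by
    rw [hT]
    field_simp
  rw [e5] at hBE
  have hle2 := mul_le_mul_of_nonneg_left hle (by positivity : 0 ≤ 1 / Real.pi)
  refine hBE.trans ((add_le_add_left hle2 _).trans (le_of_eq ?_))
  field_simp
  ring

end

/-! ### Expectations of functions of the weights -/

section

variable {p : ℝ}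

lemma measurable_sum_weights_prod (p : ℝ) {f : ℝ → ℝ} (hf : Measurable f) :
    Measurable fun ω : BinaryTree Unit × (ℕ → ℝ) => ((weights p ω.1 ω.2).map f).sum :=
  measurable_from_prod_countable_right fun g => measurable_sum_weights p g hf

lemma measurable_maxAbs_weights_prod (p : ℝ) :
    Measurable fun ω : BinaryTree Unit × (ℕ → ℝ) => maxAbs (weights p ω.1 ω.2) :=
  measurable_from_prod_countable_right fun g => measurable_maxAbs_weights p g

lemma integral_sum_abs_rpow_weights (hp : 0 < p) {t : ℝ} (ht : 0 ≤ t) :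
    ∫ ω, ((weights p ω.1 ω.2).map fun b => |b| ^ (2 * alpha p)).sum ∂(treeAngleLaw t)
      = Real.exp (-(t * (1 - 2 * constA 4))) := by
  have h := expAvg_treePow hp one_le_two ht
  have e : (2 : ℝ) * 2 = 4 := by norm_num
  rw [e] at h
  rw [← h, integral_treeAngleLaw ht (C := 1)]
  · rfl
  · exact measurable_sum_weights_prod p (by fun_prop)
  · intro ω
    rw [abs_of_nonneg (sum_abs_rpow_nonneg _ _)]
    exact sum_abs_rpow_le_one hp one_le_two _ _

lemma integrable_sum_abs_rpow_weights (hp : 0 < p) {t : ℝ} (ht : 0 ≤ t) :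
    Integrable (fun ω : BinaryTree Unit × (ℕ → ℝ) =>
      ((weights p ω.1 ω.2).map fun b => |b| ^ (2 * alpha p)).sum) (treeAngleLaw t) := by
  have := isProbabilityMeasure_treeAngleLaw ht
  refine Integrable.of_bound (measurable_sum_weights_prod p (by fun_prop)).aestronglyMeasurable 1
    (Eventually.of_forall fun ω => ?_)
  rw [Real.norm_of_nonneg (sum_abs_rpow_nonneg _ _)]
  exact sum_abs_rpow_le_one hp one_le_two _ _

lemma integrable_maxAbs_weights (hp : 0 < p) {t : ℝ} (ht : 0 ≤ t) :
    Integrable (fun ω : BinaryTree Unit × (ℕ → ℝ) => maxAbs (weights p ω.1 ω.2))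
      (treeAngleLaw t) := by
  have := isProbabilityMeasure_treeAngleLaw ht
  refine Integrable.of_bound (measurable_maxAbs_weights_prod p).aestronglyMeasurable 1
    (Eventually.of_forall fun ω => ?_)
  rw [Real.norm_of_nonneg (maxAbs_nonneg _)]
  exact maxAbs_weights_le_one hp _ _

lemma sum_abs_rpow_mul_nonneg {I : ℝ → ℝ} (hI : ∀ q, 0 ≤ I q) (s : ℝ) (L : List ℝ) :
    0 ≤ (L.map fun b => |b| ^ s * I |b|).sum := by
  refine List.sum_nonneg ?_
  intro x hx
  obtain ⟨b, _, rfl⟩ := List.mem_map.1 hx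
  exact mul_nonneg (by positivity) (hI _)

lemma integrable_sum_abs_rpow_mul_weights (hp : 0 < p) {t : ℝ} (ht : 0 ≤ t) {I : ℝ → ℝ}
    (hIm : Measurable I) (hI : ∀ q, 0 ≤ I q) {C : ℝ} (hC : ∀ q, I q ≤ C) :
    Integrable (fun ω : BinaryTree Unit × (ℕ → ℝ) =>
      ((weights p ω.1 ω.2).map fun b => |b| ^ alpha p * I |b|).sum) (treeAngleLaw t) := by
  have := isProbabilityMeasure_treeAngleLaw ht
  refine Integrable.of_bound (measurable_sum_weights_prod p (by fun_prop)).aestronglyMeasurable C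
    (Eventually.of_forall fun ω => ?_)
  rw [Real.norm_of_nonneg (sum_abs_rpow_mul_nonneg hI _ _)]
  refine sum_weights_le hp _ _ fun b _ => ?_
  rw [mul_comm]
  exact mul_le_mul_of_nonneg_right (hC _) (by positivity)

lemma tendsto_zero_of_le_add_exp {f : ℝ → ℝ} {κ : ℝ} (hκ : 0 < κ) (h0 : ∀ t, 0 ≤ t → 0 ≤ f t)
    (h : ∀ ε, 0 < ε → ∃ K, ∀ t, 0 ≤ t → f t ≤ ε + K * Real.exp (-(t * κ))) :
    Tendsto f atTop (𝓝 0) := by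
  have hexp : Tendsto (fun t : ℝ => Real.exp (-(t * κ))) atTop (𝓝 0) :=
    Real.tendsto_exp_neg_atTop_nhds_zero.comp (tendsto_id.atTop_mul_const hκ)
  rw [tendsto_order]
  refine ⟨fun a ha => ?_, fun ε hε => ?_⟩
  · filter_upwards [eventually_ge_atTop 0] with t ht
    exact ha.trans_le (h0 t ht)
  · obtain ⟨K, hK⟩ := h (ε / 2) (half_pos hε)
    have h1 : Tendsto (fun t : ℝ => ε / 2 + K * Real.exp (-(t * κ))) atTop (𝓝 (ε / 2 + K * 0)) :=
      (hexp.const_mul K).const_add _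
    have h2 : ε / 2 + K * 0 < ε := by linarith
    filter_upwards [eventually_ge_atTop 0, h1.eventually_lt_const h2] with t ht ht'
    exact (hK t ht).trans_lt ht'

lemma one_sub_two_mul_constA_four : 1 - 2 * constA 4 = 1 / 4 := by
  rw [constA_four]
  norm_num

lemma one_sub_two_mul_constA_six : 1 - 2 * constA 6 = 3 / 8 := by
  rw [constA_six]
  norm_num

/-- A Markov-type bound: where max|β_j| ≥ ε, the quantity ε^{-2α} ∑ |β_j|^{2α} is at least 1, and
its mean decays exponentially. -/
lemma tendsto_expectMax (hp : 0 < p) : Tendsto (expectMax p) atTop (𝓝 0) := by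
  refine tendsto_zero_of_le_add_exp (κ := 1 - 2 * constA 4)
    (by rw [one_sub_two_mul_constA_four]; norm_num)
    (fun t _ => integral_nonneg fun ω => maxAbs_nonneg _)
    fun ε hε => ⟨(ε ^ (2 * alpha p))⁻¹, fun t ht => ?_⟩
  have := isProbabilityMeasure_treeAngleLaw ht
  have hs : 0 < 2 * alpha p := by
    have := alpha_pos hp
    positivity
  have hi := integrable_sum_abs_rpow_weights hp ht
  have hsplit : ∫ ω, (ε + (ε ^ (2 * alpha p))⁻¹ *
      ((weights p ω.1 ω.2).map fun b => |b| ^ (2 * alpha p)).sum) ∂(treeAngleLaw t)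
      = ε + (ε ^ (2 * alpha p))⁻¹ * Real.exp (-(t * (1 - 2 * constA 4))) := by
    rw [integral_add (integrable_const ε) (hi.const_mul _), integral_const_mul,
      integral_sum_abs_rpow_weights hp ht]
    simp
  rw [← hsplit]
  refine integral_mono (integrable_maxAbs_weights hp ht)
    ((integrable_const ε).add (hi.const_mul _)) fun ω => ?_
  have h1 := maxAbs_rpow_le_sum hs (weights p ω.1 ω.2)
  have h2 := sum_abs_rpow_nonneg (2 * alpha p) (weights p ω.1 ω.2)
  have hεs : 0 < ε ^ (2 * alpha p) := by positivity
  rcases le_total (maxAbs (weights p ω.1 ω.2)) ε with h | h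
  · exact h.trans (le_add_of_nonneg_right (by positivity))
  · refine (maxAbs_weights_le_one hp _ _).trans (le_add_of_nonneg_of_le hε.le ?_)
    rw [inv_mul_eq_div, one_le_div hεs]
    exact (Real.rpow_le_rpow hε.le h hs.le).trans h1

/-- Leaves with |β_j| < δ contribute at most ε in total, because ∑ |β_j|^α = 1; on the others I ≤ C
≤ (C/δ^α)|β_j|^α, which reduces to the decaying power sum. -/
lemma tendsto_expectSum (hp : 0 < p) {I : ℝ → ℝ} (hIm : Measurable I) (hI : ∀ q, 0 ≤ I q)
    {C : ℝ} (hC : ∀ q, I q ≤ C) (hI0 : Tendsto I (𝓝 0) (𝓝 0)) :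
    Tendsto (fun t => expectSum p t fun q => q ^ alpha p * I q) atTop (𝓝 0) := by
  have hC0 : 0 ≤ C := (hI 0).trans (hC 0)
  refine tendsto_zero_of_le_add_exp (κ := 1 - 2 * constA 4)
    (by rw [one_sub_two_mul_constA_four]; norm_num)
    (fun t _ => integral_nonneg fun ω => sum_abs_rpow_mul_nonneg hI _ _) fun ε hε => ?_
  obtain ⟨δ, hδ, hδ'⟩ := Metric.eventually_nhds_iff.1 (hI0.eventually_le_const hε)
  have hδα : 0 < δ ^ alpha p := by positivity
  refine ⟨C / δ ^ alpha p, fun t ht => ?_⟩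
  have := isProbabilityMeasure_treeAngleLaw ht
  have hi := integrable_sum_abs_rpow_weights hp ht
  rw [← integral_sum_abs_rpow_weights hp ht, expectSum, ← integral_const_mul]
  have hconst : ∫ _, ε ∂(treeAngleLaw t) = ε := by simp
  conv_rhs => rw [← hconst]
  rw [← integral_add (integrable_const ε) (hi.const_mul _)]
  refine integral_mono (integrable_sum_abs_rpow_mul_weights hp ht hIm hI hC)
    ((integrable_const ε).add (hi.const_mul _)) fun ω => ?_
  simp only
  have hterm : ∀ b : ℝ, |b| ^ alpha p * I |b|
      ≤ ε * |b| ^ alpha p + C / δ ^ alpha p * |b| ^ (2 * alpha p) := by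
    intro b
    have hb0 : 0 ≤ |b| ^ alpha p := by positivity
    rcases lt_or_ge |b| δ with h | h
    · have h1 : I |b| ≤ ε := hδ' (by simpa using h)
      have h2 : 0 ≤ C / δ ^ alpha p * |b| ^ (2 * alpha p) := by positivity
      nlinarith
    · have hb : 0 < |b| := hδ.trans_le h
      have h1 : δ ^ alpha p ≤ |b| ^ alpha p := Real.rpow_le_rpow hδ.le h (alpha_pos hp).le
      have h2 : C ≤ C / δ ^ alpha p * |b| ^ alpha p := by
        rw [div_mul_eq_mul_div, le_div_iff₀ hδα]
        gcongr
      have e : |b| ^ (2 * alpha p) = |b| ^ alpha p * |b| ^ alpha p := by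
        rw [← Real.rpow_add hb, two_mul]
      rw [e]
      have h3 : 0 ≤ ε * |b| ^ alpha p := by positivity
      have h4 := mul_le_mul_of_nonneg_left ((hC |b|).trans h2) hb0
      linarith
  refine (sum_map_le_of_le hterm).trans_eq ?_
  rw [List.sum_map_add, List.sum_map_mul_left, List.sum_map_mul_left, sum_abs_rpow_weights hp,
    mul_one]

end

/-! ### The bound and its limit -/

section

variable {p a₀ η d c : ℝ} {G μ₀ : Measure ℝ} [IsProbabilityMeasure G] [IsProbabilityMeasure μ₀]

omit [IsProbabilityMeasure G] [IsProbabilityMeasure μ₀] in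
lemma kolmogorovBound_eq (t : ℝ) : kolmogorovBound c p a₀ G μ₀ η d t =
    2 / Real.pi * expectSum p t (fun q => q ^ alpha p * integralH (alpha p) a₀ η μ₀ q)
    + c * densitySupNorm G / dTilde (alpha p) a₀ μ₀ d * expectMax p t
    + 8 / (5 * Real.pi) * constM (alpha p) a₀ μ₀ ^ 2 * constN (alpha p) a₀ η (2 * alpha p) *
        Real.exp (-(t * (1 - 2 * constA 4)))
    + 64 / (25 * Real.pi) * constM (alpha p) a₀ μ₀ ^ 4 * constN (alpha p) a₀ η (4 * alpha p) *
        Real.exp (-(t * (1 - 2 * constA 6)))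
    + Real.exp (-t) / 2 * asymmetry μ₀ := rfl

lemma constN_nonneg (α a₀ η l : ℝ) : 0 ≤ constN α a₀ η l := by
  refine setIntegral_nonneg measurableSet_Ioi fun ξ hξ => ?_
  have : 0 < ξ := hξ
  positivity

/-- The law of the weighted sum is a mixture over the weights, so at each x the difference from G is
bounded by the mean of the conditional bounds. These are linear in the functionals of the weights,
hence the sign of c plays no role. -/
lemma kolmogorovDist_le_kolmogorovBound (hc : IsBerryEsseenConstant c) (hp : 0 < p) (ha₀ : 0 < a₀)
    (hη : η < a₀) (hG : IsSymmetricStable (alpha p) a₀ G) {B : ℝ}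
    (hB : ∀ ξ, |vStar (alpha p) a₀ μ₀ ξ| ≤ B) (hd : IsAdmissible (alpha p) a₀ μ₀ η d)
    {μ : ℝ → Measure ℝ} [∀ t, IsProbabilityMeasure (μ t)] (hμ : IsSolution p μ₀ μ) {t : ℝ}
    (ht : 0 ≤ t) : kolmogorovDist (μ t) G ≤ kolmogorovBound c p a₀ G μ₀ η d t := by
  have := isProbabilityMeasure_treeAngleLaw ht
  have hα := alpha_pos hp
  obtain ⟨C, hC0, hC⟩ := exists_integralH_le hα hη hB
  have hi1 := (integrable_sum_abs_rpow_mul_weights hp ht measurable_integralH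
    (integralH_nonneg (α := alpha p) (a₀ := a₀) (η := η) (μ₀ := μ₀)) hC).const_mul (2 / Real.pi)
  have hi2 := (integrable_maxAbs_weights hp ht).const_mul
    (c * densitySupNorm G / dTilde (alpha p) a₀ μ₀ d)
  have hi3 := (integrable_sum_abs_rpow_weights hp ht).const_mul
    (8 / (5 * Real.pi) * constM (alpha p) a₀ μ₀ ^ 2 * constN (alpha p) a₀ η (2 * alpha p))
  have hi12 : Integrable (fun ω : BinaryTree Unit × (ℕ → ℝ) => 2 / Real.pi *
      ((weights p ω.1 ω.2).map fun b => |b| ^ alpha p * integralH (alpha p) a₀ η μ₀ |b|).sum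
      + c * densitySupNorm G / dTilde (alpha p) a₀ μ₀ d * maxAbs (weights p ω.1 ω.2))
      (treeAngleLaw t) := hi1.add hi2
  refine ciSup_le fun x => ?_
  have hwild : |cdf (wildLaw p (symmetrized μ₀) t) x - cdf G x| ≤
      2 / Real.pi * expectSum p t (fun q => q ^ alpha p * integralH (alpha p) a₀ η μ₀ q)
      + c * densitySupNorm G / dTilde (alpha p) a₀ μ₀ d * expectMax p t
      + 8 / (5 * Real.pi) * constM (alpha p) a₀ μ₀ ^ 2 * constN (alpha p) a₀ η (2 * alpha p) *
        Real.exp (-(t * (1 - 2 * constA 4))) := by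
    rw [← integral_sum_abs_rpow_weights hp ht, expectSum, expectMax, ← integral_const_mul,
      ← integral_const_mul, ← integral_const_mul, ← integral_add hi1 hi2,
      ← integral_add hi12 hi3]
    have hconst : ∫ _, cdf G x ∂(treeAngleLaw t) = cdf G x := by simp
    have hi : Integrable (fun ω : BinaryTree Unit × (ℕ → ℝ) =>
        cdf (listLaw (symmetrized μ₀) (weights p ω.1 ω.2)) x) (treeAngleLaw t) := by
      refine Integrable.of_bound (measurable_cdf_listLaw_weights x).aestronglyMeasurable 1
        (Eventually.of_forall fun ω => ?_)
      rw [Real.norm_of_nonneg (cdf_nonneg _ _)]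
      exact cdf_le_one _ _
    conv_lhs => rw [cdf_wildLaw ht, ← hconst, ← integral_sub hi (integrable_const _)]
    rw [← Real.norm_eq_abs]
    refine norm_integral_le_of_norm_le (hi12.add hi3) (Eventually.of_forall fun ω => ?_)
    exact (abs_cdf_sub_cdf_le _ _ x).trans (kolmogorovDist_listLaw_le hc hα ha₀ hη hG hB hd
      (sum_abs_rpow_weights hp _ _) (maxAbs_weights_pos hp _ _))
  have hsol : |cdf (μ t) x - cdf (wildLaw p (symmetrized μ₀) t) x|
      ≤ Real.exp (-t) / 2 * asymmetry μ₀ := by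
    rw [hμ.cdf_sub_cdf_wildLaw ht, abs_mul, abs_of_pos (by positivity)]
    exact mul_le_mul_of_nonneg_left (abs_le_asymmetry x) (by positivity)
  have htri := abs_sub_le (cdf (μ t) x) (cdf (wildLaw p (symmetrized μ₀) t) x) (cdf G x)
  -- The A_6 term does not arise in the estimate; being nonnegative, it may be added.
  have h4 : 0 ≤ 64 / (25 * Real.pi) * constM (alpha p) a₀ μ₀ ^ 4 *
      constN (alpha p) a₀ η (4 * alpha p) * Real.exp (-(t * (1 - 2 * constA 6))) := by
    have h5 := constN_nonneg (alpha p) a₀ η (4 * alpha p)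
    have h6 := constM_pos (α := alpha p) (μ₀ := μ₀) ha₀
    positivity
  rw [kolmogorovBound_eq]
  linarith

omit [IsProbabilityMeasure G] in
lemma tendsto_kolmogorovBound (hp : 0 < p) (hη : η < a₀) {B : ℝ}
    (hB : ∀ ξ, |vStar (alpha p) a₀ μ₀ ξ| ≤ B)
    (hv : Tendsto (vStar (alpha p) a₀ μ₀) (𝓝 0) (𝓝 0)) :
    Tendsto (fun t => kolmogorovBound c p a₀ G μ₀ η d t) atTop (𝓝 0) := by
  have hα := alpha_pos hp
  obtain ⟨C, hC0, hC⟩ := exists_integralH_le hα hη hB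
  have h1 := tendsto_expectSum hp measurable_integralH
    (integralH_nonneg (α := alpha p) (a₀ := a₀) (η := η) (μ₀ := μ₀)) hC
    (tendsto_integralH hα hη hB hv)
  have h2 := tendsto_expectMax hp
  have hexp : ∀ κ : ℝ, 0 < κ → Tendsto (fun t : ℝ => Real.exp (-(t * κ))) atTop (𝓝 0) :=
    fun κ hκ => Real.tendsto_exp_neg_atTop_nhds_zero.comp (tendsto_id.atTop_mul_const hκ)
  have h3 := hexp (1 - 2 * constA 4) (by rw [one_sub_two_mul_constA_four]; norm_num)
  have h4 := hexp (1 - 2 * constA 6) (by rw [one_sub_two_mul_constA_six]; norm_num)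
  have h5 := Real.tendsto_exp_neg_atTop_nhds_zero
  have h := ((((h1.const_mul (2 / Real.pi)).add
    (h2.const_mul (c * densitySupNorm G / dTilde (alpha p) a₀ μ₀ d))).add
    (h3.const_mul (8 / (5 * Real.pi) * constM (alpha p) a₀ μ₀ ^ 2 *
      constN (alpha p) a₀ η (2 * alpha p)))).add
    (h4.const_mul (64 / (25 * Real.pi) * constM (alpha p) a₀ μ₀ ^ 4 *
      constN (alpha p) a₀ η (4 * alpha p)))).add
    ((h5.div_const 2).mul_const (asymmetry μ₀))
  simp only [mul_zero, zero_div, zero_mul, add_zero] at h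
  exact h

end

end InelasticKac

theorem theorem4 :
    (∃ c : ℝ, InelasticKac.IsBerryEsseenConstant c) ∧
    ∀ c : ℝ, InelasticKac.IsBerryEsseenConstant c →
    ∀ (p a₀ : ℝ), 0 < p → 0 < a₀ →
    ∀ (G μ₀ : Measure ℝ) [IsProbabilityMeasure G] [IsProbabilityMeasure μ₀],
      InelasticKac.IsSymmetricStable (InelasticKac.alpha p) a₀ G →
      InelasticKac.InDomainOfNormalAttraction (InelasticKac.alpha p) μ₀ G →
    ∀ (μ : ℝ → Measure ℝ) [∀ t, IsProbabilityMeasure (μ t)],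
      InelasticKac.IsSolution p μ₀ μ →
    ∀ η ∈ Set.Ioo (0 : ℝ) a₀,
      (∃ d : ℝ, InelasticKac.IsAdmissible (InelasticKac.alpha p) a₀ μ₀ η d) ∧
      ∀ d : ℝ, InelasticKac.IsAdmissible (InelasticKac.alpha p) a₀ μ₀ η d →
        (∀ t : ℝ, 0 ≤ t →
          InelasticKac.kolmogorovDist (μ t) G ≤
            InelasticKac.kolmogorovBound c p a₀ G μ₀ η d t) ∧
        Filter.Tendsto (fun t : ℝ => InelasticKac.kolmogorovBound c p a₀ G μ₀ η d t)
          Filter.atTop (nhds 0) := by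
  refine ⟨InelasticKac.exists_isBerryEsseenConstant, ?_⟩
  intro c hc p a₀ hp ha₀ G μ₀ _ _ hG hD μ _ hμ η hη
  have hα := InelasticKac.alpha_pos hp
  have hα2 := InelasticKac.alpha_lt_two hp
  have hv := InelasticKac.tendsto_vStar hα hα2 hG hD
  obtain ⟨B, hB⟩ := InelasticKac.exists_abs_vStar_le hα hα2 ha₀ hG hD
  refine ⟨InelasticKac.exists_isAdmissible hα ha₀ hη.1 hv, fun d hd => ⟨fun t ht => ?_, ?_⟩⟩
  · exact InelasticKac.kolmogorovDist_le_kolmogorovBound hc hp ha₀ hη.2 hG hB hd hμ ht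
  · exact InelasticKac.tendsto_kolmogorovBound hp hη.2 hB hv
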